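/- Setting. Let $K$ be a Lie group acting smoothly on a smooth manifold $X$, and let $Y\subset X$ be an embedded submanifold, possibly with boundary (or corners), with interior $Y^\circ$ ($Y$ minus its boundary), that is transversal to the action: $Ky\cap Y=\{y\}$ for every $y\in Y$, $X=\bigcup_{y\in Y}Ky$, and $T_yX=T_yY+T_y(Ky)$ for $y\in Y^\circ$. Assume that the isotropy group $\{k\in K:\ ky=y\}$ is the same compact subgroup $M$ of $K$ for all $y\in Y^\circ$. Then $X^\circ=\bigcup_{y\in Y^\circ}Ky$ is open and $X^\circ=Y^\circ\times(K/M)$, where $(y,kM)$ corresponds to $ky$, which is also written $zy$ with $z=kM$. Let $x_t$ be a $K$-invariant Markov process in $X$: there are sub-probability kernels $P_t$ on $X$ with $P_0(x,\cdot)=\delta_x$, $P_{t+s}=P_tP_s$ and $P_t(f\circ k)=(P_tf)\circ k$ for $f\in C_b(X)$, $k\in K$, and, for each $x\in X$, a probability measure $P_x$ under which $x_0=x$ almost surely and $E_x[f(x_{t+s})\mid \sigma(x_u;u\le t)]=P_sf(x_t)$ for all $s,t\ge 0$ and $f\in C_b(X)$; the paths are right continuous with left limits (rcll) in $X$ up to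 a possibly finite life time $\xi$, after which $x_t$ is at a cemetery, where functions on $X$ are set to $0$. Let $\zeta=\inf\{t>0:\ x_t\notin X^\circ,\ x_{t-}\notin X^\circ\text{ or }t\ge\xi\}$ with $\inf\emptyset=\infty$. For $x_0\in X^\circ$ and $t<\zeta$ write $x_t=z_ty_t$ with the radial part $y_t\in Y^\circ$ and the angular part $z_t\in K/M$. Fix $T>0$. Let $D_T(E)$ be the space of rcll maps $[0,T]\to E$ with the $\sigma$-algebra generated by the evaluation maps, let $\mathcal F^Y_{s,t}=\sigma\{y_u;\ s\le u\le t\}$ on $D_T(Y^\circ)$, and for $y\in Y^\circ$ let $JP_y$ be the law on $D_T(Y^\circ)$ of the radial path on the event $[\zeta>T]$ under $P_y$. A conditional distribution of the angular process is a probability kernel $R_z^{y(\cdot)}$ from $D_T(Y^\circ)\times(K/M)$ to $D_T(K/M)$ such that, for every $x=kp\in X^\circ$ with $k\in K$, $p\in Y^\circ$, and every measurable $F\subset D_T(K/M)$, $P_x$-almost surely on $[\zeta>T]$, $R_{kM}^{y(\cdot)}(F)$ is the conditional probability under $P_x$ of $z(\cdot)\in F$ given the radial path $y(\cdot)$ on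 $[0,T]$. A process $z_t$, $0\le t\le T$, in $K/M$ with rcll paths is a nonhomogeneous Lévy process with increment distributions $\mu_{s,t}$ if $\mu_{s,t}$, $0\le s\le t\le T$, are $M$-invariant probability measures on $K/M$ with $\mu_{t,t}=\delta_{eM}$, $\mu_{s,t}*\mu_{t,u}=\mu_{s,u}$ for $s\le t\le u$, and $\mu_{s,t}\to\mu_{s,s}$ weakly as $t\downarrow s$, and if there is a probability measure $\mu_0$ on $K/M$ such that for all $n\ge 0$, all $0<t_1<\dots<t_n\le T$ and all nonnegative $f\in C_b((K/M)^{n+1})$ $$E f(z_0,z_{t_1},\dots,z_{t_n})=\int f(z_0,z_0z_1,\dots,z_0z_1\cdots z_n)\,\mu_0(dz_0)\,\mu_{0,t_1}(dz_1)\cdots\mu_{t_{n-1},t_n}(dz_n),$$ where $z_0z_1\cdots z_i=S(z_0)\cdots S(z_{i-1})z_i$ and $\mu*\nu(f)=\int\int f(S(z)z')\,\nu(dz')\,\mu(dz)$ for any section $S$ of $K\to K/M$ (as iterated integrals these do not depend on $S$, because the measures are $M$-invariant). Theorem 3. A conditional distribution $R_z^{y(\cdot)}$ of the angular process exists. For every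 such $R$ there are measures $\mu_{s,t}=\mu_{s,t}^{y(\cdot)}$ on $K/M$, for $0\le s\le t\le T$ and $y(\cdot)\in D_T(Y^\circ)$, not depending on the starting point, such that (a) for all $y\in Y^\circ$ and $z\in K/M$ and for $JP_y$-almost all $y(\cdot)$, the angular process $z_t$, $0\le t\le T$, is under $R_z^{y(\cdot)}$ a nonhomogeneous Lévy process in $K/M$ with the $M$-invariant increment distributions $\mu_{s,t}^{y(\cdot)}$; (b) for all $0\le s\le t\le T$, the random measure $\mu_{s,t}$ is $\mathcal F^Y_{s,t}$-measurable up to null sets: there is an $\mathcal F^Y_{s,t}$-measurable random measure that equals $\mu_{s,t}$ almost surely under $JP_y$ for every $y\in Y^\circ$. -/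

import Mathlib

open MeasureTheory ProbabilityTheory Filter Set Topology
open scoped Manifold ContDiff NNReal ENNReal BoundedContinuousFunction

noncomputable section

namespace AngularPart

/-! ### Right continuous paths with left limits -/

/-- A function on `[0, T]` that is right continuous and has left limits. -/
def IsRcll {T : ℝ≥0} {E : Type*} [TopologicalSpace E] (f : Icc (0 : ℝ≥0) T → E) : Prop :=
  ∀ t, ContinuousWithinAt f (Ici t) t ∧ ∃ l, Tendsto f (𝓝[<] t) (𝓝 l)

/-- The space `D_T(E)` of rcll maps `[0, T] → E`. Its σ-algebra (the subtype of the product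
σ-algebra) is the one generated by the evaluation maps; for separable metrizable `E` this is the
Borel σ-algebra of the Skorohod topology. -/
abbrev RcllPath (T : ℝ≥0) (E : Type*) [TopologicalSpace E] : Type _ :=
  {f : Icc (0 : ℝ≥0) T → E // IsRcll f}

/-- The σ-algebra `F_{s,t} = σ{f(u); s ≤ u ≤ t}` on `D_T(E)`. -/
@[reducible] def evalSigma {T : ℝ≥0} (E : Type*) [TopologicalSpace E] [MeasurableSpace E]
    (s t : Icc (0 : ℝ≥0) T) : MeasurableSpace (RcllPath T E) :=
  ⨆ u : Icc s t, MeasurableSpace.comap (fun f : RcllPath T E => f.1 u) inferInstance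

/-- A path `[0, ∞) → X ∪ {∞}` with a possibly finite life time: it stays at the cemetery `∞` once
it is there, it is right continuous, and up to its life time it has left limits in `X`. -/
structure IsRcllWithLifetime {X : Type*} [TopologicalSpace X] (w : ℝ≥0 → OnePoint X) : Prop where
  absorbed : ∀ s t, s ≤ t → w s = OnePoint.infty → w t = OnePoint.infty
  right_cont : ∀ t, ContinuousWithinAt w (Ici t) t
  left_lim : ∀ t, w t ≠ OnePoint.infty → ∃ a : X, Tendsto w (𝓝[<] t) (𝓝 (a : OnePoint X))

/-- The life time of a path. -/
def lifetime {X : Type*} (w : ℝ≥0 → OnePoint X) : ℝ≥0∞ :=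
  sInf {t | ∃ s : ℝ≥0, t = s ∧ w s = OnePoint.infty}

/-- The exit time `ζ = inf {s > 0; w_s ∉ O, w_{s-} ∉ O or s ≥ lifetime}` of a path from `O ⊆ X`
(`ζ = ⊤` if the set is empty). -/
def exitTime {X : Type*} [TopologicalSpace X] (O : Set X) (w : ℝ≥0 → OnePoint X) : ℝ≥0∞ :=
  sInf {t | ∃ s : ℝ≥0, t = s ∧ 0 < s ∧
    (w s ∉ ((↑) : X → OnePoint X) '' O ∨
      (¬ ∃ a ∈ O, Tendsto w (𝓝[<] s) (𝓝 (a : OnePoint X))) ∨ lifetime w ≤ s)}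

/-- The path starts in `O` and `ζ > T`. -/
def Survives {X : Type*} [TopologicalSpace X] (O : Set X) (T : ℝ≥0) (w : ℝ≥0 → OnePoint X) :
    Prop :=
  w 0 ∈ ((↑) : X → OnePoint X) '' O ∧ (T : ℝ≥0∞) < exitTime O w

/-! Helper facts: the event `ζ > T` is measurable. -/

theorem not_exit {X : Type*} [TopologicalSpace X] {O : Set X} {T : ℝ≥0} {w : ℝ≥0 → OnePoint X} (hs : Survives O T w) (t : ℝ≥0)
    (ht : t ≤ T) : w t ∈ ((↑) : X → OnePoint X) '' O ∧
      (0 < t → ∃ a ∈ O, Tendsto w (𝓝[<] t) (𝓝 (a : OnePoint X))) := by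
  rcases eq_zero_or_pos t with rfl | h0
  · exact ⟨hs.1, fun h => absurd h (lt_irrefl _)⟩
  · have : ¬ (w t ∉ ((↑) : X → OnePoint X) '' O ∨
      (¬ ∃ a ∈ O, Tendsto w (𝓝[<] t) (𝓝 (a : OnePoint X))) ∨ lifetime w ≤ t) := by
      intro hb
      have h1 : exitTime O w ≤ t := sInf_le ⟨t, rfl, h0, hb⟩
      exact absurd (hs.2.trans_le (h1.trans (by exact_mod_cast ht))) (lt_irrefl _)
    push Not at this
    exact ⟨this.1, fun _ => this.2.1⟩


theorem exists_compact_of_survives {X : Type*} [TopologicalSpace X] {O : Set X}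
    (C : CompactExhaustion O) {T : ℝ≥0} (hO : IsOpen O)
    {w : ℝ≥0 → OnePoint X} (hw : IsRcllWithLifetime w) (hs : Survives O T w) :
    ∃ m, ∀ t ≤ T, w t ∈ (fun a : O => ((a : X) : OnePoint X)) '' C m := by
  set j : O → OnePoint X := fun a : O => ((a : X) : OnePoint X) with hj
  have hjo : IsOpenEmbedding j := OnePoint.isOpenEmbedding_coe.comp hO.isOpenEmbedding_subtypeVal
  have hnb : ∀ a : O, ∃ m, j '' C m ∈ 𝓝 (j a) := by
    intro a
    obtain ⟨m, hm⟩ := C.exists_mem_nhds a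
    exact ⟨m, hjo.image_mem_nhds.2 hm⟩
  have key : ∃ m, ∀ t ∈ Icc 0 T, w t ∈ j '' C m := by
    refine (isCompact_Icc (a := (0 : ℝ≥0)) (b := T)).induction_on
      (p := fun A => ∃ m, ∀ t ∈ A, w t ∈ j '' C m) ⟨0, by simp⟩ ?_ ?_ ?_
    · rintro A B hAB ⟨m, hm⟩
      exact ⟨m, fun t ht => hm t (hAB ht)⟩
    · rintro A B ⟨m, hm⟩ ⟨m', hm'⟩
      refine ⟨max m m', fun t ht => ?_⟩
      rcases ht with ht | ht
      · exact image_mono (C.subset (le_max_left _ _)) (hm t ht)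
      · exact image_mono (C.subset (le_max_right _ _)) (hm' t ht)
    · intro t ht
      obtain ⟨⟨a, ha, hat⟩, hlt⟩ := not_exit hs t ht.2
      obtain ⟨m, hm⟩ := hnb ⟨a, ha⟩
      have hright : ∀ᶠ u in 𝓝[≥] t, w u ∈ j '' C m := by
        refine (hw.right_cont t).tendsto ?_
        rw [← hat]
        exact hm
      have hleft : ∃ m', ∀ᶠ u in 𝓝[<] t, w u ∈ j '' C m' := by
        rcases eq_zero_or_pos t with rfl | h0
        · exact ⟨0, by simp⟩
        · obtain ⟨b, hb, hbt⟩ := hlt h0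
          obtain ⟨m', hm'⟩ := hnb ⟨b, hb⟩
          exact ⟨m', hbt hm'⟩
      obtain ⟨m', hleft⟩ := hleft
      refine ⟨{u | w u ∈ j '' C (max m m')}, mem_nhdsWithin_of_mem_nhds ?_, max m m',
        fun u hu => hu⟩
      rw [← nhdsLT_sup_nhdsGE]
      refine mem_sup.2 ⟨?_, ?_⟩
      · filter_upwards [hleft] with u hu using image_mono (C.subset (le_max_right _ _)) hu
      · filter_upwards [hright] with u hu using image_mono (C.subset (le_max_left _ _)) hu
  obtain ⟨m, hm⟩ := key
  exact ⟨m, fun t ht => hm t ⟨zero_le, ht⟩⟩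

theorem survives_of_compact {X : Type*} [TopologicalSpace X] {O C C' : Set X} {T : ℝ≥0}
    (hC : IsClosed (((↑) : X → OnePoint X) '' C)) (hC' : IsClosed (((↑) : X → OnePoint X) '' C'))
    (hCC' : C ⊆ interior C') (hO : C' ⊆ O)
    {w : ℝ≥0 → OnePoint X} (hw : IsRcllWithLifetime w) {D : Set ℝ≥0} (hD : Dense D)
    (hwD : ∀ t ∈ D, t < T → w t ∈ ((↑) : X → OnePoint X) '' C)
    (hwT : w T ∈ ((↑) : X → OnePoint X) '' C) : Survives O T w := by
  have h1 : ∀ t ≤ T, w t ∈ ((↑) : X → OnePoint X) '' C := by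
    intro t ht
    rcases ht.eq_or_lt with rfl | ht
    · exact hwT
    · have hfr : ∃ᶠ u in 𝓝[≥] t, w u ∈ ((↑) : X → OnePoint X) '' C := by
        rw [frequently_iff]
        intro U hU
        obtain ⟨b, hb, hbU⟩ := (mem_nhdsGE_iff_exists_Ico_subset' ht).1 hU
        obtain ⟨u, hu, hu'⟩ := hD.exists_between (show t < min b T from lt_min hb ht)
        exact ⟨u, hbU ⟨hu'.1.le, hu'.2.trans_le (min_le_left _ _)⟩,
          hwD u hu (hu'.2.trans_le (min_le_right _ _))⟩
      exact hC.mem_of_frequently_of_tendsto hfr (hw.right_cont t).tendsto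
  have h2 : ∃ b > T, ∀ t < b, w t ∈ ((↑) : X → OnePoint X) '' C' := by
    obtain ⟨a, ha, hat⟩ := hwT
    have : ((↑) : X → OnePoint X) '' C' ∈ 𝓝 (w T) := by
      rw [← hat]
      exact OnePoint.isOpenEmbedding_coe.image_mem_nhds.2 (mem_interior_iff_mem_nhds.1 (hCC' ha))
    obtain ⟨b, hb, hbU⟩ := (mem_nhdsGE_iff_exists_Ico_subset' (lt_add_one T)).1
      ((hw.right_cont T).tendsto this)
    refine ⟨b, hb, fun t ht => ?_⟩
    rcases le_total t T with h | h
    · exact image_mono (hCC'.trans interior_subset) (h1 t h)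
    · exact hbU ⟨h, ht⟩
  obtain ⟨b, hb, hbC⟩ := h2
  have hlife : (b : ℝ≥0∞) ≤ lifetime w := by
    refine le_sInf ?_
    rintro _ ⟨s, rfl, hs⟩
    by_contra hlt
    push Not at hlt
    obtain ⟨a, -, ha⟩ := hbC s (by exact_mod_cast hlt)
    rw [hs] at ha
    exact OnePoint.coe_ne_infty a ha
  refine ⟨image_mono (hCC'.trans (interior_subset.trans hO)) (h1 0 zero_le), ?_⟩
  refine lt_of_lt_of_le (b := (b : ℝ≥0∞)) (by exact_mod_cast hb) (le_sInf ?_)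
  rintro _ ⟨s, rfl, h0, hs⟩
  by_contra hlt
  push Not at hlt
  have hsb : s < b := by exact_mod_cast hlt
  rcases hs with hs | hs | hs
  · exact hs (image_mono hO (hbC s hsb))
  · apply hs
    have hne : w s ≠ OnePoint.infty := by
      obtain ⟨a, -, ha⟩ := hbC s hsb
      rw [← ha]
      exact OnePoint.coe_ne_infty a
    obtain ⟨a, ha⟩ := hw.left_lim s hne
    have hnb : (𝓝[<] s).NeBot := nhdsLT_neBot_of_exists_lt ⟨0, h0⟩
    have : ((a : X) : OnePoint X) ∈ ((↑) : X → OnePoint X) '' C' := by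
      refine hC'.mem_of_tendsto ha ?_
      filter_upwards [self_mem_nhdsWithin] with u hu
      exact hbC u ((show u < s from hu).trans hsb)
    obtain ⟨a', ha', he⟩ := this
    rw [OnePoint.coe_injective he] at ha'
    exact ⟨a, hO ha', ha⟩
  · exact absurd (hlife.trans hs) (not_le.2 hlt)

/-- The event that the path starts in `O` and `ζ > T` is measurable. -/
theorem measurableSet_survives {X : Type*} [TopologicalSpace X] [T2Space X]
    [LocallyCompactSpace X] [SecondCountableTopology X] {Ω : Type*} [MeasurableSpace Ω]
    {x : ℝ≥0 → Ω → OnePoint X} (hm : ∀ t, Measurable[_, borel (OnePoint X)] (x t))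
    (hx : ∀ θ, IsRcllWithLifetime (fun t => x t θ)) {O : Set X} (hO : IsOpen O) (T : ℝ≥0) :
    MeasurableSet {θ | Survives O T (fun t => x t θ)} := by
  have : LocallyCompactSpace O := hO.locallyCompactSpace
  let C : CompactExhaustion O := CompactExhaustion.choice O
  obtain ⟨D, hDc, hD⟩ := TopologicalSpace.exists_countable_dense ℝ≥0
  have hcl : ∀ m, IsClosed (((↑) : X → OnePoint X) '' (((↑) : O → X) '' C m)) := fun m =>
    (((C.isCompact m).image continuous_subtype_val).image OnePoint.continuous_coe).isClosed
  have heq : {θ | Survives O T (fun t => x t θ)} = ⋃ m, ⋂ t ∈ insert T (D ∩ Iio T),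
      x t ⁻¹' (((↑) : X → OnePoint X) '' (((↑) : O → X) '' C m)) := by
    ext θ
    simp only [Set.mem_ofPred_eq, mem_iUnion, mem_iInter, mem_preimage]
    constructor
    · intro hs
      obtain ⟨m, hm⟩ := exists_compact_of_survives C hO (hx θ) hs
      refine ⟨m, fun t ht => ?_⟩
      have htT : t ≤ T := by
        rcases ht with rfl | ht
        · exact le_rfl
        · exact ht.2.le
      rw [image_image]
      exact hm t htT
    · rintro ⟨m, hm⟩
      refine survives_of_compact (hcl m) (hcl (m + 1)) ?_ (Subtype.coe_image_subset _ _) (hx θ) hD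
        (fun t ht htT => hm t (Or.inr ⟨ht, htT⟩)) (hm T (Or.inl rfl))
      have := hO.isOpenEmbedding_subtypeVal.isOpenMap.image_interior_subset (C (m + 1))
      exact (image_mono (C.subset_interior_succ m)).trans this
  rw [heq]
  refine MeasurableSet.iUnion fun m => MeasurableSet.biInter
    ((hDc.mono inter_subset_left).insert T) fun t _ => ?_
  exact hm t (MeasurableSpace.measurableSet_generateFrom (isOpen_compl_iff.2 (hcl m))).of_compl

/-! ### Invariant Markov processes -/

section Markov

variable {X : Type*} [TopologicalSpace X] [MeasurableSpace X]
  {Ω : Type*} [MeasurableSpace Ω]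

/-- Extension of a function on `X` by `0` at the cemetery. -/
def extendZero (f : X → ℝ) (p : OnePoint X) : ℝ := p.elim 0 f

/-- `F_t = σ{x_u; u ≤ t}`. -/
@[reducible] def pastSigma (x : ℝ≥0 → Ω → OnePoint X) (t : ℝ≥0) : MeasurableSpace Ω :=
  ⨆ u : Iic t, MeasurableSpace.comap (x u) (borel (OnePoint X))

/-- A semigroup of sub-probability kernels. -/
structure IsSubMarkovSemigroup (P : ℝ≥0 → Kernel X X) : Prop where
  le_one : ∀ t a, P t a univ ≤ 1
  zero : ∀ a, P 0 a = Measure.dirac a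
  add : ∀ s t a (B : Set X), MeasurableSet B → P (t + s) a B = ∫⁻ b, P s b B ∂(P t a)

/-- `K`-invariance of a transition semigroup: `P_t (f ∘ k) = (P_t f) ∘ k`. -/
def IsInvariantSemigroup (K : Type*) [SMul K X] (P : ℝ≥0 → Kernel X X) : Prop :=
  ∀ (t : ℝ≥0) (f : X →ᵇ ℝ) (k : K) (a : X), ∫ b, f (k • b) ∂(P t a) = ∫ b, f b ∂(P t (k • a))

/-- The process `x` on `Ω`, with rcll paths and possibly finite life time, is under `Pr a`, for
every `a ∈ X`, a Markov process with transition semigroup `P` that starts at `a`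
(simple Markov property). -/
structure IsMarkovProcess (P : ℝ≥0 → Kernel X X) (x : ℝ≥0 → Ω → OnePoint X)
    (Pr : X → Measure Ω) : Prop where
  semigroup : IsSubMarkovSemigroup P
  isProb : ∀ a, IsProbabilityMeasure (Pr a)
  measurable : ∀ t, Measurable[_, borel (OnePoint X)] (x t)
  rcll : ∀ θ, IsRcllWithLifetime (fun t => x t θ)
  start : ∀ a : X, ∀ᵐ θ ∂(Pr a), x 0 θ = (a : OnePoint X)
  markov : ∀ (a : X) (s t : ℝ≥0) (f : X →ᵇ ℝ),
    (Pr a)[fun θ => extendZero f (x (t + s) θ) | pastSigma x t]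
      =ᵐ[Pr a] fun θ => extendZero (fun b => ∫ c, f c ∂(P s b)) (x t θ)

end Markov

/-! ### Nonhomogeneous Lévy processes in `K/M` -/

section Levy

variable {K : Type*} [Group K] {M : Subgroup K}

/-- A section map of `K → K/M`. All integrals below are integrals of measures that are invariant
under `M`, so they do not depend on the section map, and no regularity of it is needed. -/
def IsSection (S : K ⧸ M → K) : Prop := ∀ z, ((S z : K) : K ⧸ M) = z

variable [TopologicalSpace K] [MeasurableSpace (K ⧸ M)]

/-- A continuous two-parameter convolution semigroup `μ_{s,t}`, `0 ≤ s ≤ t ≤ T`, of `M`-invariant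
probability measures on `K/M`. -/
structure IsConvolutionSemigroup {T : ℝ≥0}
    (μ : Icc (0 : ℝ≥0) T → Icc (0 : ℝ≥0) T → Measure (K ⧸ M)) : Prop where
  isProb : ∀ s t, s ≤ t → IsProbabilityMeasure (μ s t)
  invariant : ∀ s t, s ≤ t → ∀ m ∈ M, (μ s t).map (fun z => m • z) = μ s t
  diag : ∀ t, μ t t = Measure.dirac ((1 : K) : K ⧸ M)
  conv : ∀ s t u, s ≤ t → t ≤ u → ∀ S : K ⧸ M → K, IsSection S → ∀ f : K ⧸ M →ᵇ ℝ≥0,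
    ∫⁻ z, (f z : ℝ≥0∞) ∂(μ s u)
      = ∫⁻ z₁, ∫⁻ z₂, (f (S z₁ • z₂) : ℝ≥0∞) ∂(μ t u) ∂(μ s t)
  cont : ∀ s (f : K ⧸ M →ᵇ ℝ),
    Tendsto (fun t => ∫ z, f z ∂(μ s t)) (𝓝[>] s) (𝓝 (∫ z, f z ∂(μ s s)))

/-- The iterated integral
`∫ μ_{s,t₁}(dz₁) ∫ μ_{t₁,t₂}(dz₂) ⋯ ∫ μ_{t_{n-1},t_n}(dz_n) f(g z₁, g z₁ z₂, …, g z₁ z₂ ⋯ z_n)`,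
where `z₁ z₂ ⋯ z_i` stands for `S(z₁) S(z₂) ⋯ S(z_{i-1}) z_i`. -/
def incrementIntegral (S : K ⧸ M → K) {I : Type*} (μ : I → I → Measure (K ⧸ M)) :
    (n : ℕ) → (s : I) → (t : Fin n → I) → (g : K) → ((Fin n → K ⧸ M) → ℝ≥0∞) → ℝ≥0∞
  | 0, _, _, _, f => f Fin.elim0
  | n + 1, s, t, g, f =>
    ∫⁻ z, incrementIntegral S μ n (t 0) (Fin.tail t) (g * S z)
      (fun v => f (Fin.cons (g • z) v)) ∂(μ s (t 0))

/-- The coordinate process on `D_T(K/M)` is, under the law `Q`, a nonhomogeneous Lévy process in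
`K/M` whose increments have the distributions `μ_{s,t}`: these are a continuous two-parameter
convolution semigroup of `M`-invariant probability measures, and, for some initial distribution
`μ₀` and all `0 < t₁ < ⋯ < t_n ≤ T`,
`E f(z_0, z_{t₁}, …, z_{t_n}) = ∫ f(z₀, z₀ z₁, …, z₀ z₁ ⋯ z_n) μ₀(dz₀) μ_{0,t₁}(dz₁) ⋯
μ_{t_{n-1},t_n}(dz_n)`. -/
def IsNonhomogeneousLevy {T : ℝ≥0} (Q : Measure (RcllPath T (K ⧸ M)))
    (μ : Icc (0 : ℝ≥0) T → Icc (0 : ℝ≥0) T → Measure (K ⧸ M)) : Prop :=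
  IsConvolutionSemigroup μ ∧ ∃ μ₀ : Measure (K ⧸ M), IsProbabilityMeasure μ₀ ∧
    ∀ S : K ⧸ M → K, IsSection S → ∀ (n : ℕ) (t : Fin n → Icc (0 : ℝ≥0) T), StrictMono t →
      (∀ i, (0 : ℝ≥0) < t i) → ∀ f : (Fin (n + 1) → K ⧸ M) →ᵇ ℝ≥0,
        ∫⁻ q, (f (Fin.cons (q.1 ⟨0, left_mem_Icc.2 zero_le⟩) (fun i => q.1 (t i))) : ℝ≥0∞) ∂Q
          = ∫⁻ z₀, incrementIntegral S μ n ⟨0, left_mem_Icc.2 zero_le⟩ t (S z₀)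
              (fun v => (f (Fin.cons z₀ v) : ℝ≥0∞)) ∂μ₀

end Levy

/-! ### Submanifolds transversal to a group action -/

section Geometry

variable {n d : ℕ}
  {X : Type*} [TopologicalSpace X] [ChartedSpace (EuclideanSpace ℝ (Fin n)) X]
  {K : Type*} [TopologicalSpace K] [ChartedSpace (EuclideanSpace ℝ (Fin d)) K] [Group K]
  [MulAction K X]
  {EY HY : Type*} [NormedAddCommGroup EY] [NormedSpace ℝ EY] [TopologicalSpace HY]

/-- `Y` is a submanifold of `X`, possibly with boundary (and corners), that is transversal to the
action of `K`, and `M` is the compact isotropy group of all points of the interior `Y°` of `Y`.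
Transversality has the usual two parts: `Y` meets each orbit in exactly one point, and
`T_y X = T_y Y + T_y (K y)` for `y ∈ Y°`; the latter says that the differential of
`Y × K → X, (y, k) ↦ k y` at `(y, 1)` is onto, and makes `X°` the product manifold
`Y° × (K/M)`. -/
structure IsTransversal (IY : ModelWithCorners ℝ EY HY) (Y : Set X) [ChartedSpace HY Y]
    (M : Subgroup K) : Prop where
  submanifold : Manifold.IsSmoothEmbedding IY (𝓡 n) ∞ ((↑) : Y → X)
  orbit_inter : ∀ y ∈ Y, MulAction.orbit K y ∩ Y = {y}
  orbit_cover : ⋃ y ∈ Y, MulAction.orbit K y = univ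
  transversal : ∀ y ∈ IY.interior Y, Function.Surjective
    (mfderiv (IY.prod (𝓡 d)) (𝓡 n) (fun p : Y × K => p.2 • (p.1 : X)) (y, 1))
  stabilizer_eq : ∀ y ∈ IY.interior Y, MulAction.stabilizer K (y : X) = M
  compact : IsCompact (M : Set K)

/-- `X°`: the union of the orbits through the points of `Y°`. -/
def regularPart (K : Type*) [Group K] [MulAction K X] (IY : ModelWithCorners ℝ EY HY)
    (Y : Set X) [ChartedSpace HY Y] : Set X :=
  ⋃ y : IY.interior Y, MulAction.orbit K ((y : Y) : X)

theorem mem_regularPart {K : Type*} [Group K] [MulAction K X] {IY : ModelWithCorners ℝ EY HY} {Y : Set X} [ChartedSpace HY Y]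
    {a : X} (ha : a ∈ regularPart K IY Y) :
    ∃ (y : IY.interior Y) (k : K), k • ((y : Y) : X) = a := by
  obtain ⟨y, k, hk⟩ := mem_iUnion.1 ha
  exact ⟨y, k, hk⟩

end Geometry

/-! Helper facts: `X°` is open, and the radial and angular parts depend continuously on the point. -/

theorem map_nhds_eq_of_surjective_mfderiv
    {E H E' H' M N : Type*} [NormedAddCommGroup E] [NormedSpace ℝ E] [CompleteSpace E]
    [TopologicalSpace H] [NormedAddCommGroup E'] [NormedSpace ℝ E'] [CompleteSpace E']
    [TopologicalSpace H'] {I : ModelWithCorners ℝ E H} {I' : ModelWithCorners ℝ E' H'}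
    [I'.Boundaryless]
    [TopologicalSpace M] [ChartedSpace H M] [TopologicalSpace N] [ChartedSpace H' N]
    {f : M → N} {x : M} (hf : ContMDiffAt I I' 1 f x) (hx : I.IsInteriorPoint x)
    (hs : Function.Surjective (mfderiv I I' f x)) : map f (𝓝 x) = 𝓝 (f x) := by
  have hmd : MDifferentiableAt I I' f x := hf.mdifferentiableAt one_ne_zero
  have hr : range I ∈ 𝓝 (extChartAt I x x) := range_mem_nhds_isInteriorPoint hx
  have hc : ContDiffAt ℝ 1 (writtenInExtChartAt I I' x f) (extChartAt I x x) :=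
    ((contMDiffAt_iff.1 hf).2).contDiffAt hr
  have hstr := hc.hasStrictFDerivAt (by simp)
  have hd : mfderiv I I' f x
      = fderiv ℝ (writtenInExtChartAt I I' x f) (extChartAt I x x) := by
    simp only [mfderiv, hmd]
    exact fderivWithin_of_mem_nhds hr
  have hsurj : Function.Surjective
      (fderiv ℝ (writtenInExtChartAt I I' x f) (extChartAt I x x)) := by
    rw [← hd]; exact hs
  have h1 := hstr.map_nhds_eq_of_surj (LinearMap.range_eq_top.2 hsurj)
  have h2 : map (extChartAt I x) (𝓝 x) = 𝓝 (extChartAt I x x) := by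
    rw [map_extChartAt_nhds, nhdsWithin_eq_nhds.2 hr]
  have h3 : map (extChartAt I' (f x)) (map f (𝓝 x)) = map (extChartAt I' (f x)) (𝓝 (f x)) := by
    rw [map_extChartAt_nhds_of_boundaryless]
    have h4 : writtenInExtChartAt I I' x f (extChartAt I x x) = extChartAt I' (f x) (f x) := by
      simp [writtenInExtChartAt]
    rw [← h4, ← h1, ← h2, map_map, map_map]
    apply Filter.map_congr
    filter_upwards [extChartAt_source_mem_nhds (I := I) x] with p hp
    change extChartAt I' (f x) (f p)
      = extChartAt I' (f x) (f ((extChartAt I x).symm (extChartAt I x p)))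
    rw [(extChartAt I x).left_inv hp]
  have h5 : ∀ l : Filter N, (extChartAt I' (f x)).source ∈ l →
      map (extChartAt I' (f x)).symm (map (extChartAt I' (f x)) l) = l := by
    intro l hl
    rw [map_map]
    conv_rhs => rw [← map_id (f := l)]
    apply Filter.map_congr
    filter_upwards [hl] with p hp
    exact (extChartAt I' (f x)).left_inv hp
  have hsrc : (extChartAt I' (f x)).source ∈ 𝓝 (f x) := extChartAt_source_mem_nhds _
  rw [← h5 _ (hf.continuousAt hsrc), h3, h5 _ hsrc]

section Polar

variable {n d : ℕ}
  {X : Type*} [TopologicalSpace X] [ChartedSpace (EuclideanSpace ℝ (Fin n)) X]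
  {K : Type*} [TopologicalSpace K] [ChartedSpace (EuclideanSpace ℝ (Fin d)) K] [Group K]
  [LieGroup (𝓡 d) ∞ K] [MulAction K X] [ContMDiffSMul (𝓡 d) (𝓡 n) ∞ K X]
  {EY HY : Type*} [NormedAddCommGroup EY] [NormedSpace ℝ EY] [FiniteDimensional ℝ EY]
  [TopologicalSpace HY] {IY : ModelWithCorners ℝ EY HY} {Y : Set X} [ChartedSpace HY Y]
  [IsManifold IY ∞ Y] {M : Subgroup K}

theorem IsTransversal.map_nhds (h : IsTransversal (n := n) (d := d) IY Y M)
    (y : IY.interior Y) (k : K) :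
    map (fun p : IY.interior Y × K => p.2 • ((p.1 : Y) : X)) (𝓝 (y, k))
      = 𝓝 (k • ((y : Y) : X)) := by
  have : ContinuousSMul K X := ContMDiffSMul.continuousSMul (I := 𝓡 d) (I' := 𝓡 n) ∞
  have : IsTopologicalGroup K := topologicalGroup_of_lieGroup (𝓡 d) ∞
  have : CompleteSpace EY := FiniteDimensional.complete ℝ EY
  have h1 : map (fun p : Y × K => p.2 • (p.1 : X)) (𝓝 ((y : Y), 1))
      = 𝓝 ((1 : K) • ((y : Y) : X)) := by
    refine map_nhds_eq_of_surjective_mfderiv (I := IY.prod (𝓡 d)) (I' := 𝓡 n)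
      (f := fun p : Y × K => p.2 • (p.1 : X)) (x := ((y : Y), (1 : K))) ?_ ?_ (h.transversal y y.2)
    · have : ContMDiff (IY.prod (𝓡 d)) (𝓡 n) ∞ (fun p : Y × K => p.2 • (p.1 : X)) :=
        (contMDiff_smul (I := 𝓡 d) (I' := 𝓡 n) (n := ∞) (G := K) (M := X)).comp
          (contMDiff_snd.prodMk (h.submanifold.contMDiff.comp contMDiff_fst))
      exact (this.of_le (by simp)).contMDiffAt
    · have := ModelWithCorners.interior_prod (I := IY) (J := 𝓡 d) (M := Y) (N := K)
      have h2 : ((y : Y), (1 : K)) ∈ (IY.prod (𝓡 d)).interior (Y × K) := by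
        rw [this]
        exact ⟨y.2, by simp [ModelWithCorners.interior_eq_univ]⟩
      exact h2
  have ho : IsOpenEmbedding (fun p : IY.interior Y × K => ((p.1 : Y), p.2)) :=
    (((ModelWithCorners.isOpen_interior (I := IY) (M := Y) (n := ∞)
      (by simp)).isOpenEmbedding_subtypeVal)).prodMap IsOpenEmbedding.id
  have h2 : map (fun p : IY.interior Y × K => p.2 • ((p.1 : Y) : X)) (𝓝 (y, 1))
      = 𝓝 ((y : Y) : X) := by
    have := ho.map_nhds_eq (y, 1)
    rw [one_smul] at h1
    rw [← h1, ← this, map_map]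
    rfl
  have h3 : (fun p : IY.interior Y × K => p.2 • ((p.1 : Y) : X)) =
      (fun a : X => k • a) ∘ (fun p : IY.interior Y × K => p.2 • ((p.1 : Y) : X)) ∘
        (Prod.map id (fun l => k⁻¹ * l)) := by
    funext p
    simp [smul_smul]
  have h4 : map (Prod.map (id : IY.interior Y → IY.interior Y) (fun l => k⁻¹ * l)) (𝓝 (y, k))
      = 𝓝 (y, 1) := by
    have := ((Homeomorph.refl (IY.interior Y)).prodCongr (Homeomorph.mulLeft k⁻¹)).map_nhds_eq
      (y, k)
    simpa using this
  rw [h3, ← map_map, ← map_map, h4, h2]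
  exact (Homeomorph.smul k).map_nhds_eq _

theorem IsTransversal.tendsto_polar (h : IsTransversal (n := n) (d := d) IY Y M)
    {ι : Type*} {l : Filter ι} {p : ι → IY.interior Y} {q : ι → K ⧸ M} {g : ι → X}
    (hg : ∀ i, ∃ k : K, (k : K ⧸ M) = q i ∧ k • ((p i : Y) : X) = g i)
    {y : IY.interior Y} {k : K} (hl : Tendsto g l (𝓝 (k • ((y : Y) : X)))) :
    Tendsto p l (𝓝 y) ∧ Tendsto q l (𝓝 (k : K ⧸ M)) := by
  have key : ∀ U ∈ 𝓝 y, ∀ V ∈ 𝓝 (k : K ⧸ M), ∀ᶠ i in l, p i ∈ U ∧ q i ∈ V := by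
    intro U hU V hV
    have hV' : (fun k : K => (k : K ⧸ M)) ⁻¹' V ∈ 𝓝 k :=
      QuotientGroup.continuous_mk.continuousAt hV
    have := image_mem_map (m := fun p : IY.interior Y × K => p.2 • ((p.1 : Y) : X))
      (prod_mem_nhds hU hV')
    rw [h.map_nhds y k] at this
    filter_upwards [hl this] with i hi
    obtain ⟨⟨y', k'⟩, ⟨hy', hk'⟩, he⟩ := hi
    obtain ⟨k₁, hk₁, he₁⟩ := hg i
    simp only at he hy' hk'
    rw [← he₁] at he
    have hy : y' = p i := by
      have : ((y' : Y) : X) ∈ MulAction.orbit K ((p i : Y) : X) ∩ Y := by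
        refine ⟨⟨k'⁻¹ * k₁, ?_⟩, (y' : Y).2⟩
        simp only [mul_smul, ← he, inv_smul_smul]
      rw [h.orbit_inter _ (p i : Y).2] at this
      exact Subtype.ext (Subtype.ext this)
    subst hy
    refine ⟨hy', ?_⟩
    rw [← hk₁]
    have : k'⁻¹ * k₁ ∈ MulAction.stabilizer K ((p i : Y) : X) := by
      simp only [MulAction.mem_stabilizer_iff, mul_smul, ← he, inv_smul_smul]
    rw [h.stabilizer_eq _ (p i).2] at this
    rw [← QuotientGroup.eq.2 this]
    exact hk'
  exact ⟨fun U hU => (key U hU univ univ_mem).mono fun i hi => hi.1,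
    fun V hV => (key univ univ_mem V hV).mono fun i hi => hi.2⟩

theorem IsTransversal.isOpen_regularPart (h : IsTransversal (n := n) (d := d) IY Y M) :
    IsOpen (regularPart K IY Y) := by
  rw [isOpen_iff_mem_nhds]
  intro a ha
  obtain ⟨y, k, rfl⟩ := mem_regularPart ha
  rw [← h.map_nhds y k]
  refine mem_of_superset (image_mem_map univ_mem) ?_
  rintro _ ⟨p, -, rfl⟩
  exact mem_iUnion.2 ⟨p.1, p.2, rfl⟩

/-- A path that survives in `X°` up to time `T` has a polar decomposition `x_t = z_t y_t`,
`0 ≤ t ≤ T`, with rcll paths `y` in `Y°` and `z` in `K/M`. -/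
theorem IsTransversal.exists_polarPath (h : IsTransversal (n := n) (d := d) IY Y M) {T : ℝ≥0}
    {w : ℝ≥0 → OnePoint X} (hw : IsRcllWithLifetime w) (hs : Survives (regularPart K IY Y) T w) :
    ∃ r : RcllPath T (IY.interior Y) × RcllPath T (K ⧸ M), ∀ t : Icc (0 : ℝ≥0) T, ∃ k : K,
      (k : K ⧸ M) = r.2.1 t ∧ ((k • ((r.1.1 t : Y) : X) : X) : OnePoint X) = w t := by
  have h1 : ∀ t : Icc (0 : ℝ≥0) T, ∃ (y : IY.interior Y) (k : K),
      ((k • ((y : Y) : X) : X) : OnePoint X) = w t := by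
    intro t
    obtain ⟨a, ha, hat⟩ := (not_exit hs t t.2.2).1
    obtain ⟨y, k, rfl⟩ := mem_regularPart ha
    exact ⟨y, k, hat⟩
  choose p k hpk using h1
  have hlim : ∀ (l : Filter (Icc (0 : ℝ≥0) T)) (y : IY.interior Y) (k₀ : K),
      Tendsto (fun t : Icc (0 : ℝ≥0) T => w t) l (𝓝 ((k₀ • ((y : Y) : X) : X) : OnePoint X)) →
      Tendsto p l (𝓝 y) ∧ Tendsto (fun t => (k t : K ⧸ M)) l (𝓝 (k₀ : K ⧸ M)) := by
    intro l y k₀ ht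
    refine h.tendsto_polar (g := fun t => k t • ((p t : Y) : X)) (fun t => ⟨k t, rfl, rfl⟩) ?_
    rw [OnePoint.isOpenEmbedding_coe.toIsEmbedding.tendsto_nhds_iff]
    refine ht.congr fun t => (hpk t).symm
  have hr : ∀ t : Icc (0 : ℝ≥0) T,
      Tendsto (fun u : Icc (0 : ℝ≥0) T => w u) (𝓝[≥] t) (𝓝 (w t)) := by
    intro t
    refine (hw.right_cont t).tendsto.comp ?_
    exact continuous_subtype_val.continuousWithinAt.tendsto_nhdsWithin fun u hu => hu
  have hl : ∀ t : Icc (0 : ℝ≥0) T, ∃ (y : IY.interior Y) (k₀ : K),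
      Tendsto (fun u : Icc (0 : ℝ≥0) T => w u) (𝓝[<] t)
        (𝓝 ((k₀ • ((y : Y) : X) : X) : OnePoint X)) := by
    intro t
    rcases eq_zero_or_pos (t : ℝ≥0) with h0 | h0
    · refine ⟨p t, k t, ?_⟩
      have : (Iio t) = ∅ := by
        ext u
        simp only [mem_Iio, mem_empty_iff_false, iff_false, not_lt]
        change (t : ℝ≥0) ≤ u
        rw [h0]
        exact zero_le
      rw [this, nhdsWithin_empty]
      exact tendsto_bot
    · obtain ⟨a, ha, hat⟩ := (not_exit hs t t.2.2).2 h0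
      obtain ⟨y, k₀, rfl⟩ := mem_regularPart ha
      refine ⟨y, k₀, hat.comp ?_⟩
      exact continuous_subtype_val.continuousWithinAt.tendsto_nhdsWithin fun u hu => hu
  refine ⟨(⟨p, fun t => ⟨?_, ?_⟩⟩, ⟨fun t => (k t : K ⧸ M), fun t => ⟨?_, ?_⟩⟩),
    fun t => ⟨k t, rfl, hpk t⟩⟩
  · exact (hlim _ _ _ (by rw [hpk]; exact hr t)).1
  · obtain ⟨y, k₀, hy⟩ := hl t
    exact ⟨_, (hlim _ _ _ hy).1⟩
  · exact (hlim _ _ _ (by rw [hpk]; exact hr t)).2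
  · obtain ⟨y, k₀, hy⟩ := hl t
    exact ⟨_, (hlim _ _ _ hy).2⟩

/-- The radial path `y` and the angular path `z` on `[0, T]` of a path that survives in `X°` up to
time `T`. -/
def IsTransversal.polarPath (h : IsTransversal (n := n) (d := d) IY Y M) {T : ℝ≥0}
    {w : ℝ≥0 → OnePoint X} (hw : IsRcllWithLifetime w) (hs : Survives (regularPart K IY Y) T w) :
    RcllPath T (IY.interior Y) × RcllPath T (K ⧸ M) :=
  (h.exists_polarPath hw hs).choose

theorem IsTransversal.polarPath_spec (h : IsTransversal (n := n) (d := d) IY Y M) {T : ℝ≥0}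
    {w : ℝ≥0 → OnePoint X} (hw : IsRcllWithLifetime w) (hs : Survives (regularPart K IY Y) T w)
    (t : Icc (0 : ℝ≥0) T) : ∃ k : K, (k : K ⧸ M) = (h.polarPath hw hs).2.1 t ∧
      ((k • (((h.polarPath hw hs).1.1 t : Y) : X) : X) : OnePoint X) = w t :=
  (h.exists_polarPath hw hs).choose_spec t

variable [MeasurableSpace X] [BorelSpace X] [MeasurableSpace (K ⧸ M)] [BorelSpace (K ⧸ M)]
  {Ω : Type*} [MeasurableSpace Ω]

theorem IsTransversal.measurable_polarPath (h : IsTransversal (n := n) (d := d) IY Y M) {T : ℝ≥0}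
    {x : ℝ≥0 → Ω → OnePoint X} (hm : ∀ t, Measurable[_, borel (OnePoint X)] (x t))
    (hx : ∀ θ, IsRcllWithLifetime (fun t => x t θ)) :
    Measurable (fun θ : {θ // Survives (regularPart K IY Y) T (fun t => x t θ)} =>
      h.polarPath (hx θ) θ.2) := by
  have hopen : ∀ (U : Set (IY.interior Y)) (V : Set (K ⧸ M)), IsOpen U → IsOpen V →
      ∀ t : Icc (0 : ℝ≥0) T, MeasurableSet
        {θ : {θ // Survives (regularPart K IY Y) T (fun t => x t θ)} |
          (h.polarPath (hx θ) θ.2).1.1 t ∈ U ∧ (h.polarPath (hx θ) θ.2).2.1 t ∈ V} := by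
    intro U V hU hV t
    set W : Set X := {a | ∃ (y : IY.interior Y) (k : K), y ∈ U ∧ (k : K ⧸ M) ∈ V ∧
      k • ((y : Y) : X) = a} with hWdef
    have hW : IsOpen W := by
      rw [isOpen_iff_mem_nhds]
      rintro _ ⟨y, k, hy, hk, rfl⟩
      rw [← h.map_nhds y k]
      refine mem_of_superset (image_mem_map (prod_mem_nhds (hU.mem_nhds hy)
        (QuotientGroup.continuous_mk.continuousAt (hV.mem_nhds hk)))) ?_
      rintro _ ⟨p, ⟨hp1, hp2⟩, rfl⟩
      exact ⟨p.1, p.2, hp1, hp2, rfl⟩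
    have hWm : MeasurableSet[borel (OnePoint X)] (((↑) : X → OnePoint X) '' W) :=
      MeasurableSpace.measurableSet_generateFrom (OnePoint.isOpenEmbedding_coe.isOpenMap _ hW)
    have heq : {θ : {θ // Survives (regularPart K IY Y) T (fun t => x t θ)} |
          (h.polarPath (hx θ) θ.2).1.1 t ∈ U ∧ (h.polarPath (hx θ) θ.2).2.1 t ∈ V}
        = (fun θ : {θ // Survives (regularPart K IY Y) T (fun t => x t θ)} => x t θ) ⁻¹'
          (((↑) : X → OnePoint X) '' W) := by
      ext θ
      obtain ⟨k, hk, hkx⟩ := h.polarPath_spec (hx θ) θ.2 t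
      constructor
      · rintro ⟨h1, h2⟩
        exact ⟨_, ⟨_, k, h1, by rw [hk]; exact h2, rfl⟩, hkx⟩
      · rintro ⟨a, ⟨y', k', hy', hk', rfl⟩, ha⟩
        have ha' : ((k' • ((y' : Y) : X) : X) : OnePoint X) = x t θ := ha
        rw [← hkx] at ha'
        have hlim := h.tendsto_polar (l := pure ()) (p := fun _ : Unit => y')
          (q := fun _ => (k' : K ⧸ M)) (g := fun _ => k' • ((y' : Y) : X))
          (fun _ => ⟨k', rfl, rfl⟩) (y := (h.polarPath (hx θ) θ.2).1.1 t) (k := k) (by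
            rw [OnePoint.coe_injective ha']; exact tendsto_pure_nhds _ _)
        have hlim' := h.tendsto_polar (l := pure ())
          (p := fun _ : Unit => (h.polarPath (hx θ) θ.2).1.1 t)
          (q := fun _ => (k : K ⧸ M)) (g := fun _ => k • (((h.polarPath (hx θ) θ.2).1.1 t : Y) : X))
          (fun _ => ⟨k, rfl, rfl⟩) (y := y') (k := k') (by
            rw [OnePoint.coe_injective ha']; exact tendsto_pure_nhds _ _)
        refine ⟨?_, ?_⟩
        · have := (tendsto_pure_left.1 hlim'.1) U (hU.mem_nhds hy')
          exact this
        · have := (tendsto_pure_left.1 hlim'.2) V (hV.mem_nhds hk')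
          rw [hk] at this
          exact this
    rw [heq]
    exact ((hm t).comp measurable_subtype_coe) hWm
  refine Measurable.prodMk (Measurable.subtype_mk (measurable_pi_lambda _ fun t => ?_))
    (Measurable.subtype_mk (measurable_pi_lambda _ fun t => ?_))
  · refine measurable_of_isOpen fun U hU => ?_
    have := hopen U univ hU isOpen_univ t
    simp only [mem_univ, and_true] at this
    exact this
  · refine measurable_of_isOpen fun V hV => ?_
    have := hopen univ V isOpen_univ hV t
    simp only [mem_univ, true_and] at this
    exact this

/-- The law on `D_T(Y°) × D_T(K/M)` of the radial and the angular path on the event `ζ > T`, for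
the measure `Q` on `Ω`. Its total mass is `Q(ζ > T)`. -/
def IsTransversal.pathLaw (h : IsTransversal (n := n) (d := d) IY Y M) (T : ℝ≥0)
    {x : ℝ≥0 → Ω → OnePoint X} (hx : ∀ θ, IsRcllWithLifetime (fun t => x t θ)) (Q : Measure Ω) :
    Measure (RcllPath T (IY.interior Y) × RcllPath T (K ⧸ M)) :=
  (Q.comap ((↑) : {θ // Survives (regularPart K IY Y) T (fun t => x t θ)} → Ω)).map
    fun θ : {θ // Survives (regularPart K IY Y) T (fun t => x t θ)} => h.polarPath (hx θ) θ.2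

/-- The law on `D_T(Y°)` of the radial path on the event `ζ > T`. -/
def IsTransversal.radialLaw (h : IsTransversal (n := n) (d := d) IY Y M) (T : ℝ≥0)
    {x : ℝ≥0 → Ω → OnePoint X} (hx : ∀ θ, IsRcllWithLifetime (fun t => x t θ)) (Q : Measure Ω) :
    Measure (RcllPath T (IY.interior Y)) :=
  (h.pathLaw T hx Q).map Prod.fst

/-- `R` is a conditional distribution `R_z^{y(·)}` of the angular process on `[0, T]` given the
radial path `y(·)` and `z_0 = z`: a probability kernel from `D_T(Y°) × (K/M)` to `D_T(K/M)` such
that, for every starting point `x = k y ∈ X°`, whose angular part is `kM`,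
`R_{kM}^{y(·)}(F) = P_x[z(·) ∈ F | y(·)]` almost surely on `ζ > T`. -/
def IsTransversal.IsAngularKernel (h : IsTransversal (n := n) (d := d) IY Y M) (T : ℝ≥0)
    {x : ℝ≥0 → Ω → OnePoint X} (hx : ∀ θ, IsRcllWithLifetime (fun t => x t θ))
    (Pr : X → Measure Ω)
    (R : Kernel (RcllPath T (IY.interior Y) × (K ⧸ M)) (RcllPath T (K ⧸ M))) : Prop :=
  IsMarkovKernel R ∧ ∀ (y : IY.interior Y) (k : K)
    (B : Set (RcllPath T (IY.interior Y))) (F : Set (RcllPath T (K ⧸ M))),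
    MeasurableSet B → MeasurableSet F →
      h.pathLaw T hx (Pr (k • ((y : Y) : X))) (B ×ˢ F)
        = ∫⁻ p in B, R (p, (k : K ⧸ M)) F ∂(h.radialLaw T hx (Pr (k • ((y : Y) : X))))

end Polar

end AngularPart

open AngularPart

set_option linter.unusedSectionVars false

/-! Write the process as `x_t = z_t y_t`. By `K`-invariance, translating the angular starting point
by `k` translates the angular path by `k` and leaves the radial path alone
(`IsTransversal.polarKernel_smul`). So the radial law does not depend on the angular starting point,
and it is enough to disintegrate the joint law of both paths, started at the base coset, with
respect to the radial path. This is possible because the rcll paths in a Polish space form a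
standard Borel space. Translating the resulting conditional law by a uniformly distributed element
of the coset `kM` gives a conditional distribution that is equivariant for every radial path, not
merely for almost every one (`IsPolarFamily.angularKernel_smul`).

Fix `s ≤ t`. By the Markov property at `t`, the radial path after `t` depends on the past of both
paths only through `y_t`, so it can be integrated out. By the Markov property at `s`, given the
whole radial path and the angular path up to `s`, the position `z_t` is the end point of a
conditional angular path over the radial window `[s, t]` started at `z_s`
(`IsPolarFamily.lintegral_step`). By equivariance its law is the translate by `z_s` of an
`M`-invariant measure that depends on the window only (`IsPolarFamily.windowIncrement`). Hence, for
almost every radial path, the increment over `[s, t]` is independent of the angular past, and its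
law is measurable with respect to the radial window.

The null set depends on `s` and `t`. To have one family for all times, the increment measure is
taken to be the law of `z_s⁻¹ z_t`, averaged over `M`, under the conditional law started at the base
coset (`incrementLaw`). It is defined for every path and all times, and it agrees almost surely with
the window version for each fixed `s ≤ t` (`IsPolarFamily.ae_incrementLaw_eq`). Independence holds
off one null set for all pairs of a countable dense set of times, and right continuity extends it to
all pairs (`HasIndepIncrement.of_grid`). The convolution property (`incrementLaw_conv`) and the
finite-dimensional distributions (`lintegral_eval_eq_iteratedIntegral`) then follow by successive
conditioning. Any other conditional distribution agrees almost surely with the constructed one for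
each starting point, so the same increment measures serve it. -/

namespace AngularPart

/-! ### Rcll paths: time windows, a countable grid of times, generating evaluations. -/

section RcllPaths

variable {T r : ℝ≥0} {E : Type*} [TopologicalSpace E]

theorem IsRcll.comp {f : Icc (0 : ℝ≥0) T → E} (hf : IsRcll f)
    {φ : Icc (0 : ℝ≥0) r → Icc (0 : ℝ≥0) T} (hc : Continuous φ) (hm : StrictMono φ) :
    IsRcll (f ∘ φ) := by
  refine fun t => ⟨?_, ?_⟩
  · exact ((hf (φ t)).1).comp hc.continuousWithinAt fun u hu => hm.monotone hu
  · obtain ⟨l, hl⟩ := (hf (φ t)).2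
    refine ⟨l, hl.comp ?_⟩
    exact hc.continuousWithinAt.tendsto_nhdsWithin fun u hu => hm hu

theorem IsRcll.continuous_comp {F : Type*} [TopologicalSpace F] {f : Icc (0 : ℝ≥0) T → E}
    (hf : IsRcll f) {g : E → F} (hg : Continuous g) : IsRcll (g ∘ f) := by
  refine fun t => ⟨hg.continuousAt.comp_continuousWithinAt (hf t).1, ?_⟩
  obtain ⟨l, hl⟩ := (hf t).2
  exact ⟨g l, (hg.tendsto l).comp hl⟩

theorem isRcll_const (c : E) : IsRcll (fun _ : Icc (0 : ℝ≥0) T => c) :=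
  fun _ => ⟨continuousWithinAt_const, c, tendsto_const_nhds⟩

instance [Nonempty E] : Nonempty (RcllPath T E) := ⟨⟨_, isRcll_const (Classical.arbitrary E)⟩⟩

/-- The embedding `u ↦ s + u` of `[0, r]` into `[0, T]`. -/
def shiftTime (s : ℝ≥0) (h : s + r ≤ T) (u : Icc (0 : ℝ≥0) r) : Icc (0 : ℝ≥0) T :=
  ⟨s + u, zero_le, (add_le_add_right u.2.2 s).trans h⟩

theorem continuous_shiftTime (s : ℝ≥0) (h : s + r ≤ T) : Continuous (shiftTime s h) :=
  Continuous.subtype_mk (continuous_const.add continuous_subtype_val) _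

theorem strictMono_shiftTime (s : ℝ≥0) (h : s + r ≤ T) : StrictMono (shiftTime s h) :=
  fun _ _ hab => add_lt_add_right (α := ℝ≥0) hab s

/-- The piece of a path between the times `s` and `s + r`. -/
def window (s : ℝ≥0) (h : s + r ≤ T) (p : RcllPath T E) : RcllPath r E :=
  ⟨p.1 ∘ shiftTime s h, p.2.comp (continuous_shiftTime s h) (strictMono_shiftTime s h)⟩

/-- The first time of `[0, r]`. -/
def firstTime : Icc (0 : ℝ≥0) r := ⟨0, left_mem_Icc.2 zero_le⟩

/-- The last time of `[0, r]`. -/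
def lastTime : Icc (0 : ℝ≥0) r := ⟨r, right_mem_Icc.2 zero_le⟩

/-- A countable dense set of times in `[0, T]` that contains `T`. -/
def grid (T : ℝ≥0) : Set (Icc (0 : ℝ≥0) T) :=
  insert lastTime (Subtype.val ⁻¹' (TopologicalSpace.exists_countable_dense ℝ≥0).choose)

theorem countable_grid : (grid T).Countable :=
  ((TopologicalSpace.exists_countable_dense ℝ≥0).choose_spec.1.preimage
    Subtype.val_injective).insert _

instance : Countable (grid T) := countable_grid.to_subtype

theorem lastTime_mem_grid : lastTime ∈ grid T := Or.inl rfl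

/-- The right end point has no times beyond it, which is why the grid must contain it; at any other
time density supplies grid times just to the right. -/
theorem mem_closure_grid (t : Icc (0 : ℝ≥0) T) : t ∈ closure (grid T ∩ Ici t) := by
  rcases eq_or_lt_of_le t.2.2 with h | h
  · refine subset_closure ⟨?_, self_mem_Ici⟩
    have : t = lastTime := Subtype.ext h
    rw [this]
    exact lastTime_mem_grid
  · rw [mem_closure_iff_nhds]
    intro U hU
    have hlt : t < lastTime := h
    obtain ⟨b, hb, hbU⟩ := (mem_nhdsGE_iff_exists_Ico_subset' hlt).1 (mem_nhdsWithin_of_mem_nhds hU)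
    obtain ⟨q, hq, hq1, hq2⟩ :=
      (TopologicalSpace.exists_countable_dense ℝ≥0).choose_spec.2.exists_between
        (show (t : ℝ≥0) < b from hb)
    exact ⟨⟨q, zero_le, hq2.le.trans b.2.2⟩, hbU ⟨hq1.le, hq2⟩, Or.inr hq, hq1.le⟩

/-- The times of the grid that approach `t` from the right. -/
def rightFilter (t : Icc (0 : ℝ≥0) T) : Filter (↥(grid T ∩ Ici t)) := comap Subtype.val (𝓝 t)

instance (t : Icc (0 : ℝ≥0) T) : NeBot (rightFilter t) :=
  mem_closure_iff_comap_neBot.1 (mem_closure_grid t)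

instance (t : Icc (0 : ℝ≥0) T) : IsCountablyGenerated (rightFilter t) := by
  unfold rightFilter; infer_instance

theorem tendsto_rightFilter (t : Icc (0 : ℝ≥0) T) :
    Tendsto Subtype.val (rightFilter t) (𝓝[≥] t) :=
  tendsto_nhdsWithin_iff.2 ⟨tendsto_comap, Eventually.of_forall fun u => u.2.2⟩

theorem IsRcll.tendsto_rightFilter {f : Icc (0 : ℝ≥0) T → E} (hf : IsRcll f)
    (t : Icc (0 : ℝ≥0) T) : Tendsto (fun u : ↥(grid T ∩ Ici t) => f u) (rightFilter t) (𝓝 (f t)) :=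
  (hf t).1.tendsto.comp (AngularPart.tendsto_rightFilter t)

/-- The restriction of a path to the grid. -/
def restrictGrid (p : RcllPath T E) : grid T → E := fun u => p.1 u

theorem restrictGrid_injective [T2Space E] :
    Function.Injective (restrictGrid : RcllPath T E → grid T → E) := by
  intro p q h
  refine Subtype.ext (funext fun t => ?_)
  refine tendsto_nhds_unique (p.2.tendsto_rightFilter t) ?_
  refine (q.2.tendsto_rightFilter t).congr fun u => ?_
  exact (congrFun h ⟨u, u.2.1⟩).symm

variable [MeasurableSpace E]

@[fun_prop]
theorem measurable_eval (t : Icc (0 : ℝ≥0) T) : Measurable fun p : RcllPath T E => p.1 t :=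
  (measurable_pi_apply t).comp measurable_subtype_coe

theorem measurable_rcllPath_iff {α : Type*} [MeasurableSpace α] {g : α → RcllPath T E} :
    Measurable g ↔ ∀ t, Measurable fun a => (g a).1 t :=
  ⟨fun h t => (measurable_eval t).comp h,
    fun h => Measurable.subtype_mk (measurable_pi_lambda _ h)⟩

@[fun_prop]
theorem measurable_window (s : ℝ≥0) (h : s + r ≤ T) :
    Measurable (window s h : RcllPath T E → RcllPath r E) :=
  measurable_rcllPath_iff.2 fun _ => measurable_eval _

/-- Source of the measurability of the increments: whatever is a measurable function of the window
is measurable for the σ-algebra of the path between `s` and `t`. -/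
theorem measurable_window_evalSigma {s t : Icc (0 : ℝ≥0) T} (hst : s ≤ t)
    (h : (s : ℝ≥0) + ((t : ℝ≥0) - s) ≤ T) :
    Measurable[evalSigma E s t] (window (s : ℝ≥0) h : RcllPath T E → RcllPath (t - s : ℝ≥0) E) := by
  have h1 : ∀ u, Measurable[evalSigma E s t]
      fun p : RcllPath T E => p.1 (shiftTime (r := (t : ℝ≥0) - s) s h u) := by
    intro u
    have hm : shiftTime (s : ℝ≥0) h u ∈ Icc s t := by
      refine ⟨?_, ?_⟩
      · change (s : ℝ≥0) ≤ s + u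
        exact le_self_add
      · change (s : ℝ≥0) + u ≤ t
        calc (s : ℝ≥0) + u ≤ s + (t - s) := add_le_add_right u.2.2 _
          _ = t := add_tsub_cancel_of_le hst
    refine Measurable.mono (comap_measurable _) ?_ le_rfl
    exact le_iSup (fun u : Icc s t =>
      MeasurableSpace.comap (fun f : RcllPath T E => f.1 u) inferInstance) ⟨_, hm⟩
  let : MeasurableSpace (RcllPath T E) := evalSigma E s t
  exact Measurable.subtype_mk (measurable_pi_lambda _ h1)

theorem measurable_eval_evalSigma {s t : Icc (0 : ℝ≥0) T} {u : Icc (0 : ℝ≥0) T} (hu : u ∈ Icc s t) :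
    Measurable[evalSigma E s t] fun p : RcllPath T E => p.1 u := by
  refine Measurable.mono (comap_measurable _) ?_ le_rfl
  exact le_iSup (fun u : Icc s t =>
      MeasurableSpace.comap (fun f : RcllPath T E => f.1 u) inferInstance) ⟨_, hu⟩

theorem evalSigma_mono {s t t' : Icc (0 : ℝ≥0) T} (h : t ≤ t') :
    evalSigma E s t ≤ evalSigma E s t' :=
  iSup_le fun u => (measurable_eval_evalSigma (E := E)
    (⟨u.2.1, u.2.2.trans h⟩ : (u : Icc (0 : ℝ≥0) T) ∈ Icc s t')).comap_le

theorem evalSigma_le {s t : Icc (0 : ℝ≥0) T} :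
    evalSigma E s t ≤ (inferInstance : MeasurableSpace (RcllPath T E)) :=
  iSup_le fun u => (measurable_eval (E := E) (u : Icc (0 : ℝ≥0) T)).comap_le

/-- The σ-algebra of the path up to time `s` is generated by the path on `[0, s]`. -/
theorem evalSigma_firstTime_le_comap {s : Icc (0 : ℝ≥0) T} (h : 0 + (s : ℝ≥0) ≤ T) :
    evalSigma E firstTime s ≤ MeasurableSpace.comap
      (window 0 h : RcllPath T E → RcllPath (s : ℝ≥0) E) inferInstance := by
  refine iSup_le fun u => ?_
  have : (fun f : RcllPath T E => f.1 u)
      = (fun q : RcllPath (s : ℝ≥0) E => q.1 ⟨(u : Icc (0 : ℝ≥0) T), zero_le, u.2.2⟩) ∘ window 0 h := by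
    funext f
    exact congrArg f.1 (Subtype.ext (zero_add ((u : Icc (0 : ℝ≥0) T) : ℝ≥0)).symm)
  rw [this, ← MeasurableSpace.comap_comp]
  exact MeasurableSpace.comap_mono (measurable_eval _).comap_le

theorem measurable_restrictGrid :
    Measurable (restrictGrid : RcllPath T E → grid T → E) :=
  measurable_pi_lambda _ fun u => measurable_eval (u : Icc (0 : ℝ≥0) T)

/-- By right continuity every evaluation is a limit of evaluations at grid times, so countably many
evaluations generate the σ-algebra. -/
theorem comap_restrictGrid [TopologicalSpace.PseudoMetrizableSpace E] [BorelSpace E] :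
    MeasurableSpace.comap (restrictGrid : RcllPath T E → grid T → E) inferInstance
      = (inferInstance : MeasurableSpace (RcllPath T E)) := by
  refine le_antisymm measurable_restrictGrid.comap_le ?_
  set m := MeasurableSpace.comap (restrictGrid : RcllPath T E → grid T → E) inferInstance with hm
  have h1 : ∀ t, Measurable[m] fun p : RcllPath T E => p.1 t := by
    intro t
    refine @measurable_of_tendsto_metrizable' _ _ m _ _ _ _ _
      (fun (u : ↥(grid T ∩ Ici t)) (p : RcllPath T E) => p.1 u) (fun p => p.1 t)
      (rightFilter t) _ _ (fun u => ?_) (tendsto_pi_nhds.2 fun p => p.2.tendsto_rightFilter t)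
    exact (measurable_pi_apply (X := fun _ : grid T => E) (⟨u, u.2.1⟩ : grid T)).comp
      (comap_measurable _)
  have h2 : Measurable[m] (Subtype.val : RcllPath T E → Icc (0 : ℝ≥0) T → E) :=
    measurable_pi_lambda _ h1
  exact h2.comap_le

/-- Countable generation is needed twice: to disintegrate jointly measurably in a parameter, and to
conclude that kernels with equal composition products agree off a null set. -/
instance [TopologicalSpace.PseudoMetrizableSpace E] [BorelSpace E] [SecondCountableTopology E] :
    MeasurableSpace.CountablyGenerated (RcllPath T E) := by
  have := MeasurableSpace.CountablyGenerated.comap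
    (restrictGrid : RcllPath T E → grid T → E)
  rwa [comap_restrictGrid] at this

end RcllPaths

end AngularPart

namespace AngularPart

/-! ### The space of rcll paths in a Polish space is standard Borel. -/

section StandardBorel

/-- If the image were not Cauchy, there would be a pair `x, y` with images at distance at least `ε`
and, beyond `y` in the order `r`, a second such pair. The triples formed by the first pair and
either point of the second force both new images to be within `ε / 4` of `f y`, hence within `ε / 2`
of each other. -/
theorem cauchy_map_of_between {G Z : Type*} [PseudoMetricSpace Z] (r : G → G → Prop)
    (hr : ∀ x y, x ≠ y → r x y ∨ r y x) {l : Filter G} [NeBot l] {f : G → Z}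
    (h : ∀ ε > 0, ∃ U ∈ l, ∀ a ∈ U, ∀ b ∈ U, ∀ c ∈ U, r a b → r b c →
      dist (f a) (f b) ≤ ε ∨ dist (f b) (f c) ≤ ε)
    (hl : ∃ U ∈ l, ∀ x ∈ U, ∀ᶠ y in l, r x y) : Cauchy (map f l) := by
  rw [Metric.cauchy_iff]
  refine ⟨inferInstance, fun ε hε => ?_⟩
  obtain ⟨U, hU, hUε⟩ := h (ε / 4) (by positivity)
  obtain ⟨U₀, hU₀, hr₀⟩ := hl
  by_contra! hcon
  have pick : ∀ V ∈ l, ∃ x ∈ V, ∃ y ∈ V, r x y ∧ ε ≤ dist (f x) (f y) := by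
    intro V hV
    obtain ⟨_, ⟨x, hx, rfl⟩, _, ⟨y, hy, rfl⟩, hxy⟩ := hcon (f '' V) (image_mem_map hV)
    have hne : x ≠ y := by
      rintro rfl
      rw [dist_self] at hxy
      exact absurd hxy (not_le.2 hε)
    rcases hr x y hne with h | h
    · exact ⟨x, hx, y, hy, h, hxy⟩
    · exact ⟨y, hy, x, hx, h, by rwa [dist_comm]⟩
  obtain ⟨x, hx, y, hy, hxy, hd⟩ := pick (U ∩ U₀) (inter_mem hU hU₀)
  obtain ⟨x', hx', y', hy', -, hd'⟩ := pick (U ∩ {w | r y w}) (inter_mem hU (hr₀ y hy.2))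
  have hlt : ε / 4 < dist (f x) (f y) := by linarith
  have h1 : dist (f y) (f x') ≤ ε / 4 :=
    (hUε x hx.1 y hy.1 x' hx'.1 hxy hx'.2).resolve_left (not_le.2 hlt)
  have h2 : dist (f y) (f y') ≤ ε / 4 :=
    (hUε x hx.1 y hy.1 y' hy'.1 hxy hy'.2).resolve_left (not_le.2 hlt)
  have := dist_triangle_left (f x') (f y') (f y)
  linarith

variable {T : ℝ≥0} {Z : Type*}

/-- A metric characterization of the functions on the grid that extend to rcll functions. -/
def IsGridRcll [PseudoMetricSpace Z] (f : grid T → Z) : Prop :=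
  (∀ m : ℕ, ∃ n : ℕ, ∀ s t u : grid T, s < t → t < u →
    dist (s : Icc (0 : ℝ≥0) T) u < 1 / ((n : ℝ) + 1) →
      dist (f s) (f t) ≤ 1 / ((m : ℝ) + 1) ∨ dist (f t) (f u) ≤ 1 / ((m : ℝ) + 1)) ∧
  ∀ (q : grid T) (m : ℕ), ∃ n : ℕ, ∀ u : grid T, q ≤ u →
    dist (q : Icc (0 : ℝ≥0) T) u < 1 / ((n : ℝ) + 1) → dist (f q) (f u) ≤ 1 / ((m : ℝ) + 1)

theorem dist_le_of_between {a b c : Icc (0 : ℝ≥0) T} (hab : a ≤ b) (hbc : b ≤ c) :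
    dist a b ≤ dist a c := by
  have h1 : ((a : ℝ≥0) : ℝ) ≤ (b : ℝ≥0) := NNReal.coe_le_coe.2 hab
  have h2 : ((b : ℝ≥0) : ℝ) ≤ (c : ℝ≥0) := NNReal.coe_le_coe.2 hbc
  rw [Subtype.dist_eq, Subtype.dist_eq, NNReal.dist_eq, NNReal.dist_eq, abs_sub_comm,
    abs_of_nonneg (by linarith), abs_sub_comm, abs_of_nonneg (by linarith)]
  linarith

/-- Near `t₀` the path is close to its left limit before `t₀` and close to `f t₀` from `t₀` on. If
the middle time is before `t₀`, so is the first; otherwise the last is on the right as well. A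
Lebesgue number of the resulting cover makes this uniform. -/
theorem IsRcll.exists_osc [PseudoMetricSpace Z] {f : Icc (0 : ℝ≥0) T → Z} (hf : IsRcll f) {ε : ℝ}
    (hε : 0 < ε) : ∃ δ > 0, ∀ s t u : Icc (0 : ℝ≥0) T, s < t → t < u → dist s u < δ →
      dist (f s) (f t) ≤ ε ∨ dist (f t) (f u) ≤ ε := by
  have h1 : ∀ t₀ : Icc (0 : ℝ≥0) T, ∃ V, IsOpen V ∧ t₀ ∈ V ∧ ∀ s ∈ V, ∀ t ∈ V, ∀ u ∈ V,
      s < t → t < u → dist (f s) (f t) ≤ ε ∨ dist (f t) (f u) ≤ ε := by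
    intro t₀
    obtain ⟨hr, l, hl⟩ := hf t₀
    have e1 : ∀ᶠ x in 𝓝[≥] t₀, dist (f x) (f t₀) < ε / 2 :=
      hr.tendsto.eventually (Metric.ball_mem_nhds _ (by positivity))
    have e2 : ∀ᶠ x in 𝓝[<] t₀, dist (f x) l < ε / 2 :=
      hl.eventually (Metric.ball_mem_nhds _ (by positivity))
    obtain ⟨V₁, ho₁, ht₁, hV₁⟩ := mem_nhdsWithin.1 e1
    obtain ⟨V₂, ho₂, ht₂, hV₂⟩ := mem_nhdsWithin.1 e2
    refine ⟨V₁ ∩ V₂, ho₁.inter ho₂, ⟨ht₁, ht₂⟩, fun s hs t ht u hu hst htu => ?_⟩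
    rcases lt_or_ge t t₀ with h | h
    · have a1 : dist (f s) l < ε / 2 := hV₂ ⟨hs.2, hst.trans h⟩
      have a2 : dist (f t) l < ε / 2 := hV₂ ⟨ht.2, h⟩
      have := dist_triangle_right (f s) (f t) l
      exact Or.inl (by linarith)
    · have a1 : dist (f t) (f t₀) < ε / 2 := hV₁ ⟨ht.1, h⟩
      have a2 : dist (f u) (f t₀) < ε / 2 := hV₁ ⟨hu.1, h.trans htu.le⟩
      have := dist_triangle_right (f t) (f u) (f t₀)
      exact Or.inr (by linarith)
  choose V hVo hVm hV using h1
  obtain ⟨δ, hδ, hδV⟩ := lebesgue_number_lemma_of_metric (isCompact_univ (X := Icc (0 : ℝ≥0) T))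
    hVo (fun t _ => mem_iUnion.2 ⟨t, hVm t⟩)
  refine ⟨δ, hδ, fun s t u hst htu hsu => ?_⟩
  obtain ⟨i, hi⟩ := hδV s (mem_univ s)
  refine hV i s (hi (Metric.mem_ball_self hδ)) t (hi ?_) u (hi ?_) hst htu
  · rw [Metric.mem_ball, dist_comm]
    exact (dist_le_of_between hst.le htu.le).trans_lt hsu
  · rwa [Metric.mem_ball, dist_comm]

theorem isGridRcll_restrictGrid [PseudoMetricSpace Z] (p : RcllPath T Z) :
    IsGridRcll (restrictGrid p) := by
  refine ⟨fun m => ?_, fun q m => ?_⟩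
  · obtain ⟨δ, hδ, h⟩ := p.2.exists_osc (ε := 1 / ((m : ℝ) + 1)) (by positivity)
    obtain ⟨n, hn⟩ := exists_nat_one_div_lt hδ
    exact ⟨n, fun s t u hst htu hsu => h s t u hst htu (hsu.trans hn)⟩
  · have e1 : ∀ᶠ x in 𝓝[≥] (q : Icc (0 : ℝ≥0) T), dist (p.1 x) (p.1 q) < 1 / ((m : ℝ) + 1) :=
      (p.2 q).1.tendsto.eventually (Metric.ball_mem_nhds _ (by positivity))
    obtain ⟨δ, hδ, h⟩ := Metric.mem_nhdsWithin_iff.1 e1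
    obtain ⟨n, hn⟩ := exists_nat_one_div_lt hδ
    refine ⟨n, fun u hqu hd => ?_⟩
    have : dist (p.1 u) (p.1 q) < 1 / ((m : ℝ) + 1) :=
      h ⟨by rw [Metric.mem_ball, dist_comm]; exact hd.trans hn, hqu⟩
    rw [dist_comm]
    exact this.le

theorem IsGridRcll.exists_osc [PseudoMetricSpace Z] {f : grid T → Z} (hf : IsGridRcll f) {ε : ℝ}
    (hε : 0 < ε) : ∃ δ > 0, ∀ s t u : grid T, s < t → t < u →
      dist (s : Icc (0 : ℝ≥0) T) u < δ → dist (f s) (f t) ≤ ε ∨ dist (f t) (f u) ≤ ε := by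
  obtain ⟨m, hm⟩ := exists_nat_one_div_lt hε
  obtain ⟨n, hn⟩ := hf.1 m
  exact ⟨1 / ((n : ℝ) + 1), by positivity, fun s t u hst htu hsu =>
    (hn s t u hst htu hsu).imp (fun h => h.trans hm.le) fun h => h.trans hm.le⟩

theorem IsGridRcll.tendsto_grid [PseudoMetricSpace Z] {f : grid T → Z} (hf : IsGridRcll f)
    (t : grid T) : Tendsto f (comap Subtype.val (𝓝[≥] (t : Icc (0 : ℝ≥0) T))) (𝓝 (f t)) := by
  refine Metric.tendsto_nhds.2 fun ε hε => ?_
  obtain ⟨m, hm⟩ := exists_nat_one_div_lt hε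
  obtain ⟨n, hn⟩ := hf.2 t m
  have : Metric.ball (t : Icc (0 : ℝ≥0) T) (1 / ((n : ℝ) + 1)) ∩ Ici (t : Icc (0 : ℝ≥0) T)
      ∈ 𝓝[≥] (t : Icc (0 : ℝ≥0) T) :=
    inter_mem (mem_nhdsWithin_of_mem_nhds (Metric.ball_mem_nhds _ (by positivity)))
      self_mem_nhdsWithin
  refine mem_of_superset (preimage_mem_comap this) fun u hu => ?_
  have := hn u hu.2 (by rw [dist_comm]; exact hu.1)
  change dist (f u) (f t) < ε
  rw [dist_comm]
  exact this.trans_lt hm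

theorem IsGridRcll.exists_tendsto_left [PseudoMetricSpace Z] [CompleteSpace Z] [Nonempty Z]
    {f : grid T → Z}
    (hf : IsGridRcll f) (t : Icc (0 : ℝ≥0) T) :
    ∃ z, Tendsto f (comap Subtype.val (𝓝[<] t)) (𝓝 z) := by
  rcases eq_or_neBot (comap (Subtype.val : grid T → Icc (0 : ℝ≥0) T) (𝓝[<] t)) with h | h
  · exact ⟨Classical.arbitrary Z, by rw [h]; exact tendsto_bot⟩
  · refine CompleteSpace.complete (cauchy_map_of_between (· < ·) (fun x y => lt_or_gt_of_ne)
      (fun ε hε => ?_) ⟨Subtype.val ⁻¹' Iio t, preimage_mem_comap self_mem_nhdsWithin, ?_⟩)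
    · obtain ⟨δ, hδ, hfδ⟩ := hf.exists_osc hε
      refine ⟨Subtype.val ⁻¹' Metric.ball t (δ / 2), preimage_mem_comap
        (mem_nhdsWithin_of_mem_nhds (Metric.ball_mem_nhds _ (by positivity))), ?_⟩
      intro a ha b hb c hc hab hbc
      refine hfδ a b c hab hbc ?_
      have h1 : dist (a : Icc (0 : ℝ≥0) T) t < δ / 2 := ha
      have h2 : dist (c : Icc (0 : ℝ≥0) T) t < δ / 2 := hc
      have := dist_triangle_right (a : Icc (0 : ℝ≥0) T) c t
      linarith
    · intro x hx
      exact preimage_mem_comap (Ioo_mem_nhdsLT (show (x : Icc (0 : ℝ≥0) T) < t from hx))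
        |> fun h => mem_of_superset h fun y hy => hy.1

/-- At a grid time the second clause of `IsGridRcll` names the limit. At any other time no grid time
equals `t`, so only strictly later ones matter, and the oscillation condition applies with the order
reversed. -/
theorem IsGridRcll.exists_tendsto_right [PseudoMetricSpace Z] [CompleteSpace Z] [Nonempty Z]
    {f : grid T → Z}
    (hf : IsGridRcll f) (t : Icc (0 : ℝ≥0) T) :
    ∃ z, Tendsto f (comap Subtype.val (𝓝[≥] t)) (𝓝 z) := by
  by_cases ht : t ∈ grid T
  · exact ⟨f ⟨t, ht⟩, hf.tendsto_grid ⟨t, ht⟩⟩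
  · have heq : comap (Subtype.val : grid T → Icc (0 : ℝ≥0) T) (𝓝[≥] t)
        = comap Subtype.val (𝓝[>] t) := by
      refine le_antisymm ?_ (comap_mono (nhdsWithin_mono _ Ioi_subset_Ici_self))
      intro S hS
      obtain ⟨U, hU, hUS⟩ := hS
      obtain ⟨O, hO, htO, hOU⟩ := mem_nhdsWithin.1 hU
      refine ⟨O ∩ Ici t, mem_nhdsWithin.2 ⟨O, hO, htO, Subset.rfl⟩, fun u hu => hUS (hOU
        ⟨hu.1, ?_⟩)⟩
      refine lt_of_le_of_ne (show t ≤ u from hu.2) fun h => ht ?_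
      rw [h]
      exact u.2
    rw [heq]
    rcases eq_or_neBot (comap (Subtype.val : grid T → Icc (0 : ℝ≥0) T) (𝓝[>] t)) with h | h
    · exact ⟨Classical.arbitrary Z, by rw [h]; exact tendsto_bot⟩
    · refine CompleteSpace.complete (cauchy_map_of_between (fun x y => y < x)
        (fun x y h => (lt_or_gt_of_ne h).symm)
        (fun ε hε => ?_) ⟨Subtype.val ⁻¹' Ioi t, preimage_mem_comap self_mem_nhdsWithin, ?_⟩)
      · obtain ⟨δ, hδ, hfδ⟩ := hf.exists_osc hε
        refine ⟨Subtype.val ⁻¹' Metric.ball t (δ / 2), preimage_mem_comap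
          (mem_nhdsWithin_of_mem_nhds (Metric.ball_mem_nhds _ (by positivity))), ?_⟩
        intro a ha b hb c hc hab hbc
        have h1 : dist (a : Icc (0 : ℝ≥0) T) t < δ / 2 := ha
        have h2 : dist (c : Icc (0 : ℝ≥0) T) t < δ / 2 := hc
        have := dist_triangle_right (c : Icc (0 : ℝ≥0) T) a t
        have := hfδ c b a hbc hab (by linarith)
        rw [dist_comm (f a), dist_comm (f b) (f c)]
        exact this.symm
      · intro x hx
        exact preimage_mem_comap (Ioo_mem_nhdsGT (show t < (x : Icc (0 : ℝ≥0) T) from hx))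
          |> fun h => mem_of_superset h fun y hy => hy.2

theorem IsGridRcll.exists_extension [PseudoMetricSpace Z] [CompleteSpace Z] [T2Space Z] [Nonempty Z]
    {f : grid T → Z}
    (hf : IsGridRcll f) : ∃ p : RcllPath T Z, restrictGrid p = f := by
  choose F hF using hf.exists_tendsto_right
  have hne : ∀ t : Icc (0 : ℝ≥0) T,
      NeBot (comap (Subtype.val : grid T → Icc (0 : ℝ≥0) T) (𝓝[≥] t)) := by
    intro t
    rw [comap_neBot_iff]
    intro U hU
    obtain ⟨O, hO, htO, hOU⟩ := mem_nhdsWithin.1 hU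
    obtain ⟨u, hu, hug, hut⟩ := mem_closure_iff.1 (mem_closure_grid t) O hO htO
    exact ⟨⟨u, hug⟩, hOU ⟨hu, hut⟩⟩
  -- A value `F u` is a limit of values of `f` just to the right of `u`. The sets `S` contain a
  -- right neighbourhood of each of their points, and a closed neighbourhood of `z` that contains
  -- the values of `f` over `S` contains these limits.
  have key : ∀ (l : Filter (Icc (0 : ℝ≥0) T)) (z : Z),
      (∀ s ∈ l, ∃ S ∈ l, S ⊆ s ∧ ∀ u ∈ S, S ∈ 𝓝[≥] u) →
      Tendsto f (comap Subtype.val l) (𝓝 z) → Tendsto F l (𝓝 z) := by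
    intro l z hl hz
    rw [(closed_nhds_basis z).tendsto_right_iff]
    rintro V ⟨hV, hVc⟩
    obtain ⟨s, hs, hsV⟩ := hz hV
    obtain ⟨S, hS, hSs, hSo⟩ := hl s hs
    refine mem_of_superset hS fun u hu => ?_
    refine hVc.mem_of_tendsto (hF u) ?_
    exact mem_of_superset (preimage_mem_comap (hSo u hu)) fun x hx => hsV (hSs hx)
  refine ⟨⟨F, fun t => ⟨key _ _ (fun s hs => ?_) (hF t), ?_⟩⟩, funext fun t => ?_⟩
  · obtain ⟨O, hO, htO, hOU⟩ := mem_nhdsWithin.1 hs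
    refine ⟨O ∩ Ici t, mem_nhdsWithin.2 ⟨O, hO, htO, Subset.rfl⟩, hOU, fun u hu => ?_⟩
    exact mem_nhdsWithin.2 ⟨O, hO, hu.1, fun x hx => ⟨hx.1, le_trans (show t ≤ u from hu.2) hx.2⟩⟩
  · obtain ⟨z, hz⟩ := hf.exists_tendsto_left t
    refine ⟨z, key _ _ (fun s hs => ?_) hz⟩
    obtain ⟨O, hO, htO, hOU⟩ := mem_nhdsWithin.1 hs
    exact ⟨O ∩ Iio t, mem_nhdsWithin.2 ⟨O, hO, htO, Subset.rfl⟩, hOU, fun u hu =>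
      mem_nhdsWithin_of_mem_nhds ((hO.inter isOpen_Iio).mem_nhds hu)⟩
  · change F t = f t
    exact tendsto_nhds_unique (hF t) (hf.tendsto_grid t)

/-- All quantifiers in `IsGridRcll` range over the countable grid and over natural numbers; this is
the purpose of that formulation. -/
theorem measurableSet_isGridRcll [PseudoMetricSpace Z] [SecondCountableTopology Z]
    [MeasurableSpace Z] [BorelSpace Z] : MeasurableSet {f : grid T → Z | IsGridRcll f} := by
  have hd : ∀ (s t : grid T) (c : ℝ), MeasurableSet {f : grid T → Z | dist (f s) (f t) ≤ c} :=
    fun s t c => measurableSet_le ((measurable_pi_apply s).dist (measurable_pi_apply t))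
      measurable_const
  simp only [IsGridRcll, ofPred_and, ofPred_forall, ofPred_exists, ofPred_or]
  refine MeasurableSet.inter ?_ ?_
  · refine MeasurableSet.iInter fun m => MeasurableSet.iUnion fun n => MeasurableSet.iInter fun s =>
      MeasurableSet.iInter fun t => MeasurableSet.iInter fun u => MeasurableSet.iInter fun _ =>
      MeasurableSet.iInter fun _ => MeasurableSet.iInter fun _ => (hd _ _ _).union (hd _ _ _)
  · refine MeasurableSet.iInter fun q => MeasurableSet.iInter fun m => MeasurableSet.iUnion fun n =>
      MeasurableSet.iInter fun u => MeasurableSet.iInter fun _ => MeasurableSet.iInter fun _ =>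
      hd _ _ _

theorem _root_.MeasurableEmbedding.standardBorelSpace {α β : Type*} [MeasurableSpace α]
    [MeasurableSpace β] [StandardBorelSpace β] {f : α → β} (hf : MeasurableEmbedding f) :
    StandardBorelSpace α := by
  have : StandardBorelSpace (range f) := hf.measurableSet_range.standardBorel
  let e := hf.equivRange
  obtain ⟨τ, hτ, hp⟩ := StandardBorelSpace.polish (α := range f)
  let t : TopologicalSpace α := TopologicalSpace.induced e τ
  refine ⟨t, ⟨?_⟩, e.toEquiv.polishSpace_induced⟩
  rw [← e.measurableEmbedding.comap_eq]
  exact (congrArg (MeasurableSpace.comap (e.toEquiv : α → range f)) hτ.measurable_eq).trans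
    borel_comap.symm

/-- Restriction to the grid identifies the path space with a measurable subset of a countable
product of copies of `Z`. Regular conditional distributions of angular paths rest on this. -/
instance [TopologicalSpace Z] [PolishSpace Z] [MeasurableSpace Z] [BorelSpace Z] :
    StandardBorelSpace (RcllPath T Z) := by
  let := TopologicalSpace.upgradeIsCompletelyMetrizable Z
  refine MeasurableEmbedding.standardBorelSpace
    (f := (restrictGrid : RcllPath T Z → grid T → Z))
    ⟨restrictGrid_injective, measurable_restrictGrid, fun {A} hA => ?_⟩
  have h1 : range (restrictGrid : RcllPath T Z → grid T → Z) = {f | IsGridRcll f} := by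
    refine Subset.antisymm (range_subset_iff.2 isGridRcll_restrictGrid) fun f hf => ?_
    have : Nonempty Z := ⟨f ⟨_, lastTime_mem_grid⟩⟩
    exact hf.exists_extension
  have h2 := comap_restrictGrid (T := T) (E := Z)
  have h3 : MeasurableSet[MeasurableSpace.comap (restrictGrid : RcllPath T Z → grid T → Z)
      inferInstance] A := by rw [h2]; exact hA
  obtain ⟨B, hB, rfl⟩ := h3
  rw [image_preimage_eq_inter_range, h1]
  exact hB.inter measurableSet_isGridRcll

end StandardBorel

end AngularPart

namespace AngularPart

/-! ### Averaging over the compact isotropy group and increments in `K/M`. -/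

section Cosets

variable {K : Type*} [Group K] [TopologicalSpace K] [IsTopologicalGroup K] [PolishSpace K]
  [MeasurableSpace K] [BorelSpace K] (M : Subgroup K) [CompactSpace M]

/-- The uniform distribution on the compact subgroup `M`, as a measure on `K`. -/
def uniformMeasure : Measure K :=
  ((Measure.haarMeasure (⊤ : TopologicalSpace.PositiveCompacts M)).prod
    (Measure.haarMeasure (⊤ : TopologicalSpace.PositiveCompacts M))).map
      fun p => ((p.1 * p.2⁻¹ : M) : K)

instance : IsProbabilityMeasure (Measure.haarMeasure (⊤ : TopologicalSpace.PositiveCompacts M)) :=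
  ⟨by
    have := Measure.haarMeasure_self (K₀ := (⊤ : TopologicalSpace.PositiveCompacts M))
    simpa using this⟩

theorem measurable_mul_inv_coe : Measurable fun p : M × M => ((p.1 * p.2⁻¹ : M) : K) := by
  have : (fun p : M × M => ((p.1 * p.2⁻¹ : M) : K)) = fun p => (p.1 : K) * (p.2 : K)⁻¹ := by
    funext p
    simp
  rw [this]
  fun_prop

instance : IsProbabilityMeasure (uniformMeasure M) :=
  Measure.isProbabilityMeasure_map (measurable_mul_inv_coe M).aemeasurable

theorem ae_mem_uniformMeasure : ∀ᵐ m ∂(uniformMeasure M), m ∈ M := by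
  have hM : IsClosed (M : Set K) := (isCompact_iff_compactSpace.2 ‹_›).isClosed
  rw [uniformMeasure]
  refine (ae_map_iff (p := fun m => m ∈ M) (measurable_mul_inv_coe M).aemeasurable
    hM.measurableSet).2 ?_
  exact Eventually.of_forall fun p => (p.1 * p.2⁻¹).2

theorem map_mul_left_uniformMeasure {m : K} (hm : m ∈ M) :
    (uniformMeasure M).map (fun k => m * k) = uniformMeasure M := by
  set h := Measure.haarMeasure (⊤ : TopologicalSpace.PositiveCompacts M)
  have h1 : (h.prod h).map (Prod.map (fun a => (⟨m, hm⟩ : M) * a) id) = h.prod h := by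
    rw [← Measure.map_prod_map _ _ (measurable_const_mul _) measurable_id, Measure.map_id,
      map_mul_left_eq_self]
  conv_rhs => rw [uniformMeasure, ← h1]
  rw [uniformMeasure, Measure.map_map (measurable_const_mul _) (measurable_mul_inv_coe M),
    Measure.map_map (measurable_mul_inv_coe M)
      ((measurable_const_mul _).prodMap measurable_id)]
  congr 1
  funext p
  simp [mul_assoc]

/-- The measure is the law of a quotient of two independent Haar variables, and inversion merely
exchanges them; unimodularity of compact groups is not needed. -/
theorem map_inv_uniformMeasure : (uniformMeasure M).map (fun k => k⁻¹) = uniformMeasure M := by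
  set h := Measure.haarMeasure (⊤ : TopologicalSpace.PositiveCompacts M)
  conv_rhs => rw [uniformMeasure, ← Measure.prod_swap]
  rw [uniformMeasure, Measure.map_map measurable_inv (measurable_mul_inv_coe M),
    Measure.map_map (measurable_mul_inv_coe M) measurable_swap]
  congr 1
  funext p
  simp

theorem lintegral_mul_uniformMeasure {m : K} (hm : m ∈ M) {f : K → ℝ≥0∞} (hf : Measurable f) :
    ∫⁻ k, f (m * k) ∂(uniformMeasure M) = ∫⁻ k, f k ∂(uniformMeasure M) := by
  conv_rhs => rw [← map_mul_left_uniformMeasure M hm]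
  rw [lintegral_map hf (measurable_const_mul _)]

theorem lintegral_inv_uniformMeasure {f : K → ℝ≥0∞} (hf : Measurable f) :
    ∫⁻ k, f k⁻¹ ∂(uniformMeasure M) = ∫⁻ k, f k ∂(uniformMeasure M) := by
  conv_rhs => rw [← map_inv_uniformMeasure M]
  rw [lintegral_map hf measurable_inv]

theorem measurable_map_mul_uniformMeasure :
    Measurable fun k : K => (uniformMeasure M).map (fun m => k * m) := by
  refine Measure.measurable_of_measurable_coe _ fun B hB => ?_
  have : ∀ k : K, (uniformMeasure M).map (fun m => k * m) B
      = uniformMeasure M (Prod.mk k ⁻¹' ((fun p : K × K => p.1 * p.2) ⁻¹' B)) :=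
    fun k => Measure.map_apply (measurable_const_mul _) hB
  simp only [this]
  exact measurable_measure_prodMk_left (measurable_mul hB)

variable {M} [MeasurableSpace (K ⧸ M)] [BorelSpace (K ⧸ M)] [PolishSpace (K ⧸ M)]

@[fun_prop]
theorem measurable_coset_mk : Measurable fun k : K => (k : K ⧸ M) :=
  QuotientGroup.continuous_mk.measurable

theorem map_mul_uniformMeasure_eq {k l : K} (h : (k : K ⧸ M) = l) :
    (uniformMeasure M).map (fun m => k * m) = (uniformMeasure M).map (fun m => l * m) := by
  have hm := QuotientGroup.eq.1 h
  conv_lhs => rw [← map_mul_left_uniformMeasure M hm]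
  rw [Measure.map_map (measurable_const_mul _) (measurable_const_mul _)]
  congr 1
  funext m
  simp [mul_assoc]

/-- The kernel that sends `k M` to the uniform distribution on the coset `k M`. -/
def cosetKernel (M : Subgroup K) [CompactSpace M] [MeasurableSpace (K ⧸ M)] [BorelSpace (K ⧸ M)]
    [PolishSpace (K ⧸ M)] : Kernel (K ⧸ M) K where
  toFun z := (uniformMeasure M).map (fun m => z.out * m)
  measurable' := by
    -- The representative `z.out` need not depend measurably on `z`. The measure depends on the
    -- coset alone, and a Borel surjection from a Polish space onto `K ⧸ M` detects measurability,
    -- so it suffices to check it on `K`.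
    refine (measurable_coset_mk.measurable_comp_iff_of_surjective
      (QuotientGroup.mk_surjective (s := M))).1 ?_
    have : (fun z : K ⧸ M => (uniformMeasure M).map (fun m => z.out * m)) ∘ (fun k : K => (k : K ⧸ M))
        = fun k => (uniformMeasure M).map (fun m => k * m) :=
      funext fun k => map_mul_uniformMeasure_eq (Quotient.out_eq _)
    exact this ▸ measurable_map_mul_uniformMeasure M

theorem cosetKernel_mk (k : K) :
    (cosetKernel M (k : K ⧸ M) : Measure K) = (uniformMeasure M).map (fun m => k * m) :=
  map_mul_uniformMeasure_eq (Quotient.out_eq _)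

instance : IsMarkovKernel (cosetKernel M) :=
  ⟨fun _ => Measure.isProbabilityMeasure_map (measurable_const_mul _).aemeasurable⟩

theorem lintegral_cosetKernel (k : K) {f : K → ℝ≥0∞} (hf : Measurable f) :
    ∫⁻ l, f l ∂(cosetKernel M (k : K ⧸ M)) = ∫⁻ m, f (k * m) ∂(uniformMeasure M) := by
  rw [cosetKernel_mk, lintegral_map hf (measurable_const_mul _)]

/-! ### Increments -/

/-- The distribution of the increment `z⁻¹ w`, made invariant under `M`. -/
def incrementKernel (M : Subgroup K) [CompactSpace M] [MeasurableSpace (K ⧸ M)]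
    [BorelSpace (K ⧸ M)] [PolishSpace (K ⧸ M)] : Kernel ((K ⧸ M) × (K ⧸ M)) (K ⧸ M) :=
  ((cosetKernel M).comap Prod.fst measurable_fst ×ₖ
    Kernel.deterministic Prod.snd measurable_snd).map fun p => p.1⁻¹ • p.2

theorem measurable_inv_smul : Measurable fun p : K × (K ⧸ M) => p.1⁻¹ • p.2 :=
  measurable_fst.inv.smul measurable_snd

theorem measurable_coset_smul : Measurable fun p : K × (K ⧸ M) => p.1 • p.2 :=
  measurable_fst.smul measurable_snd

instance : IsMarkovKernel (incrementKernel M) :=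
  Kernel.IsMarkovKernel.map _ measurable_inv_smul

/-- A random representative of the coset is `k * m`, with `(k * m)⁻¹ • w = m⁻¹ • k⁻¹ • w`;
invariance under inversion replaces `m⁻¹` by `m`. -/
theorem lintegral_incrementKernel (k : K) (w : K ⧸ M) {f : K ⧸ M → ℝ≥0∞} (hf : Measurable f) :
    ∫⁻ v, f v ∂(incrementKernel M ((k : K ⧸ M), w))
      = ∫⁻ m, f (m • k⁻¹ • w) ∂(uniformMeasure M) := by
  rw [incrementKernel, Kernel.lintegral_map _ measurable_inv_smul _ hf,
    Kernel.lintegral_prod _ _ _ (g := fun p : K × (K ⧸ M) => f (p.1⁻¹ • p.2))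
      (hf.comp measurable_inv_smul), Kernel.lintegral_comap]
  have h1 : ∀ l : K, ∫⁻ c, f (l⁻¹ • c) ∂(Measure.dirac w) = f (l⁻¹ • w) := fun l =>
    lintegral_dirac' (f := fun c => f (l⁻¹ • c)) _ (hf.comp (measurable_const_smul _))
  simp only [Kernel.deterministic_apply, h1]
  rw [lintegral_cosetKernel k (f := fun l => f (l⁻¹ • w)) (by fun_prop),
    ← lintegral_inv_uniformMeasure _ (by fun_prop)]
  simp [mul_smul]

/-- A measure on `K / M` that is invariant under `M`. -/
def IsInvariantUnder (M : Subgroup K) [MeasurableSpace (K ⧸ M)] (μ : Measure (K ⧸ M)) : Prop :=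
  ∀ m ∈ M, μ.map (fun z => m • z) = μ

theorem IsInvariantUnder.lintegral_smul {μ : Measure (K ⧸ M)} (h : IsInvariantUnder M μ) {m : K}
    (hm : m ∈ M) {f : K ⧸ M → ℝ≥0∞} (hf : Measurable f) :
    ∫⁻ z, f (m • z) ∂μ = ∫⁻ z, f z ∂μ := by
  conv_rhs => rw [← h m hm]
  rw [lintegral_map hf (measurable_const_smul m)]

theorem isInvariantUnder_of_lintegral {μ : Measure (K ⧸ M)}
    (h : ∀ m ∈ M, ∀ f : K ⧸ M → ℝ≥0∞, Measurable f → ∫⁻ z, f (m • z) ∂μ = ∫⁻ z, f z ∂μ) :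
    IsInvariantUnder M μ := by
  intro m hm
  refine Measure.ext_of_lintegral _ fun f hf => ?_
  rw [lintegral_map hf (measurable_const_smul m), h m hm f hf]

theorem isInvariantUnder_incrementKernel (x : (K ⧸ M) × (K ⧸ M)) :
    IsInvariantUnder M (incrementKernel M x) := by
  obtain ⟨z, w⟩ := x
  obtain ⟨k, rfl⟩ := QuotientGroup.mk_surjective z
  refine isInvariantUnder_of_lintegral fun m hm f hf => ?_
  rw [lintegral_incrementKernel k w hf,
    lintegral_incrementKernel k w (f := fun z => f (m • z)) (hf.comp (measurable_const_smul m)),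
    ← lintegral_mul_uniformMeasure M hm (f := fun m => f (m • k⁻¹ • w))]
  · simp only [mul_smul]
  · exact hf.comp (measurable_id.smul measurable_const)

theorem incrementKernel_smul (k : K) (z w : K ⧸ M) :
    incrementKernel M (k • z, k • w) = incrementKernel M (z, w) := by
  obtain ⟨l, rfl⟩ := QuotientGroup.mk_surjective z
  refine Measure.ext_of_lintegral _ fun f hf => ?_
  rw [MulAction.Quotient.smul_coe, lintegral_incrementKernel _ _ hf,
    lintegral_incrementKernel _ _ hf]
  simp [mul_smul]

/-- The factor `k` cancels, and what is left is the average of `μ` over `M`, which is `μ`. An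
invariant step distribution is thus recovered from the averaged increments. -/
theorem IsInvariantUnder.lintegral_incrementKernel {μ : Measure (K ⧸ M)} [SFinite μ]
    (h : IsInvariantUnder M μ)
    (k : K) {f : K ⧸ M → ℝ≥0∞} (hf : Measurable f) :
    ∫⁻ w, ∫⁻ v, f v ∂(incrementKernel M ((k : K ⧸ M), k • w)) ∂μ = ∫⁻ w, f w ∂μ := by
  simp only [AngularPart.lintegral_incrementKernel k _ hf, inv_smul_smul]
  have hm : Measurable (Function.uncurry fun (w : K ⧸ M) (m : K) => f (m • w)) :=
    hf.comp (measurable_snd.smul measurable_fst)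
  rw [lintegral_lintegral_swap hm.aemeasurable]
  have : ∀ᵐ m ∂(uniformMeasure M), ∫⁻ w, f (m • w) ∂μ = ∫⁻ w, f w ∂μ := by
    filter_upwards [ae_mem_uniformMeasure M] with m hm
    exact h.lintegral_smul hm hf
  rw [lintegral_congr_ae this]
  simp

theorem incrementKernel_self (z : K ⧸ M) :
    incrementKernel M (z, z) = Measure.dirac ((1 : K) : K ⧸ M) := by
  obtain ⟨k, rfl⟩ := QuotientGroup.mk_surjective z
  refine Measure.ext_of_lintegral _ fun f hf => ?_
  rw [lintegral_incrementKernel _ _ hf, lintegral_dirac' _ hf]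
  have : ∀ᵐ m ∂(uniformMeasure M), f (m • k⁻¹ • (k : K ⧸ M)) = f ((1 : K) : K ⧸ M) := by
    filter_upwards [ae_mem_uniformMeasure M] with m hm
    rw [MulAction.Quotient.smul_coe, MulAction.Quotient.smul_coe]
    congr 1
    rw [QuotientGroup.eq]
    simpa using hm
  rw [lintegral_congr_ae this]
  simp

/-- The kernel that sends `z = k M` to the distribution of `k w`, where `w` has the distribution
`μ`. -/
def translateKernel (μ : Measure (K ⧸ M)) [SFinite μ] : Kernel (K ⧸ M) (K ⧸ M) :=
  ((cosetKernel M) ×ₖ Kernel.const _ μ).map fun p => p.1 • p.2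

instance (μ : Measure (K ⧸ M)) [IsProbabilityMeasure μ] : IsMarkovKernel (translateKernel μ) :=
  Kernel.IsMarkovKernel.map _ measurable_coset_smul

/-- The random representative `k * m` differs from `k` by a factor in `M`, which the invariance of
`μ` absorbs. -/
theorem IsInvariantUnder.translateKernel_mk {μ : Measure (K ⧸ M)} [SFinite μ]
    (h : IsInvariantUnder M μ) (k : K) :
    translateKernel μ (k : K ⧸ M) = μ.map fun z => k • z := by
  refine Measure.ext_of_lintegral _ fun f hf => ?_
  rw [translateKernel, Kernel.lintegral_map _ measurable_coset_smul _ hf,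
    Kernel.lintegral_prod _ _ _ (g := fun p : K × (K ⧸ M) => f (p.1 • p.2))
      (hf.comp measurable_coset_smul)]
  simp only [Kernel.const_apply]
  rw [lintegral_cosetKernel _ (Measurable.lintegral_prod_right'
      (f := fun p : K × (K ⧸ M) => f (p.1 • p.2)) (hf.comp measurable_coset_smul)),
    lintegral_map hf (measurable_const_smul k)]
  have : ∀ᵐ m ∂(uniformMeasure M), ∫⁻ w, f ((k * m) • w) ∂μ = ∫⁻ w, f (k • w) ∂μ := by
    filter_upwards [ae_mem_uniformMeasure M] with m hm
    simp only [mul_smul]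
    exact h.lintegral_smul hm (f := fun z => f (k • z)) (hf.comp (measurable_const_smul k))
  rw [lintegral_congr_ae this]
  simp

/-- The kernel that sends `(z, z', w)` to the distribution of `z z'⁻¹ w`, made invariant. -/
def transportKernel (M : Subgroup K) [CompactSpace M] [MeasurableSpace (K ⧸ M)]
    [BorelSpace (K ⧸ M)] [PolishSpace (K ⧸ M)] :
    Kernel ((K ⧸ M) × (K ⧸ M) × (K ⧸ M)) (K ⧸ M) :=
  ((cosetKernel M).comap Prod.fst measurable_fst ×ₖ
    (incrementKernel M).comap Prod.snd measurable_snd).map fun p => p.1 • p.2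

instance : IsMarkovKernel (transportKernel M) :=
  Kernel.IsMarkovKernel.map _ measurable_coset_smul

theorem transportKernel_mk (l k : K) (w : K ⧸ M) :
    transportKernel M ((l : K ⧸ M), (k : K ⧸ M), w)
      = (uniformMeasure M).map fun m => l • m • k⁻¹ • w := by
  have hm : Measurable fun m : K => l • m • k⁻¹ • w :=
    (measurable_const_smul l).comp (measurable_id.smul measurable_const)
  have h1 : transportKernel M ((l : K ⧸ M), (k : K ⧸ M), w)
      = translateKernel (incrementKernel M ((k : K ⧸ M), w)) (l : K ⧸ M) := by
    rw [transportKernel, translateKernel, Kernel.map_apply _ measurable_coset_smul,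
      Kernel.map_apply _ measurable_coset_smul, Kernel.prod_apply, Kernel.prod_apply]
    rfl
  rw [h1, (isInvariantUnder_incrementKernel _).translateKernel_mk]
  refine Measure.ext_of_lintegral _ fun f hf => ?_
  rw [lintegral_map hf (measurable_const_smul l), lintegral_map hf hm,
    lintegral_incrementKernel k w (f := fun z => f (l • z)) (hf.comp (measurable_const_smul l))]

/-- All limits in time go through this continuity. Pulled back along the open quotient map from `K ×
K × (K ⧸ M)`, the integral is an average over `M` of a bounded continuous function of the
representatives, so dominated convergence applies; no continuous section is needed. -/
theorem continuous_integral_transportKernel (f : K ⧸ M →ᵇ ℝ) :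
    Continuous fun x : (K ⧸ M) × (K ⧸ M) × (K ⧸ M) => ∫ v, f v ∂(transportKernel M x) := by
  have hq : IsOpenQuotientMap fun p : K × K × (K ⧸ M) =>
      ((p.1 : K ⧸ M), (p.2.1 : K ⧸ M), p.2.2) :=
    QuotientGroup.isOpenQuotientMap_mk.prodMap
      (QuotientGroup.isOpenQuotientMap_mk.prodMap IsOpenQuotientMap.id)
  rw [hq.isQuotientMap.continuous_iff]
  have h1 : (fun x : (K ⧸ M) × (K ⧸ M) × (K ⧸ M) => ∫ v, f v ∂(transportKernel M x)) ∘
      (fun p : K × K × (K ⧸ M) => ((p.1 : K ⧸ M), (p.2.1 : K ⧸ M), p.2.2))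
      = fun p => ∫ m, f (p.1 • m • p.2.1⁻¹ • p.2.2) ∂(uniformMeasure M) := by
    funext p
    have hm : Measurable fun m : K => p.1 • m • p.2.1⁻¹ • p.2.2 :=
      (measurable_const_smul p.1).comp (measurable_id.smul measurable_const)
    simp only [Function.comp]
    rw [transportKernel_mk, integral_map hm.aemeasurable
      f.continuous.stronglyMeasurable.aestronglyMeasurable]
  rw [h1]
  refine continuous_of_dominated (bound := fun _ => ‖f‖) (fun p => ?_) (fun p => ?_)
    (integrable_const _) ?_
  · refine (f.continuous.comp ?_).stronglyMeasurable.aestronglyMeasurable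
    fun_prop
  · exact Eventually.of_forall fun m => f.norm_coe_le_norm _
  · refine Eventually.of_forall fun m => f.continuous.comp ?_
    fun_prop

theorem transportKernel_one (z w : K ⧸ M) :
    transportKernel M (((1 : K) : K ⧸ M), z, w) = incrementKernel M (z, w) := by
  obtain ⟨k, rfl⟩ := QuotientGroup.mk_surjective z
  refine Measure.ext_of_lintegral _ fun f hf => ?_
  rw [transportKernel_mk, lintegral_incrementKernel k w hf, lintegral_map hf]
  · simp
  · exact (measurable_const_smul (1 : K)).comp (measurable_id.smul measurable_const)

end Cosets

end AngularPart

namespace AngularPart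

theorem integral_bind_kernel {α β : Type*} [MeasurableSpace α] [MeasurableSpace β] {μ : Measure α}
    [SFinite μ] {κ : Kernel α β} [IsSFiniteKernel κ] {f : β → ℝ} (hf : Integrable f (μ.bind κ)) :
    ∫ b, f b ∂(μ.bind κ) = ∫ a, ∫ b, f b ∂(κ a) ∂μ := by
  rw [← Measure.snd_compProd] at hf ⊢
  rw [Measure.snd] at hf ⊢
  rw [integral_map measurable_snd.aemeasurable hf.aestronglyMeasurable,
    Measure.integral_compProd (f := fun x : α × β => f x.2) (hf.comp_measurable measurable_snd)]

/-! ### Increment laws and independence of one increment from the past. -/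

section Step

universe u

variable {K : Type u} [Group K] [TopologicalSpace K] [IsTopologicalGroup K] [PolishSpace K]
  [MeasurableSpace K] [BorelSpace K] {M : Subgroup K} [CompactSpace M]
  [MeasurableSpace (K ⧸ M)] [BorelSpace (K ⧸ M)] [PolishSpace (K ⧸ M)] {T : ℝ≥0}

theorem measurable_eval_pair (s t : Icc (0 : ℝ≥0) T) :
    Measurable fun q : RcllPath T (K ⧸ M) => (q.1 s, q.1 t) :=
  (measurable_eval s).prodMk (measurable_eval t)

/-- The distribution of the invariant increment between the times `s` and `t` under the law `Q`. -/
def incrementLaw (Q : Measure (RcllPath T (K ⧸ M))) (s t : Icc (0 : ℝ≥0) T) : Measure (K ⧸ M) :=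
  (Q.map fun q => (q.1 s, q.1 t)).bind (incrementKernel M)

variable (Q : Measure (RcllPath T (K ⧸ M))) [IsProbabilityMeasure Q]

theorem lintegral_incrementLaw (s t : Icc (0 : ℝ≥0) T) {f : K ⧸ M → ℝ≥0∞} (hf : Measurable f) :
    ∫⁻ w, f w ∂(incrementLaw Q s t)
      = ∫⁻ q, ∫⁻ w, f w ∂(incrementKernel M (q.1 s, q.1 t)) ∂Q := by
  rw [incrementLaw, Measure.lintegral_bind (Kernel.measurable _).aemeasurable hf.aemeasurable,
    lintegral_map hf.lintegral_kernel (measurable_eval_pair s t)]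

instance (s t : Icc (0 : ℝ≥0) T) : IsProbabilityMeasure (incrementLaw Q s t) := by
  refine ⟨?_⟩
  have := lintegral_incrementLaw Q s t (f := fun _ => 1) measurable_const
  simpa using this

theorem isInvariantUnder_incrementLaw (s t : Icc (0 : ℝ≥0) T) :
    IsInvariantUnder M (incrementLaw Q s t) := by
  refine isInvariantUnder_of_lintegral fun m hm f hf => ?_
  rw [lintegral_incrementLaw Q s t hf,
    lintegral_incrementLaw Q s t (f := fun z => f (m • z)) (hf.comp (measurable_const_smul m))]
  exact lintegral_congr fun q =>
    (isInvariantUnder_incrementKernel _).lintegral_smul hm hf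

theorem incrementLaw_self (t : Icc (0 : ℝ≥0) T) :
    incrementLaw Q t t = Measure.dirac ((1 : K) : K ⧸ M) := by
  refine Measure.ext_of_lintegral _ fun f hf => ?_
  rw [lintegral_incrementLaw Q t t hf]
  simp [incrementKernel_self]

/-- Transport starting from the base coset is the averaged increment, so the continuity of the
transport integrals passes to increment laws. -/
theorem integral_incrementLaw (s t : Icc (0 : ℝ≥0) T) (f : K ⧸ M →ᵇ ℝ) :
    ∫ w, f w ∂(incrementLaw Q s t)
      = ∫ q, ∫ v, f v ∂(transportKernel M (((1 : K) : K ⧸ M), q.1 s, q.1 t)) ∂Q := by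
  have : IsProbabilityMeasure (Q.map fun q => (q.1 s, q.1 t)) :=
    Measure.isProbabilityMeasure_map (measurable_eval_pair s t).aemeasurable
  have hc : Continuous fun x : (K ⧸ M) × (K ⧸ M) => ∫ v, f v ∂(incrementKernel M x) := by
    have h1 := (continuous_integral_transportKernel f).comp
      (Continuous.prodMk (continuous_const (y := ((1 : K) : K ⧸ M)))
        (continuous_id (X := (K ⧸ M) × (K ⧸ M))))
    refine h1.congr fun x => ?_
    simp only [Function.comp, id]
    rw [transportKernel_one]
  have hp : IsProbabilityMeasure (incrementLaw Q s t) := inferInstance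
  rw [incrementLaw] at hp ⊢
  rw [integral_bind_kernel (f.integrable _),
    integral_map (measurable_eval_pair s t).aemeasurable hc.stronglyMeasurable.aestronglyMeasurable]
  simp only [transportKernel_one]

theorem tendsto_integral_incrementLaw (s : Icc (0 : ℝ≥0) T) (f : K ⧸ M →ᵇ ℝ) :
    Tendsto (fun t => ∫ z, f z ∂(incrementLaw Q s t)) (𝓝[>] s)
      (𝓝 (∫ z, f z ∂(incrementLaw Q s s))) := by
  simp only [integral_incrementLaw]
  have hc := continuous_integral_transportKernel f
  refine tendsto_integral_filter_of_dominated_convergence (fun _ => ‖f‖) ?_ ?_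
    (integrable_const _) ?_
  · refine Eventually.of_forall fun t => ?_
    exact (hc.measurable.comp (measurable_const.prodMk
      (measurable_eval_pair s t))).aestronglyMeasurable
  · refine Eventually.of_forall fun t => Eventually.of_forall fun q => ?_
    exact f.norm_integral_le_norm _
  · refine Eventually.of_forall fun q => ?_
    refine (hc.tendsto (_, q.1 s, q.1 s)).comp ?_
    refine tendsto_const_nhds.prodMk_nhds (tendsto_const_nhds.prodMk_nhds ?_)
    exact (q.2 s).1.tendsto.mono_left (nhdsWithin_mono _ Ioi_subset_Ici_self)

/-- Moves the dependence on `s` and `t` from the increment law into the points `q.1 s` and `q.1 t`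
of an independent path, where right continuity can act. -/
theorem translateKernel_incrementLaw_apply (s t : Icc (0 : ℝ≥0) T) (z : K ⧸ M)
    {B : Set (K ⧸ M)} (hB : MeasurableSet B) :
    translateKernel (incrementLaw Q s t) z B
      = ∫⁻ q, transportKernel M (z, q.1 s, q.1 t) B ∂Q := by
  obtain ⟨k, rfl⟩ := QuotientGroup.mk_surjective z
  rw [(isInvariantUnder_incrementLaw Q s t).translateKernel_mk,
    ← lintegral_indicator_one hB,
    lintegral_map (measurable_one.indicator hB) (measurable_const_smul k),
    lintegral_incrementLaw Q s t (f := fun a => B.indicator 1 (k • a))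
      ((measurable_one.indicator hB).comp (measurable_const_smul k))]
  refine lintegral_congr fun q => ?_
  obtain ⟨l, hl⟩ := QuotientGroup.mk_surjective (q.1 s)
  rw [← hl, lintegral_incrementKernel _ _ (f := fun a => B.indicator 1 (k • a))
    ((measurable_one.indicator hB).comp (measurable_const_smul k)), transportKernel_mk,
    ← lintegral_indicator_one hB, lintegral_map (measurable_one.indicator hB)]
  · exact (measurable_const_smul k).comp (measurable_id.smul measurable_const)

/-- Under `Q`, the increment between `s` and `t` is independent of the path up to time `s`. -/
def HasIndepIncrement (s t : Icc (0 : ℝ≥0) T) : Prop :=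
  ∀ A, MeasurableSet[evalSigma (K ⧸ M) firstTime s] A → ∀ B, MeasurableSet B →
    Q (A ∩ {q | q.1 t ∈ B}) = ∫⁻ q in A, translateKernel (incrementLaw Q s t) (q.1 s) B ∂Q

/-- The measure `B ↦ ∫_A ∫ transport(q_s, q'_s, q'_t)(B) Q(dq') Q(dq)`. -/
def transportLaw (A : Set (RcllPath T (K ⧸ M))) (s t : Icc (0 : ℝ≥0) T) : Measure (K ⧸ M) :=
  (((Q.restrict A).prod Q).map fun p => (p.1.1 s, p.2.1 s, p.2.1 t)).bind (transportKernel M)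

theorem measurable_eval_triple (s t : Icc (0 : ℝ≥0) T) :
    Measurable fun p : RcllPath T (K ⧸ M) × RcllPath T (K ⧸ M) => (p.1.1 s, p.2.1 s, p.2.1 t) :=
  ((measurable_eval s).comp measurable_fst).prodMk
    ((measurable_eval_pair s t).comp measurable_snd)

theorem transportLaw_apply (A : Set (RcllPath T (K ⧸ M))) (s t : Icc (0 : ℝ≥0) T)
    {B : Set (K ⧸ M)} (hB : MeasurableSet B) :
    transportLaw Q A s t B = ∫⁻ q in A, translateKernel (incrementLaw Q s t) (q.1 s) B ∂Q := by
  rw [transportLaw, Measure.bind_apply hB (Kernel.measurable _).aemeasurable,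
    lintegral_map (Kernel.measurable_coe _ hB) (measurable_eval_triple s t), lintegral_prod]
  · exact lintegral_congr fun q => (translateKernel_incrementLaw_apply Q s t (q.1 s) hB).symm
  · exact ((Kernel.measurable_coe _ hB).comp (measurable_eval_triple s t)).aemeasurable

instance (A : Set (RcllPath T (K ⧸ M))) (s t : Icc (0 : ℝ≥0) T) :
    IsFiniteMeasure (transportLaw Q A s t) := by
  refine ⟨?_⟩
  rw [transportLaw_apply Q A s t MeasurableSet.univ]
  simp

theorem integral_transportLaw (A : Set (RcllPath T (K ⧸ M))) (s t : Icc (0 : ℝ≥0) T)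
    (f : K ⧸ M →ᵇ ℝ) :
    ∫ w, f w ∂(transportLaw Q A s t)
      = ∫ p, ∫ v, f v ∂(transportKernel M (p.1.1 s, p.2.1 s, p.2.1 t)) ∂((Q.restrict A).prod Q) := by
  have hp : IsFiniteMeasure (transportLaw Q A s t) := inferInstance
  rw [transportLaw] at hp ⊢
  rw [integral_bind_kernel (f.integrable _), integral_map (measurable_eval_triple s t).aemeasurable
    (continuous_integral_transportKernel f).stronglyMeasurable.aestronglyMeasurable]

variable {Q}

theorem hasIndepIncrement_iff {s t : Icc (0 : ℝ≥0) T} :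
    HasIndepIncrement Q s t ↔ ∀ A, MeasurableSet[evalSigma (K ⧸ M) firstTime s] A →
      (Q.restrict A).map (fun q => q.1 t) = transportLaw Q A s t := by
  refine forall₂_congr fun A hA => ⟨fun h => ?_, fun h B hB => ?_⟩
  · ext B hB
    rw [Measure.map_apply (measurable_eval t) hB, transportLaw_apply Q A s t hB, ← h B hB,
      Measure.restrict_apply (measurable_eval t hB), inter_comm]
    rfl
  · rw [← transportLaw_apply Q A s t hB, ← h, Measure.map_apply (measurable_eval t) hB,
      Measure.restrict_apply (measurable_eval t hB), inter_comm]
    rfl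

theorem hasIndepIncrement_self (t : Icc (0 : ℝ≥0) T) : HasIndepIncrement Q t t := by
  intro A hA B hB
  have hA' : MeasurableSet A := evalSigma_le _ hA
  have h : ∀ z : K ⧸ M, translateKernel (incrementLaw Q t t) z B = B.indicator 1 z := by
    intro z
    obtain ⟨k, rfl⟩ := QuotientGroup.mk_surjective z
    rw [(isInvariantUnder_incrementLaw Q t t).translateKernel_mk, incrementLaw_self,
      Measure.map_dirac' (measurable_const_smul k), Measure.dirac_apply' _ hB,
      MulAction.Quotient.smul_coe]
    simp
  simp only [h]
  have hB' : MeasurableSet {q : RcllPath T (K ⧸ M) | q.1 t ∈ B} := measurable_eval t hB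
  calc Q (A ∩ {q | q.1 t ∈ B}) = Q.restrict A {q | q.1 t ∈ B} := by
        rw [Measure.restrict_apply hB', inter_comm]
    _ = ∫⁻ q in A, B.indicator 1 (q.1 t) ∂Q := (lintegral_indicator_one hB').symm

/-- Tested against a bounded continuous function, both sides are integrals of continuous functions
of path values, so they converge as grid times decrease to `s` and `t`. The event `A` can be kept
fixed, since the past of `s` is contained in the past of every later grid time. -/
theorem HasIndepIncrement.of_grid
    (h : ∀ s ∈ grid T, ∀ t ∈ grid T, s ≤ t → HasIndepIncrement Q s t) {s t : Icc (0 : ℝ≥0) T}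
    (hst : s ≤ t) : HasIndepIncrement Q s t := by
  rcases hst.eq_or_lt with rfl | hst
  · exact hasIndepIncrement_self _
  refine hasIndepIncrement_iff.2 fun A hA => ?_
  refine ext_of_forall_integral_eq_of_IsFiniteMeasure fun f => ?_
  rw [integral_map (measurable_eval t).aemeasurable
    f.continuous.stronglyMeasurable.aestronglyMeasurable, integral_transportLaw]
  have hc := continuous_integral_transportKernel f
  have l1 : Tendsto (fun x : ↥(grid T ∩ Ici s) × ↥(grid T ∩ Ici t) =>
      ∫ q in A, f (q.1 x.2) ∂Q) (rightFilter s ×ˢ rightFilter t) (𝓝 (∫ q in A, f (q.1 t) ∂Q)) := by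
    refine tendsto_integral_filter_of_dominated_convergence (fun _ => ‖f‖) ?_ ?_
      (integrable_const _) ?_
    · refine Eventually.of_forall fun x => ?_
      exact (f.continuous.measurable.comp (measurable_eval _)).aestronglyMeasurable
    · exact Eventually.of_forall fun x => Eventually.of_forall fun q => f.norm_coe_le_norm _
    · refine Eventually.of_forall fun q => (f.continuous.tendsto _).comp ?_
      exact (q.2.tendsto_rightFilter t).comp tendsto_snd
  have l2 : Tendsto (fun x : ↥(grid T ∩ Ici s) × ↥(grid T ∩ Ici t) =>
      ∫ p, ∫ v, f v ∂(transportKernel M (p.1.1 x.1, p.2.1 x.1, p.2.1 x.2)) ∂((Q.restrict A).prod Q))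
      (rightFilter s ×ˢ rightFilter t)
      (𝓝 (∫ p, ∫ v, f v ∂(transportKernel M (p.1.1 s, p.2.1 s, p.2.1 t))
        ∂((Q.restrict A).prod Q))) := by
    refine tendsto_integral_filter_of_dominated_convergence (fun _ => ‖f‖) ?_ ?_
      (integrable_const _) ?_
    · refine Eventually.of_forall fun x => ?_
      exact (hc.measurable.comp (measurable_eval_triple _ _)).aestronglyMeasurable
    · exact Eventually.of_forall fun x => Eventually.of_forall fun q => f.norm_integral_le_norm _
    · refine Eventually.of_forall fun p => (hc.tendsto (p.1.1 s, p.2.1 s, p.2.1 t)).comp ?_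
      exact ((p.1.2.tendsto_rightFilter s).comp tendsto_fst).prodMk_nhds
        (((p.2.2.tendsto_rightFilter s).comp tendsto_fst).prodMk_nhds
          ((p.2.2.tendsto_rightFilter t).comp tendsto_snd))
  refine tendsto_nhds_unique_of_eventuallyEq l1 l2 ?_
  -- Strictness of `s < t` matters here: grid times close to `s` stay below `t`, hence below all
  -- grid times used to approach `t`.
  have e1 : ∀ᶠ x : ↥(grid T ∩ Ici s) in rightFilter s, (x : Icc (0 : ℝ≥0) T) < t :=
    tendsto_comap.eventually (gt_mem_nhds hst)
  filter_upwards [e1.prod_inl _] with x hx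
  have h1 := h x.1 x.1.2.1 x.2 x.2.2.1 (hx.le.trans x.2.2.2)
  have h2 := hasIndepIncrement_iff.1 h1 A (evalSigma_mono x.1.2.2 _ hA)
  rw [← integral_transportLaw, ← h2, integral_map (measurable_eval _).aemeasurable
    f.continuous.stronglyMeasurable.aestronglyMeasurable]

/-- Independence on rectangles determines the joint law of `a q` and `q.1 t`. This is the form in
which conditioning on the past is used with a general past observable `a`. -/
theorem HasIndepIncrement.lintegral {s t : Icc (0 : ℝ≥0) T} (h : HasIndepIncrement Q s t)
    {α : Type*} [MeasurableSpace α] {a : RcllPath T (K ⧸ M) → α}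
    (ha : Measurable[evalSigma (K ⧸ M) firstTime s] a) {f : α × (K ⧸ M) → ℝ≥0∞}
    (hf : Measurable f) :
    ∫⁻ q, f (a q, q.1 t) ∂Q
      = ∫⁻ q, ∫⁻ w, f (a q, w) ∂(translateKernel (incrementLaw Q s t) (q.1 s)) ∂Q := by
  have ha' : Measurable a := ha.mono evalSigma_le le_rfl
  set κ : Kernel (RcllPath T (K ⧸ M)) (α × (K ⧸ M)) := Kernel.deterministic a ha' ×ₖ
    (translateKernel (incrementLaw Q s t)).comap (fun q => q.1 s) (measurable_eval s) with hκ
  have h1 : Q.map (fun q => (a q, q.1 t)) = Q.bind κ := by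
    have : IsProbabilityMeasure (Q.map (fun q => (a q, q.1 t))) :=
      Measure.isProbabilityMeasure_map (ha'.prodMk (measurable_eval t)).aemeasurable
    refine Measure.ext_prod fun {A B} hA hB => ?_
    rw [Measure.map_apply (ha'.prodMk (measurable_eval t)) (hA.prod hB),
      Measure.bind_apply (hA.prod hB) (Kernel.measurable _).aemeasurable]
    have h2 : (fun q => (a q, q.1 t)) ⁻¹' (A ×ˢ B) = a ⁻¹' A ∩ {q | q.1 t ∈ B} := rfl
    rw [h2, h _ (ha hA) B hB, ← lintegral_indicator (ha' hA)]
    refine lintegral_congr fun q => ?_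
    rw [hκ, Kernel.prod_apply, Kernel.deterministic_apply, Measure.prod_prod,
      Measure.dirac_apply' _ hA, Kernel.comap_apply]
    by_cases hq : a q ∈ A
    · rw [indicator_of_mem (show q ∈ a ⁻¹' A from hq), indicator_of_mem hq]
      simp
    · rw [indicator_of_notMem (show q ∉ a ⁻¹' A from hq), indicator_of_notMem hq]
      simp
  rw [← lintegral_map hf (ha'.prodMk (measurable_eval t)), h1,
    Measure.lintegral_bind (Kernel.measurable _).aemeasurable hf.aemeasurable]
  refine lintegral_congr fun q => ?_
  rw [hκ, Kernel.lintegral_prod _ _ _ hf, Kernel.deterministic_apply, lintegral_dirac', Kernel.comap_apply]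
  exact hf.lintegral_prod_right'

end Step

end AngularPart

namespace AngularPart

/-! ### Finite-dimensional distributions and the convolution semigroup. -/

section Iterate

universe u

/-- Iterated integral along a nonhomogeneous family of kernels. -/
def iteratedIntegral {Z : Type u} [MeasurableSpace Z] {I : Type*} (κ : I → I → Kernel Z Z) :
    (n : ℕ) → (s : I) → (t : Fin n → I) → Z → ((Fin n → Z) → ℝ≥0∞) → ℝ≥0∞
  | 0, _, _, _, f => f Fin.elim0
  | n + 1, s, t, z, f =>
    ∫⁻ w, iteratedIntegral κ n (t 0) (Fin.tail t) w (fun v => f (Fin.cons w v)) ∂(κ s (t 0) z)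

theorem measurable_finCons {Z : Type*} [MeasurableSpace Z] {n : ℕ} :
    Measurable fun p : Z × (Fin n → Z) => (Fin.cons p.1 p.2 : Fin (n + 1) → Z) := by
  refine measurable_pi_iff.2 fun i => ?_
  refine Fin.cases ?_ (fun j => ?_) i
  · exact measurable_fst
  · exact (measurable_pi_apply j).comp measurable_snd

/-- The parameter space varies in the induction, because each step of the recursion turns the point
just reached into a further parameter. -/
theorem measurable_iteratedIntegral {Z : Type u} [MeasurableSpace Z] {I : Type*}
    (κ : I → I → Kernel Z Z) [∀ s t, IsSFiniteKernel (κ s t)] (n : ℕ) :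
    ∀ (s : I) (t : Fin n → I) {α : Type u} [MeasurableSpace α] {ζ : α → Z} (_ : Measurable ζ)
      {f : α × (Fin n → Z) → ℝ≥0∞} (_ : Measurable f),
      Measurable fun a => iteratedIntegral κ n s t (ζ a) (fun v => f (a, v)) := by
  induction n with
  | zero =>
    intro s t α _ ζ hζ f hf
    exact hf.comp (measurable_id.prodMk measurable_const)
  | succ n ih =>
    intro s t α _ ζ hζ f hf
    have h1 := ih (t 0) (Fin.tail t) (α := α × Z) (ζ := Prod.snd) measurable_snd
      (f := fun p : (α × Z) × (Fin n → Z) => f (p.1.1, Fin.cons p.1.2 p.2))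
      (hf.comp ((measurable_fst.comp measurable_fst).prodMk (measurable_finCons.comp
        ((measurable_snd.comp measurable_fst).prodMk measurable_snd))))
    exact h1.lintegral_kernel_prod_right' (κ := (κ s (t 0)).comap ζ hζ)

variable {K : Type u} [Group K] [TopologicalSpace K] [IsTopologicalGroup K] [PolishSpace K]
  [MeasurableSpace K] [BorelSpace K] {M : Subgroup K} [CompactSpace M]
  [MeasurableSpace (K ⧸ M)] [BorelSpace (K ⧸ M)] [PolishSpace (K ⧸ M)] {T : ℝ≥0}

/-- By invariance the integral depends on `g` only through its coset, and `g * S z` represents `g •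
z`. The section, measurable or not, thereby disappears. -/
theorem incrementIntegral_eq_iteratedIntegral {S : K ⧸ M → K} (hS : IsSection S) {I : Type*}
    {μ : I → I → Measure (K ⧸ M)} [∀ s t, SFinite (μ s t)] (hμ : ∀ s t, IsInvariantUnder M (μ s t))
    (n : ℕ) : ∀ (s : I) (t : Fin n → I) (g : K) (f : (Fin n → K ⧸ M) → ℝ≥0∞),
      incrementIntegral S μ n s t g f
        = iteratedIntegral (fun s t => translateKernel (μ s t)) n s t (g : K ⧸ M) f := by
  induction n with
  | zero => intros; rfl
  | succ n ih =>
    intro s t g f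
    rw [incrementIntegral, iteratedIntegral, (hμ s (t 0)).translateKernel_mk]
    have he : (fun z : K ⧸ M => g • z) = MeasurableEquiv.smul g := rfl
    rw [he, lintegral_map_equiv]
    refine lintegral_congr fun z => ?_
    rw [ih]
    have : ((g * S z : K) : K ⧸ M) = g • z := by
      conv_rhs => rw [← hS z]
      rfl
    rw [this]
    rfl

theorem incrementIntegral_mul (S : K ⧸ M → K) {I : Type*} {μ : I → I → Measure (K ⧸ M)} (k : K)
    (n : ℕ) : ∀ (s : I) (t : Fin n → I) (g : K) (f : (Fin n → K ⧸ M) → ℝ≥0∞),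
      incrementIntegral S μ n s t (k * g) f
        = incrementIntegral S μ n s t g (fun v => f (fun i => k • v i)) := by
  induction n with
  | zero =>
    intro s t g f
    simp only [incrementIntegral]
    congr 1
    exact Subsingleton.elim _ _
  | succ n ih =>
    intro s t g f
    simp only [incrementIntegral]
    refine lintegral_congr fun z => ?_
    rw [mul_assoc, ih]
    congr 1
    funext v
    congr 1
    funext i
    refine Fin.cases ?_ (fun j => ?_) i
    · simp [mul_smul]
    · simp

variable {Q : Measure (RcllPath T (K ⧸ M))} [IsProbabilityMeasure Q]

/-- Induction on the number of times with a free past observable: `(a q, q.1 (t 0))` is the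
observable for the remaining times, and the increment from `s` to `t 0` is then integrated out. -/
theorem lintegral_eval_eq_iteratedIntegral
    (h : ∀ s t : Icc (0 : ℝ≥0) T, s ≤ t → HasIndepIncrement Q s t) (n : ℕ) :
    ∀ (s : Icc (0 : ℝ≥0) T) (t : Fin n → Icc (0 : ℝ≥0) T), StrictMono t → (∀ i, s ≤ t i) →
      ∀ {α : Type u} [MeasurableSpace α] {a : RcllPath T (K ⧸ M) → α}
        (_ : Measurable[evalSigma (K ⧸ M) firstTime s] a) {f : α × (Fin n → K ⧸ M) → ℝ≥0∞}
        (_ : Measurable f),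
      ∫⁻ q, f (a q, fun i => q.1 (t i)) ∂Q
        = ∫⁻ q, iteratedIntegral (fun s t => translateKernel (incrementLaw Q s t)) n s t (q.1 s)
            (fun v => f (a q, v)) ∂Q := by
  induction n with
  | zero =>
    intro s t _ _ α _ a ha f hf
    refine lintegral_congr fun q => ?_
    simp only [iteratedIntegral]
    congr 2
    exact Subsingleton.elim _ _
  | succ n ih =>
    intro s t ht hst α _ a ha f hf
    have ha' : Measurable[evalSigma (K ⧸ M) firstTime (t 0)] fun q => (a q, q.1 (t 0)) :=
      (ha.mono (evalSigma_mono (hst 0)) le_rfl).prodMk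
        (measurable_eval_evalSigma ⟨(zero_le : (0 : ℝ≥0) ≤ (t 0 : ℝ≥0)), le_rfl⟩)
    have hf' : Measurable fun p : (α × (K ⧸ M)) × (Fin n → K ⧸ M) =>
        f (p.1.1, Fin.cons p.1.2 p.2) :=
      hf.comp ((measurable_fst.comp measurable_fst).prodMk (measurable_finCons.comp
        ((measurable_snd.comp measurable_fst).prodMk measurable_snd)))
    have h1 := ih (t 0) (Fin.tail t) (fun i j hij => ht (Fin.succ_lt_succ_iff.2 hij))
      (fun i => (ht (Fin.succ_pos i)).le) ha' hf'
    have h2 : ∀ q : RcllPath T (K ⧸ M), (fun i => q.1 (t i))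
        = (Fin.cons (q.1 (t 0)) (fun i => q.1 (Fin.tail t i)) : Fin (n + 1) → K ⧸ M) := by
      intro q
      funext i
      refine Fin.cases ?_ (fun j => ?_) i <;> rfl
    simp only [h2]
    rw [h1]
    have h3 := measurable_iteratedIntegral (fun s t => translateKernel (incrementLaw Q s t)) n
      (t 0) (Fin.tail t) (α := α × (K ⧸ M)) (ζ := Prod.snd) measurable_snd hf'
    exact (h s (t 0) (hst 0)).lintegral ha h3

theorem translateKernel_smul {μ : Measure (K ⧸ M)} [SFinite μ] (hμ : IsInvariantUnder M μ) (k : K)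
    (z : K ⧸ M) {f : K ⧸ M → ℝ≥0∞} (hf : Measurable f) :
    ∫⁻ w, f w ∂(translateKernel μ (k • z)) = ∫⁻ w, f (k • w) ∂(translateKernel μ z) := by
  obtain ⟨l, rfl⟩ := QuotientGroup.mk_surjective z
  rw [MulAction.Quotient.smul_coe, hμ.translateKernel_mk, hμ.translateKernel_mk,
    lintegral_map hf (measurable_const_smul _),
    lintegral_map (f := fun w => f (k • w)) (hf.comp (measurable_const_smul _))
      (measurable_const_smul _)]
  simp [mul_smul]

theorem measurable_lintegral_incrementKernel {f : K ⧸ M → ℝ≥0∞} (hf : Measurable f) :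
    Measurable fun x : (K ⧸ M) × (K ⧸ M) => ∫⁻ v, f v ∂(incrementKernel M x) :=
  hf.lintegral_kernel

/-- Conditioning at `t` and then at `s` turns the averaged increment from `s` to `u` into two
successive independent steps. Since `F` and `G` are unchanged by a common translation, the first
step may start at the base coset, which removes the dependence on `q.1 s`. The law of the two steps
together is `M`-invariant, so the average inside `F` has no effect on it. -/
theorem incrementLaw_conv {s t u : Icc (0 : ℝ≥0) T} (hst : s ≤ t)
    (h₁ : HasIndepIncrement Q s t) (h₂ : HasIndepIncrement Q t u) {f : K ⧸ M → ℝ≥0∞}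
    (hf : Measurable f) :
    ∫⁻ z, f z ∂(incrementLaw Q s u)
      = ∫⁻ z, ∫⁻ w, f w ∂(translateKernel (incrementLaw Q t u) z) ∂(incrementLaw Q s t) := by
  set κ := translateKernel (incrementLaw Q t u) with hκ
  have hF := measurable_lintegral_incrementKernel (M := M) hf
  set F : (K ⧸ M) × (K ⧸ M) → ℝ≥0∞ := fun x => ∫⁻ v, f v ∂(incrementKernel M x) with hFd
  have hFk : ∀ (k : K) (z w : K ⧸ M), F (k • z, k • w) = F (z, w) := fun k z w => by
    simp only [hFd, incrementKernel_smul]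
  have hs : ∀ v, s ≤ v → Measurable[evalSigma (K ⧸ M) firstTime v]
      fun q : RcllPath T (K ⧸ M) => q.1 s := fun v hv =>
    measurable_eval_evalSigma ⟨(zero_le : (0 : ℝ≥0) ≤ (s : ℝ≥0)), hv⟩
  have hG : Measurable fun x : (K ⧸ M) × (K ⧸ M) => ∫⁻ w, F (x.1, w) ∂(κ x.2) :=
    Measurable.lintegral_kernel_prod_right' (κ := κ.comap Prod.snd measurable_snd)
      (f := fun p : ((K ⧸ M) × (K ⧸ M)) × (K ⧸ M) => F (p.1.1, p.2))
      (hF.comp ((measurable_fst.comp measurable_fst).prodMk measurable_snd))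
  set G : (K ⧸ M) × (K ⧸ M) → ℝ≥0∞ := fun x => ∫⁻ w, F (x.1, w) ∂(κ x.2) with hGd
  have hGk : ∀ (k : K) (z w : K ⧸ M), G (k • z, k • w) = G (z, w) := by
    intro k z w
    simp only [hGd]
    rw [hκ, translateKernel_smul (isInvariantUnder_incrementLaw Q t u) k w
      (f := fun w => F (k • z, w)) (hF.comp (measurable_const.prodMk measurable_id))]
    simp only [hFk]
  have hinv : IsInvariantUnder M ((incrementLaw Q s t).bind κ) := by
    refine isInvariantUnder_of_lintegral fun m hm g hg => ?_
    rw [Measure.lintegral_bind (f := fun z => g (m • z)) (Kernel.measurable _).aemeasurable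
      (hg.comp (measurable_const_smul m)).aemeasurable,
      Measure.lintegral_bind (Kernel.measurable _).aemeasurable hg.aemeasurable]
    have : ∀ z, ∫⁻ w, g (m • w) ∂(κ z) = ∫⁻ w, g w ∂(κ (m • z)) := fun z =>
      (translateKernel_smul (isInvariantUnder_incrementLaw Q t u) m z hg).symm
    simp only [this]
    exact (isInvariantUnder_incrementLaw Q s t).lintegral_smul hm (f := fun z => ∫⁻ w, g w ∂(κ z))
      hg.lintegral_kernel
  calc ∫⁻ z, f z ∂(incrementLaw Q s u) = ∫⁻ q, F (q.1 s, q.1 u) ∂Q := lintegral_incrementLaw Q s u hf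
    _ = ∫⁻ q, G (q.1 s, q.1 t) ∂Q := h₂.lintegral (hs t hst) hF
    _ = ∫⁻ q, ∫⁻ w, G (q.1 s, w) ∂(translateKernel (incrementLaw Q s t) (q.1 s)) ∂Q :=
      h₁.lintegral (hs s le_rfl) hG
    _ = ∫⁻ q, ∫⁻ w, G (((1 : K) : K ⧸ M), w) ∂(incrementLaw Q s t) ∂Q := by
      refine lintegral_congr fun q => ?_
      obtain ⟨k, hk⟩ := QuotientGroup.mk_surjective (q.1 s)
      rw [← hk, (isInvariantUnder_incrementLaw Q s t).translateKernel_mk,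
        lintegral_map (f := fun w => G ((k : K ⧸ M), w))
          (hG.comp (measurable_const.prodMk measurable_id)) (measurable_const_smul k)]
      refine lintegral_congr fun w => ?_
      have := hGk k ((1 : K) : K ⧸ M) w
      rwa [MulAction.Quotient.smul_coe, smul_eq_mul, mul_one] at this
    _ = ∫⁻ w, G (((1 : K) : K ⧸ M), w) ∂(incrementLaw Q s t) := by simp
    _ = ∫⁻ w, F (((1 : K) : K ⧸ M), w) ∂((incrementLaw Q s t).bind κ) := by
      rw [Measure.lintegral_bind (Kernel.measurable _).aemeasurable]
      exact (hF.comp (measurable_const.prodMk measurable_id)).aemeasurable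
    _ = ∫⁻ w, f w ∂((incrementLaw Q s t).bind κ) := by
      rw [← hinv.lintegral_incrementKernel 1 hf]
      simp [hFd]
    _ = _ := Measure.lintegral_bind (Kernel.measurable _).aemeasurable hf.aemeasurable

theorem isConvolutionSemigroup_incrementLaw
    (h : ∀ s t : Icc (0 : ℝ≥0) T, s ≤ t → HasIndepIncrement Q s t) :
    IsConvolutionSemigroup (incrementLaw Q) where
  isProb _ _ _ := inferInstance
  invariant s t _ := isInvariantUnder_incrementLaw Q s t
  diag := incrementLaw_self Q
  conv s t u hst htu S hS f := by
    have hf : Measurable fun z : K ⧸ M => (f z : ℝ≥0∞) :=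
      (ENNReal.continuous_coe.comp f.continuous).measurable
    rw [incrementLaw_conv hst (h s t hst) (h t u htu) hf]
    refine lintegral_congr fun z => ?_
    conv_lhs => rw [← hS z]
    rw [(isInvariantUnder_incrementLaw Q t u).translateKernel_mk,
      lintegral_map hf (measurable_const_smul _)]
  cont s f := tendsto_integral_incrementLaw Q s f

/-- The translate of a path in `K / M`. -/
def smulPath (k : K) (q : RcllPath T (K ⧸ M)) : RcllPath T (K ⧸ M) :=
  ⟨fun t => k • q.1 t, q.2.continuous_comp (continuous_const_smul k)⟩

theorem measurable_smulPath (k : K) :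
    Measurable (smulPath k : RcllPath T (K ⧸ M) → RcllPath T (K ⧸ M)) :=
  measurable_rcllPath_iff.2 fun t => (measurable_const_smul k).comp (measurable_eval t)

theorem lintegral_eval_eq_incrementIntegral
    (h : ∀ s t : Icc (0 : ℝ≥0) T, s ≤ t → HasIndepIncrement Q s t)
    (h₀ : ∀ᵐ q ∂Q, q.1 firstTime = ((1 : K) : K ⧸ M)) {S : K ⧸ M → K} (hS : IsSection S) {n : ℕ}
    {t : Fin n → Icc (0 : ℝ≥0) T} (ht : StrictMono t) {g : (Fin n → K ⧸ M) → ℝ≥0∞}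
    (hg : Measurable g) :
    ∫⁻ q, g (fun i => q.1 (t i)) ∂Q = incrementIntegral S (incrementLaw Q) n firstTime t 1 g := by
  rw [incrementIntegral_eq_iteratedIntegral hS (isInvariantUnder_incrementLaw Q),
    lintegral_eval_eq_iteratedIntegral h n firstTime t ht (fun i => zero_le (a := (t i : ℝ≥0)))
      (α := PUnit) (a := fun _ => PUnit.unit) measurable_const (f := fun p => g p.2)
      (hg.comp measurable_snd),
    lintegral_congr_ae (g := fun _ => iteratedIntegral
      (fun s t => translateKernel (incrementLaw Q s t)) n firstTime t ((1 : K) : K ⧸ M) g)]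
  · rw [lintegral_const, measure_univ, mul_one]
  · filter_upwards [h₀] with q hq
    rw [hq]

theorem measurable_finCons_smul (k : K) {n : ℕ} :
    Measurable fun v : Fin n → K ⧸ M =>
      (Fin.cons (k : K ⧸ M) (fun i => k • v i) : Fin (n + 1) → K ⧸ M) := by
  refine measurable_pi_iff.2 fun i => ?_
  refine Fin.cases ?_ (fun j => ?_) i
  · exact measurable_const
  · exact (measurable_const_smul k).comp (measurable_pi_apply j)

theorem measurable_finCons_eval (s : Icc (0 : ℝ≥0) T) {n : ℕ} (t : Fin n → Icc (0 : ℝ≥0) T) :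
    Measurable fun q : RcllPath T (K ⧸ M) =>
      (Fin.cons (q.1 s) (fun i => q.1 (t i)) : Fin (n + 1) → K ⧸ M) := by
  refine measurable_pi_iff.2 fun i => ?_
  refine Fin.cases ?_ (fun j => ?_) i
  · exact measurable_eval _
  · exact measurable_eval (t j)

theorem lintegral_finCons_map_smulPath
    (h : ∀ s t : Icc (0 : ℝ≥0) T, s ≤ t → HasIndepIncrement Q s t)
    (h₀ : ∀ᵐ q ∂Q, q.1 firstTime = ((1 : K) : K ⧸ M)) {S : K ⧸ M → K} (hS : IsSection S) {n : ℕ}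
    {t : Fin n → Icc (0 : ℝ≥0) T} (ht : StrictMono t) {f : (Fin (n + 1) → K ⧸ M) → ℝ≥0∞}
    (hf : Measurable f) (k : K) :
    ∫⁻ q, f (Fin.cons (q.1 firstTime) (fun i => q.1 (t i))) ∂(Q.map (smulPath k))
      = incrementIntegral S (incrementLaw Q) n firstTime t k (fun v => f (Fin.cons (k : K ⧸ M) v)) := by
  have h1 := lintegral_eval_eq_incrementIntegral h h₀ hS ht (hf.comp (measurable_finCons_smul k))
  have h2 := incrementIntegral_mul S (μ := incrementLaw Q) k n firstTime t 1
    (fun v => f (Fin.cons (k : K ⧸ M) v))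
  rw [mul_one] at h2
  rw [h2, lintegral_map
    (f := fun q : RcllPath T (K ⧸ M) => f (Fin.cons (q.1 firstTime) (fun i => q.1 (t i))))
    (hf.comp (measurable_finCons_eval firstTime t)) (measurable_smulPath k)]
  refine Eq.trans ?_ h1
  refine lintegral_congr_ae ?_
  filter_upwards [h₀] with q hq
  have h3 : (smulPath k q).1 firstTime = (k : K ⧸ M) := by
    change k • q.1 firstTime = (k : K ⧸ M)
    rw [hq, MulAction.Quotient.smul_coe, smul_eq_mul, mul_one]
  simp only [Function.comp]
  rw [h3]
  rfl

/-- No measurability of `F` is assumed, because it will be applied to an integrand that contains an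
arbitrary section; measurability of singletons is enough. -/
theorem lintegral_dirac_coe (k : K) (F : K ⧸ M → ℝ≥0∞) :
    ∫⁻ z, F z ∂(Measure.dirac (k : K ⧸ M)) = F k := by
  rw [lintegral_congr_ae (ae_eq_dirac F)]
  simp

theorem isNonhomogeneousLevy_map_smulPath
    (h : ∀ s t : Icc (0 : ℝ≥0) T, s ≤ t → HasIndepIncrement Q s t)
    (h₀ : ∀ᵐ q ∂Q, q.1 firstTime = ((1 : K) : K ⧸ M)) (k : K) :
    IsNonhomogeneousLevy (Q.map (smulPath k)) (incrementLaw Q) := by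
  refine ⟨isConvolutionSemigroup_incrementLaw h, Measure.dirac (k : K ⧸ M),
    Measure.dirac.isProbabilityMeasure, ?_⟩
  intro S hS n t ht _ f
  have hf : Measurable fun v : Fin (n + 1) → K ⧸ M => (f v : ℝ≥0∞) := by
    exact (ENNReal.continuous_coe.comp f.continuous).measurable
  rw [lintegral_dirac_coe]
  -- `S (k : K ⧸ M)` and `k` can be different representatives; the two increment integrals agree
  -- because both depend on the coset only.
  have h1 := incrementIntegral_eq_iteratedIntegral hS (isInvariantUnder_incrementLaw Q) n firstTime
    t (S (k : K ⧸ M)) (fun v => (f (Fin.cons (k : K ⧸ M) v) : ℝ≥0∞))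
  rw [hS, ← incrementIntegral_eq_iteratedIntegral hS (isInvariantUnder_incrementLaw Q)] at h1
  exact (lintegral_finCons_map_smulPath h h₀ hS ht hf k).trans h1.symm

end Iterate

end AngularPart

namespace AngularPart

/-- The Borel σ-algebra of the one-point compactification. -/
@[reducible] def onePointBorel (X : Type*) [TopologicalSpace X] : MeasurableSpace (OnePoint X) :=
  borel (OnePoint X)

attribute [local instance] onePointBorel

/-! ### Markov processes: from the semigroup to the law of the whole path. -/

section Markov

variable {X : Type*} [TopologicalSpace X] [MeasurableSpace X] [BorelSpace X]

theorem borelSpace_onePoint : BorelSpace (OnePoint X) := ⟨rfl⟩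

attribute [local instance] borelSpace_onePoint

theorem measurableEmbedding_onePoint : MeasurableEmbedding ((↑) : X → OnePoint X) :=
  OnePoint.isOpenEmbedding_coe.measurableEmbedding

/-- Extension of a function on `X` by `0` at the cemetery. -/
def zeroExtend (f : X → ℝ≥0∞) (p : OnePoint X) : ℝ≥0∞ := p.elim 0 f

@[simp] theorem zeroExtend_coe (f : X → ℝ≥0∞) (a : X) : zeroExtend f a = f a := rfl

@[simp] theorem zeroExtend_infty (f : X → ℝ≥0∞) : zeroExtend f OnePoint.infty = 0 := rfl

theorem zeroExtend_eq_extend (f : X → ℝ≥0∞) :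
    zeroExtend f = Function.extend ((↑) : X → OnePoint X) f 0 := by
  funext p
  induction p using OnePoint.rec with
  | infty =>
    rw [Function.extend_apply']
    · rfl
    · rintro ⟨a, ha⟩
      exact OnePoint.coe_ne_infty a ha
  | coe a => rw [OnePoint.coe_injective.extend_apply]; rfl

theorem extendZero_eq_extend (f : X → ℝ) :
    extendZero f = Function.extend ((↑) : X → OnePoint X) f 0 := by
  funext p
  induction p using OnePoint.rec with
  | infty =>
    rw [Function.extend_apply']
    · rfl
    · rintro ⟨a, ha⟩
      exact OnePoint.coe_ne_infty a ha
  | coe a => rw [OnePoint.coe_injective.extend_apply]; rfl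

theorem measurable_zeroExtend {f : X → ℝ≥0∞} (hf : Measurable f) : Measurable (zeroExtend f) := by
  rw [zeroExtend_eq_extend]
  exact measurableEmbedding_onePoint.measurable_extend hf measurable_zero

theorem measurable_extendZero {f : X → ℝ} (hf : Measurable f) : Measurable (extendZero f) := by
  rw [extendZero_eq_extend]
  exact measurableEmbedding_onePoint.measurable_extend hf measurable_zero

theorem lintegral_comap_onePoint (μ : Measure (OnePoint X)) (f : X → ℝ≥0∞) :
    ∫⁻ a, f a ∂(μ.comap ((↑) : X → OnePoint X)) = ∫⁻ p, zeroExtend f p ∂μ := by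
  have h1 : ∫⁻ a, f a ∂(μ.comap ((↑) : X → OnePoint X))
      = ∫⁻ p, zeroExtend f p ∂((μ.comap ((↑) : X → OnePoint X)).map ((↑) : X → OnePoint X)) := by
    rw [measurableEmbedding_onePoint.lintegral_map]
    rfl
  rw [h1, measurableEmbedding_onePoint.map_comap,
    ← lintegral_indicator measurableEmbedding_onePoint.measurableSet_range]
  refine lintegral_congr fun p => ?_
  induction p using OnePoint.rec with
  | infty => simp
  | coe a => simp

theorem integral_comap_onePoint (μ : Measure (OnePoint X)) (f : X → ℝ) :
    ∫ a, f a ∂(μ.comap ((↑) : X → OnePoint X)) = ∫ p, extendZero f p ∂μ := by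
  have h1 : ∫ a, f a ∂(μ.comap ((↑) : X → OnePoint X))
      = ∫ p, extendZero f p ∂((μ.comap ((↑) : X → OnePoint X)).map ((↑) : X → OnePoint X)) := by
    rw [measurableEmbedding_onePoint.integral_map]
    rfl
  rw [h1, measurableEmbedding_onePoint.map_comap,
    ← integral_indicator measurableEmbedding_onePoint.measurableSet_range]
  refine integral_congr_ae (Eventually.of_forall fun p => ?_)
  induction p using OnePoint.rec with
  | infty => simp [extendZero]
  | coe a => simp

instance (μ : Measure (OnePoint X)) [IsFiniteMeasure μ] :
    IsFiniteMeasure (μ.comap ((↑) : X → OnePoint X)) := by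
  refine ⟨?_⟩
  rw [measurableEmbedding_onePoint.comap_apply]
  exact measure_lt_top _ _

variable {Ω : Type*} [MeasurableSpace Ω] {P : ℝ≥0 → Kernel X X} {x : ℝ≥0 → Ω → OnePoint X}
  {Pr : X → Measure Ω}

theorem IsSubMarkovSemigroup.isFiniteKernel (h : IsSubMarkovSemigroup P) (t : ℝ≥0) :
    IsFiniteKernel (P t) := ⟨1, ENNReal.one_lt_top, h.le_one t⟩

theorem pastSigma_le (hx : ∀ t, Measurable (x t)) (t : ℝ≥0) :
    pastSigma x t ≤ (inferInstance : MeasurableSpace Ω) :=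
  iSup_le fun u => (hx u).comap_le

theorem measurable_pastSigma {u t : ℝ≥0} (h : u ≤ t) : Measurable[pastSigma x t] (x u) := by
  refine Measurable.mono (comap_measurable _) ?_ le_rfl
  exact le_iSup (fun u : Iic t => MeasurableSpace.comap (x u) (borel (OnePoint X))) ⟨u, h⟩

theorem pastSigma_mono {s t : ℝ≥0} (h : s ≤ t) : pastSigma x s ≤ pastSigma x t :=
  iSup_le fun u => (measurable_pastSigma (u.2.trans h)).comap_le

/-- Integrated over `B`, the Markov property for bounded continuous functions says that two finite
measures on `X` have the same integrals of such functions. The measures are therefore equal, which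
gives the property for all nonnegative measurable functions. -/
theorem IsMarkovProcess.setLIntegral_zeroExtend [HasOuterApproxClosed X]
    (h : IsMarkovProcess P x Pr) (a : X) (s t : ℝ≥0) {B : Set Ω}
    (hB : MeasurableSet[pastSigma x t] B) {f : X → ℝ≥0∞} (hf : Measurable f) :
    ∫⁻ θ in B, zeroExtend f (x (t + s) θ) ∂(Pr a)
      = ∫⁻ θ in B, zeroExtend (fun b => ∫⁻ c, f c ∂(P s b)) (x t θ) ∂(Pr a) := by
  have := h.isProb a
  have := h.semigroup.isFiniteKernel s
  have hm := h.measurable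
  have hle := pastSigma_le hm t
  set m₁ := (((Pr a).restrict B).map (x (t + s))).comap ((↑) : X → OnePoint X) with hm₁
  set m₂ := ((((Pr a).restrict B).map (x t)).comap ((↑) : X → OnePoint X)).bind (P s) with hm₂
  have heq : m₁ = m₂ := by
    refine ext_of_forall_integral_eq_of_IsFiniteMeasure fun g => ?_
    have hgm : Measurable fun b => ∫ c, g c ∂(P s b) :=
      (g.continuous.measurable.stronglyMeasurable.integral_kernel (κ := P s)).measurable
    rw [hm₁, hm₂, integral_bind_kernel (g.integrable _), integral_comap_onePoint,
      integral_comap_onePoint,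
      integral_map (hm _).aemeasurable
        (measurable_extendZero g.continuous.measurable).aestronglyMeasurable,
      integral_map (hm _).aemeasurable (measurable_extendZero hgm).aestronglyMeasurable]
    have hint : Integrable (fun θ => extendZero g (x (t + s) θ)) (Pr a) := by
      refine Integrable.of_bound ((measurable_extendZero g.continuous.measurable).comp
        (hm (t + s))).aestronglyMeasurable ‖g‖ (Eventually.of_forall fun θ => ?_)
      induction x (t + s) θ using OnePoint.rec with
      | infty => simp [extendZero]
      | coe a => exact g.norm_coe_le_norm a
    rw [← setIntegral_condExp hle hint hB]
    refine setIntegral_congr_ae (hle _ hB) ?_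
    filter_upwards [h.markov a s t g] with θ hθ _ using hθ
  calc ∫⁻ θ in B, zeroExtend f (x (t + s) θ) ∂(Pr a) = ∫⁻ b, f b ∂m₁ := by
        rw [hm₁, lintegral_comap_onePoint, lintegral_map (measurable_zeroExtend hf) (hm _)]
    _ = ∫⁻ b, f b ∂m₂ := by rw [heq]
    _ = _ := by
        rw [hm₂, Measure.lintegral_bind (Kernel.measurable _).aemeasurable hf.aemeasurable,
          lintegral_comap_onePoint, lintegral_map (measurable_zeroExtend hf.lintegral_kernel) (hm _)]

/-! ### The law of the whole path -/

/-- The set of the functions that visit given sets after given waiting times. -/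
def visitSet : List (ℝ≥0 × Set X) → Set (ℝ≥0 → OnePoint X)
  | [] => univ
  | p :: l => {w | w p.1 ∈ ((↑) : X → OnePoint X) '' p.2 ∧ (fun r => w (p.1 + r)) ∈ visitSet l}

/-- The probability of `visitSet` as a function of the starting point. -/
def visitProb (P : ℝ≥0 → Kernel X X) : List (ℝ≥0 × Set X) → X → ℝ≥0∞
  | [] => 1
  | p :: l => fun b => ∫⁻ c in p.2, visitProb P l c ∂(P p.1 b)

theorem measurable_visitProb : ∀ {l : List (ℝ≥0 × Set X)}, (∀ p ∈ l, MeasurableSet p.2) →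
    Measurable (visitProb P l)
  | [], _ => measurable_one
  | p :: l, h => by
    have h1 := measurable_visitProb (l := l) fun q hq => h q (List.mem_cons_of_mem _ hq)
    have h2 := h p List.mem_cons_self
    have : visitProb P (p :: l) = fun b => ∫⁻ c, p.2.indicator (visitProb P l) c ∂(P p.1 b) := by
      funext b
      rw [lintegral_indicator h2]
      rfl
    rw [this]
    exact (h1.indicator h2).lintegral_kernel

/-- Induction on the list: the first visit is added to the past event `B`, and the Markov property
moves the remaining probability back to time `s`. The path has to be alive at `s` on `B`: the empty
list imposes no condition, whereas the extension by zero would give the cemetery probability `0`. -/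
theorem IsMarkovProcess.measure_inter_visitSet [HasOuterApproxClosed X]
    (h : IsMarkovProcess P x Pr) (a : X) :
    ∀ (l : List (ℝ≥0 × Set X)), (∀ p ∈ l, MeasurableSet p.2) → ∀ (s : ℝ≥0) {B : Set Ω},
      MeasurableSet[pastSigma x s] B → (∀ θ ∈ B, x s θ ∈ range ((↑) : X → OnePoint X)) →
      Pr a (B ∩ {θ | (fun r => x (s + r) θ) ∈ visitSet l})
        = ∫⁻ θ in B, zeroExtend (visitProb P l) (x s θ) ∂(Pr a)
  | [], _, s, B, hB, hB' => by
    have h1 : ∀ θ ∈ B, zeroExtend (visitProb P ([] : List (ℝ≥0 × Set X))) (x s θ) = 1 := by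
      intro θ hθ
      obtain ⟨b, hb⟩ := hB' θ hθ
      rw [← hb]
      rfl
    rw [setLIntegral_congr_fun (pastSigma_le h.measurable s _ hB) h1]
    simp [visitSet]
  | p :: l, hl, s, B, hB, hB' => by
    have hp : MeasurableSet p.2 := hl p List.mem_cons_self
    have hpm : MeasurableSet (((↑) : X → OnePoint X) '' p.2) :=
      measurableEmbedding_onePoint.measurableSet_image.2 hp
    have hl' : ∀ q ∈ l, MeasurableSet q.2 := fun q hq => hl q (List.mem_cons_of_mem _ hq)
    set B' := B ∩ x (s + p.1) ⁻¹' (((↑) : X → OnePoint X) '' p.2) with hB'def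
    have hxB : MeasurableSet (x (s + p.1) ⁻¹' (((↑) : X → OnePoint X) '' p.2)) :=
      h.measurable _ hpm
    have h1 := h.measure_inter_visitSet a l hl' (s + p.1) (B := B')
      (MeasurableSet.inter (pastSigma_mono le_self_add _ hB)
        (measurable_pastSigma le_rfl hpm))
      (fun θ hθ => image_subset_range _ _ hθ.2)
    have h2 : B ∩ {θ | (fun r => x (s + r) θ) ∈ visitSet (p :: l)}
        = B' ∩ {θ | (fun r => x (s + p.1 + r) θ) ∈ visitSet l} := by
      ext θ
      simp only [visitSet, hB'def, mem_inter_iff, Set.mem_ofPred_eq, mem_preimage, add_assoc,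
        and_assoc]
    rw [h2, h1, hB'def, inter_comm, ← setLIntegral_indicator hxB]
    have h3 : ∀ θ, (x (s + p.1) ⁻¹' (((↑) : X → OnePoint X) '' p.2)).indicator
        (fun θ => zeroExtend (visitProb P l) (x (s + p.1) θ)) θ
        = zeroExtend (p.2.indicator (visitProb P l)) (x (s + p.1) θ) := by
      intro θ
      rcases hq : x (s + p.1) θ with _ | b
      · rw [indicator_of_notMem]
        · rfl
        · rintro ⟨c, -, hc⟩
          rw [hq] at hc
          exact OnePoint.coe_ne_infty c hc
      · change _ = zeroExtend _ ((b : X) : OnePoint X)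
        have hq' : x (s + p.1) θ = (b : OnePoint X) := hq
        rw [zeroExtend_coe]
        by_cases hb : b ∈ p.2
        · rw [indicator_of_mem hb, indicator_of_mem, hq', zeroExtend_coe]
          exact ⟨b, hb, hq'.symm⟩
        · rw [indicator_of_notMem hb, indicator_of_notMem]
          rintro ⟨c, hc, hc'⟩
          rw [hq'] at hc'
          rw [OnePoint.coe_injective hc'] at hc
          exact hb hc
    simp only [h3]
    rw [h.setLIntegral_zeroExtend a p.1 s hB ((measurable_visitProb hl').indicator hp)]
    simp only [lintegral_indicator hp]
    rfl

/-- The paths in `X` with a life time. -/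
abbrev LifePath (X : Type*) [TopologicalSpace X] : Type _ :=
  {w : ℝ≥0 → OnePoint X // IsRcllWithLifetime w}

/-- The path of a process. -/
def pathOf (hx : ∀ θ, IsRcllWithLifetime (fun t => x t θ)) (θ : Ω) : LifePath X :=
  ⟨fun t => x t θ, hx θ⟩

theorem measurable_pathOf (hm : ∀ t, Measurable (x t))
    (hx : ∀ θ, IsRcllWithLifetime (fun t => x t θ)) : Measurable (pathOf hx) :=
  Measurable.subtype_mk (measurable_pi_lambda _ hm)

theorem measurable_lifePath_eval (t : ℝ≥0) : Measurable fun w : LifePath X => w.1 t :=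
  (measurable_pi_apply t).comp measurable_subtype_coe

theorem IsRcllWithLifetime.shift {w : ℝ≥0 → OnePoint X} (hw : IsRcllWithLifetime w) (s : ℝ≥0) :
    IsRcllWithLifetime fun t => w (s + t) where
  absorbed u t hut := hw.absorbed _ _ (add_le_add_right hut s)
  right_cont t := (hw.right_cont (s + t)).comp (continuous_const_add s).continuousWithinAt
    fun _ hu => add_le_add_right hu s
  left_lim t ht := by
    obtain ⟨a, ha⟩ := hw.left_lim (s + t) ht
    exact ⟨a, ha.comp ((continuous_const_add s).continuousWithinAt.tendsto_nhdsWithin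
      fun _ hu => add_lt_add_right (α := ℝ≥0) hu s)⟩

/-- The path after time `s`. -/
def LifePath.shift (s : ℝ≥0) (w : LifePath X) : LifePath X := ⟨_, w.2.shift s⟩

theorem measurable_shift (s : ℝ≥0) : Measurable (LifePath.shift s : LifePath X → LifePath X) :=
  Measurable.subtype_mk (measurable_pi_lambda _ fun t => measurable_lifePath_eval (s + t))

/-- The sets of paths that are at finitely many times in given sets. -/
def finiteTimeSets (X : Type*) [TopologicalSpace X] [MeasurableSpace X] : Set (Set (LifePath X)) :=
  {A | ∃ (F : Finset ℝ≥0) (C : ℝ≥0 → Set X), (∀ t, MeasurableSet (C t)) ∧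
    A = {w | ∀ t ∈ F, w.1 t ∈ ((↑) : X → OnePoint X) '' C t}}

theorem isPiSystem_finiteTimeSets : IsPiSystem (finiteTimeSets X) := by
  classical
  rintro _ ⟨F, C, hC, rfl⟩ _ ⟨G, D, hD, rfl⟩ -
  refine ⟨F ∪ G, fun t => (if t ∈ F then C t else univ) ∩ (if t ∈ G then D t else univ),
    fun t => ?_, ?_⟩
  · refine MeasurableSet.inter ?_ ?_ <;> split_ifs <;> simp [hC, hD]
  · ext w
    simp only [mem_inter_iff, Set.mem_ofPred_eq, Finset.mem_union]
    constructor
    · rintro ⟨h1, h2⟩ t ht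
      by_cases hF : t ∈ F
      · obtain ⟨a, ha, haw⟩ := h1 t hF
        refine ⟨a, ⟨by simp [hF, ha], ?_⟩, haw⟩
        by_cases hG : t ∈ G
        · obtain ⟨b, hb, hbw⟩ := h2 t hG
          rw [← hbw] at haw
          rw [OnePoint.coe_injective haw]
          simp [hG, hb]
        · simp [hG]
      · have hG := ht.resolve_left hF
        obtain ⟨b, hb, hbw⟩ := h2 t hG
        exact ⟨b, ⟨by simp [hF], by simp [hG, hb]⟩, hbw⟩
    · intro h
      refine ⟨fun t ht => ?_, fun t ht => ?_⟩
      · obtain ⟨a, ha, haw⟩ := h t (Or.inl ht)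
        exact ⟨a, by simpa [ht] using ha.1, haw⟩
      · obtain ⟨a, ha, haw⟩ := h t (Or.inr ht)
        exact ⟨a, by simpa [ht] using ha.2, haw⟩

/-- Being at the cemetery is the complement of being somewhere in `X`, so conditions on points of
`X` generate the whole σ-algebra. They are also the conditions whose probabilities the semigroup
computes. -/
theorem generateFrom_finiteTimeSets :
    (inferInstance : MeasurableSpace (LifePath X))
      = MeasurableSpace.generateFrom (finiteTimeSets X) := by
  refine le_antisymm ?_ (MeasurableSpace.generateFrom_le ?_)
  · have h1 : ∀ t, Measurable[MeasurableSpace.generateFrom (finiteTimeSets X)]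
        fun w : LifePath X => w.1 t := by
      intro t D hD
      have h2 : ∀ C : Set X, MeasurableSet C →
          MeasurableSet[MeasurableSpace.generateFrom (finiteTimeSets X)]
            {w : LifePath X | w.1 t ∈ ((↑) : X → OnePoint X) '' C} := fun C hC =>
        MeasurableSpace.measurableSet_generateFrom
          ⟨{t}, fun _ => C, fun _ => hC, by simp⟩
      have h3 := h2 _ (measurableEmbedding_onePoint.measurable hD)
      by_cases hinf : OnePoint.infty ∈ D
      · have : (fun w : LifePath X => w.1 t) ⁻¹' D
            = {w | w.1 t ∈ ((↑) : X → OnePoint X) '' (((↑) : X → OnePoint X) ⁻¹' D)} ∪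
              {w | w.1 t ∈ ((↑) : X → OnePoint X) '' univ}ᶜ := by
          ext w
          rcases hw : w.1 t with _ | a
          · refine iff_of_true ?_ (Or.inr ?_)
            · change w.1 t ∈ D
              rw [hw]
              exact hinf
            · rintro ⟨a, -, ha⟩
              rw [hw] at ha
              exact OnePoint.coe_ne_infty a ha
          · have hw' : w.1 t = (a : OnePoint X) := hw
            simp [hw']
        rw [this]
        exact MeasurableSet.union h3 (MeasurableSet.compl (h2 _ MeasurableSet.univ))
      · have : (fun w : LifePath X => w.1 t) ⁻¹' D
            = {w | w.1 t ∈ ((↑) : X → OnePoint X) '' (((↑) : X → OnePoint X) ⁻¹' D)} := by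
          ext w
          rcases hw : w.1 t with _ | a
          · refine iff_of_false ?_ ?_
            · change ¬ w.1 t ∈ D
              rw [hw]
              exact hinf
            · rintro ⟨a, -, ha⟩
              rw [hw] at ha
              exact OnePoint.coe_ne_infty a ha
          · have hw' : w.1 t = (a : OnePoint X) := hw
            simp [hw']
        rw [this]
        exact h3
    have h2 : Measurable[MeasurableSpace.generateFrom (finiteTimeSets X)]
        (Subtype.val : LifePath X → ℝ≥0 → OnePoint X) :=
      @measurable_pi_lambda _ _ _ (MeasurableSpace.generateFrom (finiteTimeSets X)) _ _ h1
    exact h2.comap_le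
  · rintro _ ⟨F, C, hC, rfl⟩
    have : {w : LifePath X | ∀ t ∈ F, w.1 t ∈ ((↑) : X → OnePoint X) '' C t}
        = ⋂ t ∈ F, (fun w : LifePath X => w.1 t) ⁻¹' (((↑) : X → OnePoint X) '' C t) := by
      ext w
      simp
    rw [this]
    exact Finset.measurableSet_biInter _ fun t _ => measurable_lifePath_eval t
      (measurableEmbedding_onePoint.measurableSet_image.2 (hC t))

theorem measurableSet_of_mem_finiteTimeSets {A : Set (LifePath X)} (hA : A ∈ finiteTimeSets X) :
    MeasurableSet A := by
  have h := MeasurableSpace.measurableSet_generateFrom hA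
  rw [← generateFrom_finiteTimeSets] at h
  exact h

/-- Taking the times in increasing order turns them into waiting times. The reference time `c` is
free, because in the induction it becomes the smallest time already treated. -/
theorem exists_visitSet {C : ℝ≥0 → Set X} (hC : ∀ t, MeasurableSet (C t)) (F : Finset ℝ≥0) :
    ∀ c, (∀ t ∈ F, c ≤ t) → ∃ l : List (ℝ≥0 × Set X), (∀ p ∈ l, MeasurableSet p.2) ∧
      ∀ w : ℝ≥0 → OnePoint X, (∀ t ∈ F, w t ∈ ((↑) : X → OnePoint X) '' C t) ↔
        (fun r => w (c + r)) ∈ visitSet l := by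
  classical
  induction F using Finset.induction_on_min with
  | empty => exact fun c _ => ⟨[], by simp, by simp [visitSet]⟩
  | insert a F ha ih =>
    intro c hc
    obtain ⟨l, hl, hlw⟩ := ih a fun t ht => (ha t ht).le
    have hca : c + (a - c) = a := add_tsub_cancel_of_le (hc a (Finset.mem_insert_self _ _))
    refine ⟨(a - c, C a) :: l, ?_, fun w => ?_⟩
    · simp only [List.mem_cons, forall_eq_or_imp]
      exact ⟨hC a, hl⟩
    · simp only [Finset.mem_insert, forall_eq_or_imp, visitSet, Set.mem_ofPred_eq, ← add_assoc, hca,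
        hlw]

theorem IsMarkovProcess.measure_visitSet [HasOuterApproxClosed X]
    (h : IsMarkovProcess P x Pr) (a : X) {l : List (ℝ≥0 × Set X)}
    (hl : ∀ p ∈ l, MeasurableSet p.2) :
    Pr a {θ | (fun r => x (0 + r) θ) ∈ visitSet l} = visitProb P l a := by
  have := h.isProb a
  set B : Set Ω := x 0 ⁻¹' range ((↑) : X → OnePoint X) with hB
  have hBm : MeasurableSet[pastSigma x 0] B :=
    measurable_pastSigma le_rfl measurableEmbedding_onePoint.measurableSet_range
  have hae : ∀ᵐ θ ∂(Pr a), θ ∈ B := by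
    filter_upwards [h.start a] with θ hθ
    exact ⟨a, hθ.symm⟩
  have h1 := h.measure_inter_visitSet a l hl 0 hBm fun θ hθ => hθ
  have h2 : (B ∩ {θ | (fun r => x (0 + r) θ) ∈ visitSet l} : Set Ω)
      =ᵐ[Pr a] {θ | (fun r => x (0 + r) θ) ∈ visitSet l} := by
    filter_upwards [hae] with θ hθ
    exact propext ⟨fun h => h.2, fun h => ⟨hθ, h⟩⟩
  rw [measure_congr h2] at h1
  rw [h1, Measure.restrict_eq_self_of_ae_mem hae]
  have h3 : ∫⁻ θ, zeroExtend (visitProb P l) (x 0 θ) ∂(Pr a)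
      = ∫⁻ _, visitProb P l a ∂(Pr a) := by
    refine lintegral_congr_ae ?_
    filter_upwards [h.start a] with θ hθ
    rw [hθ, zeroExtend_coe]
  rw [h3, lintegral_const, measure_univ, mul_one]

theorem exists_visitSet_of_mem_finiteTimeSets {A : Set (LifePath X)} (hA : A ∈ finiteTimeSets X) :
    ∃ l : List (ℝ≥0 × Set X), (∀ p ∈ l, MeasurableSet p.2) ∧
      ∀ w : LifePath X, w ∈ A ↔ w.1 ∈ visitSet l := by
  obtain ⟨F, C, hC, rfl⟩ := hA
  obtain ⟨l, hl, hlw⟩ := exists_visitSet hC F 0 fun t _ => zero_le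
  refine ⟨l, hl, fun w => ?_⟩
  have := hlw w.1
  simp only [zero_add] at this
  exact this

/-- No measurability of `a ↦ Pr a` is part of the definition of the process. It is inherited from
the transition kernels, through the probabilities of a generating π-system. -/
theorem IsMarkovProcess.measurable_pathLaw [HasOuterApproxClosed X]
    (h : IsMarkovProcess P x Pr) : Measurable fun a => (Pr a).map (pathOf h.rcll) := by
  have hp := measurable_pathOf h.measurable h.rcll
  have := fun a => h.isProb a
  have := fun a => Measure.isProbabilityMeasure_map (μ := Pr a) hp.aemeasurable
  refine Measurable.measure_of_isPiSystem_of_isProbabilityMeasure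
    (generateFrom_finiteTimeSets (X := X)) isPiSystem_finiteTimeSets fun A hA => ?_
  have hAm := measurableSet_of_mem_finiteTimeSets hA
  obtain ⟨l, hl, hlw⟩ := exists_visitSet_of_mem_finiteTimeSets hA
  have heq : ∀ a, (Pr a).map (pathOf h.rcll) A = visitProb P l a := by
    intro a
    rw [Measure.map_apply hp hAm, ← h.measure_visitSet a hl]
    congr 1
    ext θ
    simp [hlw, pathOf]
  simp only [heq]
  exact measurable_visitProb hl

/-- The law of the whole path as a function of the starting point. -/
def IsMarkovProcess.pathKernel [HasOuterApproxClosed X]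
    (h : IsMarkovProcess P x Pr) : Kernel X (LifePath X) :=
  ⟨fun a => (Pr a).map (pathOf h.rcll), h.measurable_pathLaw⟩

theorem IsMarkovProcess.pathKernel_apply [HasOuterApproxClosed X]
    (h : IsMarkovProcess P x Pr) (a : X) : h.pathKernel a = (Pr a).map (pathOf h.rcll) := rfl

theorem IsMarkovProcess.isMarkovKernel_pathKernel [HasOuterApproxClosed X]
    (h : IsMarkovProcess P x Pr) : IsMarkovKernel h.pathKernel := by
  refine ⟨fun a => ?_⟩
  have := h.isProb a
  exact Measure.isProbabilityMeasure_map (measurable_pathOf h.measurable h.rcll).aemeasurable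

theorem IsMarkovProcess.pathKernel_apply_of_forall [HasOuterApproxClosed X]
    (h : IsMarkovProcess P x Pr) {A : Set (LifePath X)} (hA : MeasurableSet A)
    {l : List (ℝ≥0 × Set X)} (hl : ∀ p ∈ l, MeasurableSet p.2)
    (hlw : ∀ w : LifePath X, w ∈ A ↔ w.1 ∈ visitSet l) (a : X) :
    h.pathKernel a A = visitProb P l a := by
  rw [h.pathKernel_apply, Measure.map_apply (measurable_pathOf h.measurable h.rcll) hA,
    ← h.measure_visitSet a hl]
  congr 1
  ext θ
  simp [hlw, pathOf]

/-- The Markov property for the whole path after time `s`. -/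
theorem IsMarkovProcess.measure_inter_shift [HasOuterApproxClosed X]
    (h : IsMarkovProcess P x Pr) (a : X) (s : ℝ≥0) {B : Set Ω}
    (hB : MeasurableSet[pastSigma x s] B) (hB' : ∀ θ ∈ B, x s θ ∈ range ((↑) : X → OnePoint X))
    {A : Set (LifePath X)} (hA : MeasurableSet A) :
    Pr a (B ∩ {θ | (pathOf h.rcll θ).shift s ∈ A})
      = ∫⁻ θ in B, zeroExtend (fun b => h.pathKernel b A) (x s θ) ∂(Pr a) := by
  have := h.isProb a
  have := h.isMarkovKernel_pathKernel
  have hBm := pastSigma_le h.measurable s _ hB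
  have hsp := (measurable_shift (X := X) s).comp (measurable_pathOf h.measurable h.rcll)
  set m₁ := ((Pr a).restrict B).map (LifePath.shift s ∘ pathOf h.rcll) with hm₁
  set m₂ := ((((Pr a).restrict B).map (x s)).comap ((↑) : X → OnePoint X)).bind h.pathKernel
    with hm₂
  have h₁ : ∀ A, MeasurableSet A → m₁ A = Pr a (B ∩ {θ | (pathOf h.rcll θ).shift s ∈ A}) := by
    intro A hA
    rw [hm₁, Measure.map_apply hsp hA, Measure.restrict_apply (hsp hA), inter_comm]
    rfl
  have h₂ : ∀ A, MeasurableSet A →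
      m₂ A = ∫⁻ θ in B, zeroExtend (fun b => h.pathKernel b A) (x s θ) ∂(Pr a) := by
    intro A hA
    rw [hm₂, Measure.bind_apply hA (Kernel.measurable _).aemeasurable,
      lintegral_comap_onePoint, lintegral_map
      (measurable_zeroExtend (Kernel.measurable_coe _ hA)) (h.measurable _)]
  have hpi : ∀ A ∈ finiteTimeSets X, m₁ A = m₂ A := by
    intro A hA
    have hAm := measurableSet_of_mem_finiteTimeSets hA
    obtain ⟨l, hl, hlw⟩ := exists_visitSet_of_mem_finiteTimeSets hA
    have h3 := h.measure_inter_visitSet a l hl s hB hB'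
    rw [h₁ A hAm, h₂ A hAm]
    simp only [h.pathKernel_apply_of_forall hAm hl hlw, hlw]
    exact h3
  have huniv : (univ : Set (LifePath X)) ∈ finiteTimeSets X :=
    ⟨∅, fun _ => univ, fun _ => MeasurableSet.univ, by simp⟩
  have heq : m₁ = m₂ := ext_of_generate_finite _ generateFrom_finiteTimeSets
    isPiSystem_finiteTimeSets hpi (hpi _ huniv)
  rw [← h₁ A hA, ← h₂ A hA, heq]

/-! ### Invariance -/

section Invariance

variable {K : Type*} [Group K] [TopologicalSpace K] [MulAction K X] [ContinuousConstSMul K X]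

theorem IsRcllWithLifetime.map {w : ℝ≥0 → OnePoint X} (hw : IsRcllWithLifetime w) (φ : X ≃ₜ X) :
    IsRcllWithLifetime fun t => φ.onePointCongr (w t) where
  absorbed s t hst hs := by
    have h1 : φ.onePointCongr OnePoint.infty = OnePoint.infty := rfl
    rw [← h1] at hs ⊢
    rw [hw.absorbed s t hst (φ.onePointCongr.injective hs)]
  right_cont t := φ.onePointCongr.continuous.continuousAt.comp_continuousWithinAt (hw.right_cont t)
  left_lim t ht := by
    obtain ⟨a, ha⟩ := hw.left_lim t fun h => ht (by rw [h]; rfl)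
    exact ⟨φ a, (φ.onePointCongr.continuous.tendsto _).comp ha⟩

/-- The action of `K` on paths. -/
def LifePath.smul (k : K) (w : LifePath X) : LifePath X := ⟨_, w.2.map (Homeomorph.smul k)⟩

theorem measurable_lifePath_smul (k : K) : Measurable (LifePath.smul k : LifePath X → LifePath X) :=
  Measurable.subtype_mk (measurable_pi_lambda _ fun t =>
    (Homeomorph.smul k).onePointCongr.continuous.measurable.comp (measurable_lifePath_eval t))

theorem IsInvariantSemigroup.map_smul [HasOuterApproxClosed X] (hP : IsInvariantSemigroup K P)
    (hs : IsSubMarkovSemigroup P) (t : ℝ≥0) (k : K) (a : X) :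
    P t (k • a) = (P t a).map (k • ·) := by
  have := hs.isFiniteKernel t
  refine ext_of_forall_integral_eq_of_IsFiniteMeasure fun f => ?_
  rw [integral_map (measurable_const_smul k).aemeasurable
    f.continuous.measurable.aestronglyMeasurable, hP t f k a]

theorem IsInvariantSemigroup.visitProb_smul [HasOuterApproxClosed X]
    (hP : IsInvariantSemigroup K P) (hs : IsSubMarkovSemigroup P) (k : K) :
    ∀ {l : List (ℝ≥0 × Set X)}, (∀ p ∈ l, MeasurableSet p.2) → ∀ a,
      visitProb P l (k • a) = visitProb P (l.map fun p => (p.1, (k • ·) ⁻¹' p.2)) a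
  | [], _, _ => rfl
  | p :: l, hl, a => by
    have hl' : ∀ q ∈ l, MeasurableSet q.2 := fun q hq => hl q (List.mem_cons_of_mem _ hq)
    change ∫⁻ c in p.2, visitProb P l c ∂(P p.1 (k • a)) = ∫⁻ c in (k • ·) ⁻¹' p.2, _ ∂(P p.1 a)
    rw [hP.map_smul hs, setLIntegral_map (hl p List.mem_cons_self) (measurable_visitProb hl')
      (measurable_const_smul k)]
    simp only [hP.visitProb_smul hs k hl']

theorem smul_mem_visitSet (k : K) : ∀ (l : List (ℝ≥0 × Set X)) (w : ℝ≥0 → OnePoint X),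
    (fun t => (Homeomorph.smul k : X ≃ₜ X).onePointCongr (w t)) ∈ visitSet l ↔
      w ∈ visitSet (l.map fun p => (p.1, (k • ·) ⁻¹' p.2))
  | [], _ => Iff.rfl
  | p :: l, w => by
    have h1 := smul_mem_visitSet k l fun r => w (p.1 + r)
    have h2 : (Homeomorph.smul k : X ≃ₜ X).onePointCongr (w p.1) ∈ ((↑) : X → OnePoint X) '' p.2 ↔
        w p.1 ∈ ((↑) : X → OnePoint X) '' ((k • ·) ⁻¹' p.2) := by
      constructor
      · rintro ⟨b, hb, hbw⟩
        rcases hq : w p.1 with _ | c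
        · rw [hq] at hbw
          exact absurd hbw (OnePoint.coe_ne_infty b)
        · rw [hq] at hbw
          have : b = k • c := OnePoint.coe_injective hbw
          exact ⟨c, by rw [this] at hb; exact hb, rfl⟩
      · rintro ⟨c, hc, hcw⟩
        rw [← hcw]
        exact ⟨k • c, hc, rfl⟩
    exact and_congr h2 h1

/-- Invariance of the semigroup gives equality of the finite-dimensional probabilities, and these
determine the law on path space. -/
theorem IsMarkovProcess.pathKernel_smul [HasOuterApproxClosed X]
    (h : IsMarkovProcess P x Pr) (hP : IsInvariantSemigroup K P) (k : K) (a : X) :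
    h.pathKernel (k • a) = (h.pathKernel a).map (LifePath.smul k) := by
  have := h.isMarkovKernel_pathKernel
  have hpi : ∀ A ∈ finiteTimeSets X,
      h.pathKernel (k • a) A = (h.pathKernel a).map (LifePath.smul k) A := by
    intro A hA
    have hAm := measurableSet_of_mem_finiteTimeSets hA
    obtain ⟨l, hl, hlw⟩ := exists_visitSet_of_mem_finiteTimeSets hA
    rw [h.pathKernel_apply_of_forall hAm hl hlw, hP.visitProb_smul h.semigroup k hl,
      Measure.map_apply (measurable_lifePath_smul k) hAm]
    refine (h.pathKernel_apply_of_forall (measurable_lifePath_smul k hAm) ?_ (fun w => ?_) a).symm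
    · simp only [List.mem_map, forall_exists_index, and_imp]
      rintro _ p hp rfl
      exact measurable_const_smul k (hl p hp)
    · rw [mem_preimage, hlw, ← smul_mem_visitSet]
      rfl
  have huniv : (univ : Set (LifePath X)) ∈ finiteTimeSets X :=
    ⟨∅, fun _ => univ, fun _ => MeasurableSet.univ, by simp⟩
  exact ext_of_generate_finite _ generateFrom_finiteTimeSets
    isPiSystem_finiteTimeSets hpi (hpi _ huniv)

end Invariance

end Markov

end AngularPart

namespace AngularPart

/-! ### Survival in an open set: restarting, stopping and translating paths. -/

section Survival

variable {X : Type*} [TopologicalSpace X] [MeasurableSpace X] [BorelSpace X] {O : Set X} {w : ℝ≥0 → OnePoint X}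

/-- A strict inequality for the exit time requires some margin after `T`. Right continuity at `T`
keeps the path in a compact subset of `O` for a short while, and since that set is closed in the
one-point compactification, the left limits there stay in `O` too. -/
theorem survives_iff [T2Space X] [LocallyCompactSpace X] (hO : IsOpen O)
    (hw : IsRcllWithLifetime w) {T : ℝ≥0} : Survives O T w ↔
      ∀ t ≤ T, w t ∈ ((↑) : X → OnePoint X) '' O ∧
        (0 < t → ∃ a ∈ O, Tendsto w (𝓝[<] t) (𝓝 (a : OnePoint X))) := by
  refine ⟨fun h t ht => not_exit h t ht, fun h => ⟨(h 0 zero_le).1, ?_⟩⟩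
  obtain ⟨a, ha, haw⟩ := (h T le_rfl).1
  obtain ⟨C, hC, haC, hCO⟩ := exists_compact_subset hO ha
  have hCcl : IsClosed (((↑) : X → OnePoint X) '' C) := (hC.image OnePoint.continuous_coe).isClosed
  have hnb : ((↑) : X → OnePoint X) '' C ∈ 𝓝 (w T) := by
    rw [← haw]
    exact OnePoint.isOpenEmbedding_coe.image_mem_nhds.2 (mem_interior_iff_mem_nhds.1 haC)
  obtain ⟨b, hb, hbU⟩ := (mem_nhdsGE_iff_exists_Ico_subset' (lt_add_one T)).1
    ((hw.right_cont T).tendsto hnb)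
  have hbU' : ∀ s, T ≤ s → s < b → w s ∈ ((↑) : X → OnePoint X) '' C := fun s h1 h2 => hbU ⟨h1, h2⟩
  have hbO : ∀ s < b, w s ∈ ((↑) : X → OnePoint X) '' O := by
    intro s hs
    rcases le_total s T with h1 | h1
    · exact (h s h1).1
    · exact image_mono hCO (hbU' s h1 hs)
  have hlife : (b : ℝ≥0∞) ≤ lifetime w := by
    refine le_sInf ?_
    rintro _ ⟨s, rfl, hs⟩
    by_contra hlt
    push Not at hlt
    obtain ⟨c, -, hc⟩ := hbO s (by exact_mod_cast hlt)
    rw [hs] at hc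
    exact OnePoint.coe_ne_infty c hc
  refine lt_of_lt_of_le (b := (b : ℝ≥0∞)) (by exact_mod_cast hb) (le_sInf ?_)
  rintro _ ⟨s, rfl, h0, hs⟩
  by_contra hlt
  push Not at hlt
  have hsb : s < b := by exact_mod_cast hlt
  rcases hs with hs | hs | hs
  · exact hs (hbO s hsb)
  · apply hs
    rcases le_or_gt s T with h1 | h1
    · exact (h s h1).2 h0
    · have hne : w s ≠ OnePoint.infty := by
        obtain ⟨c, -, hc⟩ := hbO s hsb
        rw [← hc]
        exact OnePoint.coe_ne_infty c
      obtain ⟨c, hc⟩ := hw.left_lim s hne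
      have hnb : (𝓝[<] s).NeBot := nhdsLT_neBot_of_exists_lt ⟨0, h0⟩
      have : ((c : X) : OnePoint X) ∈ ((↑) : X → OnePoint X) '' C := by
        refine hCcl.mem_of_tendsto hc ?_
        filter_upwards [Ioo_mem_nhdsLT h1] with u hu
        exact hbU' u hu.1.le (hu.2.trans hsb)
      obtain ⟨c', hc', he⟩ := this
      rw [OnePoint.coe_injective he] at hc'
      exact ⟨c, hCO hc', hc⟩
  · exact absurd (hlife.trans hs) (not_le.2 hlt)

theorem survives_add_iff [T2Space X] [LocallyCompactSpace X] (hO : IsOpen O)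
    (hw : IsRcllWithLifetime w) (s u : ℝ≥0) : Survives O (s + u) w ↔
      Survives O s w ∧ Survives O u fun t => w (s + t) := by
  -- Left limits of the shifted path at a positive time are left limits of the original path. At
  -- time `0` of the shifted path there is no condition; the left limit at `s` is covered by
  -- survival up to `s`.
  have hlim : ∀ t, 0 < t → ∀ a : X, Tendsto (fun r => w (s + r)) (𝓝[<] t) (𝓝 (a : OnePoint X)) ↔
      Tendsto w (𝓝[<] (s + t)) (𝓝 (a : OnePoint X)) := by
    intro t ht a
    have hmap : map (fun r => s + r) (𝓝[<] t) = 𝓝[<] (s + t) := by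
      have hi : IsEmbedding (fun r : ℝ≥0 => s + r) :=
        (isometry_iff_dist_eq.2 fun a b => by simp [NNReal.dist_eq]).isEmbedding
      rw [hi.map_nhdsWithin_eq]
      have : (fun r => s + r) '' Iio t = Ico s (s + t) := by
        ext r
        constructor
        · rintro ⟨q, hq, rfl⟩
          exact ⟨le_self_add, add_lt_add_right (α := ℝ≥0) hq s⟩
        · rintro ⟨h1, h2⟩
          refine ⟨r - s, ?_, add_tsub_cancel_of_le h1⟩
          exact (tsub_lt_iff_left h1).2 h2
      rw [this]
      exact nhdsWithin_Ico_eq_nhdsLT (lt_add_of_pos_right s ht)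
    rw [← hmap, tendsto_map'_iff]
    rfl
  rw [survives_iff hO hw, survives_iff hO hw, survives_iff hO (hw.shift s)]
  constructor
  · refine fun h => ⟨fun t ht => h t (ht.trans le_self_add), fun t ht => ?_⟩
    have h1 := h (s + t) (add_le_add_right ht s)
    refine ⟨h1.1, fun h0 => ?_⟩
    obtain ⟨a, ha, hat⟩ := h1.2 (lt_of_lt_of_le h0 le_add_self)
    exact ⟨a, ha, (hlim t h0 a).2 hat⟩
  · rintro ⟨h1, h2⟩ t ht
    rcases le_or_gt t s with hts | hts
    · exact h1 t hts
    · have h3 := h2 (t - s) (tsub_le_iff_left.2 ht)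
      have h4 : s + (t - s) = t := add_tsub_cancel_of_le hts.le
      have h5 : 0 < t - s := tsub_pos_of_lt hts
      obtain ⟨a, ha, hat⟩ := h3.2 h5
      rw [hlim _ h5, h4] at hat
      rw [h4] at h3
      exact ⟨h3.1, fun _ => ⟨a, ha, hat⟩⟩

/-- The stopped path uses values up to time `s` only, so statements about it are automatically
measurable for the past of `s`. -/
theorem IsRcllWithLifetime.stopped (hw : IsRcllWithLifetime w) (s : ℝ≥0) :
    IsRcllWithLifetime fun t => w (min t s) where
  absorbed u t hut := hw.absorbed _ _ (min_le_min_right s hut)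
  right_cont t := by
    have h1 : ContinuousWithinAt (fun t : ℝ≥0 => min t s) (Ici t) t :=
      (continuous_id.min continuous_const).continuousWithinAt
    exact ContinuousWithinAt.comp (f := fun t => min t s) (x := t) (hw.right_cont (min t s)) h1
      fun u hu => min_le_min_right s hu
  left_lim t ht := by
    rcases le_or_gt t s with hts | hts
    · rw [min_eq_left hts] at ht
      obtain ⟨a, ha⟩ := hw.left_lim t ht
      refine ⟨a, ha.congr' ?_⟩
      filter_upwards [self_mem_nhdsWithin] with u hu
      rw [min_eq_left ((show u < t from hu).le.trans hts)]
    · rw [min_eq_right hts.le] at ht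
      obtain ⟨a, ha⟩ := OnePoint.ne_infty_iff_exists.1 ht
      refine ⟨a, tendsto_const_nhds.congr' ?_⟩
      filter_upwards [Ioo_mem_nhdsLT hts] with u hu
      rw [min_eq_right hu.1.le, ha]

theorem survives_stopped_iff [T2Space X] [LocallyCompactSpace X] (hO : IsOpen O)
    (hw : IsRcllWithLifetime w) (s : ℝ≥0) :
    Survives O s (fun t => w (min t s)) ↔ Survives O s w := by
  rw [survives_iff hO hw, survives_iff hO (hw.stopped s)]
  refine forall₂_congr fun t ht => ?_
  rw [min_eq_left ht]
  refine and_congr Iff.rfl (forall_congr' fun _ => ?_)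
  refine exists_congr fun a => and_congr Iff.rfl (tendsto_congr' ?_)
  filter_upwards [self_mem_nhdsWithin] with u hu
  rw [min_eq_left ((show u < t from hu).le.trans ht)]

theorem Survives.map [T2Space X] [LocallyCompactSpace X] (hO : IsOpen O)
    (hw : IsRcllWithLifetime w) {T : ℝ≥0} (hs : Survives O T w) (φ : X ≃ₜ X)
    (hφ : ∀ a ∈ O, φ a ∈ O) : Survives O T fun t => φ.onePointCongr (w t) := by
  rw [survives_iff hO hw] at hs
  rw [survives_iff hO (hw.map φ)]
  intro t ht
  obtain ⟨⟨a, ha, hat⟩, h2⟩ := hs t ht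
  refine ⟨⟨φ a, hφ a ha, ?_⟩, fun h0 => ?_⟩
  · rw [← hat]; rfl
  · obtain ⟨b, hb, hbt⟩ := h2 h0
    exact ⟨φ b, hφ b hb, (φ.onePointCongr.continuous.tendsto _).comp hbt⟩

end Survival

end AngularPart

namespace AngularPart

attribute [local instance] onePointBorel borelSpace_onePoint

/-! ### Polar decomposition of paths: symmetry and the Markov property. -/

section Polar

variable {n d : ℕ}
  {X : Type*} [TopologicalSpace X] [T2Space X] [SecondCountableTopology X] [LocallyCompactSpace X]
  [HasOuterApproxClosed X] [ChartedSpace (EuclideanSpace ℝ (Fin n)) X]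
  {K : Type*} [TopologicalSpace K] [ChartedSpace (EuclideanSpace ℝ (Fin d)) K] [Group K]
  [LieGroup (𝓡 d) ∞ K] [IsTopologicalGroup K]
  [PolishSpace K] [MeasurableSpace K] [BorelSpace K]
  [MulAction K X] [ContMDiffSMul (𝓡 d) (𝓡 n) ∞ K X] [ContinuousSMul K X]
  {EY HY : Type*} [NormedAddCommGroup EY] [NormedSpace ℝ EY] [FiniteDimensional ℝ EY]
  [TopologicalSpace HY] {IY : ModelWithCorners ℝ EY HY} {Y : Set X} [ChartedSpace HY Y]
  [IsManifold IY ∞ Y] {M : Subgroup K} [CompactSpace M] [PolishSpace (K ⧸ M)]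
  [MeasurableSpace X] [BorelSpace X] [MeasurableSpace (K ⧸ M)] [BorelSpace (K ⧸ M)]

/-- An orbit meets `Y` in one point, which fixes the radial part; the stabilizer of that point is
`M`, which fixes the coset. -/
theorem IsTransversal.polar_unique (h : IsTransversal (n := n) (d := d) IY Y M)
    {y y' : IY.interior Y} {k k' : K} (he : k • ((y : Y) : X) = k' • ((y' : Y) : X)) :
    y = y' ∧ (k : K ⧸ M) = k' := by
  have hy : y = y' := by
    have : ((y : Y) : X) ∈ MulAction.orbit K ((y' : Y) : X) ∩ Y := by
      refine ⟨⟨k⁻¹ * k', ?_⟩, (y : Y).2⟩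
      simp only [mul_smul, ← he, inv_smul_smul]
    rw [h.orbit_inter _ (y' : Y).2] at this
    exact Subtype.ext (Subtype.ext this)
  subst hy
  refine ⟨rfl, QuotientGroup.eq.2 ?_⟩
  rw [← h.stabilizer_eq _ y.2, MulAction.mem_stabilizer_iff, mul_smul, ← he, inv_smul_smul]

/-- `polarPath` is obtained by choice; uniqueness of polar coordinates identifies it for stopped,
shifted and translated paths. -/
theorem IsTransversal.polarPath_eq (h : IsTransversal (n := n) (d := d) IY Y M) {T : ℝ≥0}
    {w : ℝ≥0 → OnePoint X} (hw : IsRcllWithLifetime w) (hs : Survives (regularPart K IY Y) T w)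
    (r : RcllPath T (IY.interior Y) × RcllPath T (K ⧸ M))
    (hr : ∀ t : Icc (0 : ℝ≥0) T, ∃ k : K, (k : K ⧸ M) = r.2.1 t ∧
      ((k • ((r.1.1 t : Y) : X) : X) : OnePoint X) = w t) : h.polarPath hw hs = r := by
  have key : ∀ t, (h.polarPath hw hs).1.1 t = r.1.1 t ∧ (h.polarPath hw hs).2.1 t = r.2.1 t := by
    intro t
    obtain ⟨k, hk, hkw⟩ := h.polarPath_spec hw hs t
    obtain ⟨k', hk', hkw'⟩ := hr t
    rw [← hkw'] at hkw
    have := h.polar_unique (OnePoint.coe_injective hkw)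
    rw [← hk, ← hk']
    exact this
  exact Prod.ext (Subtype.ext (funext fun t => (key t).1)) (Subtype.ext (funext fun t => (key t).2))

theorem smul_mem_regularPart (k : K) {a : X} (ha : a ∈ regularPart K IY Y) :
    k • a ∈ regularPart K IY Y := by
  obtain ⟨y, k', rfl⟩ := mem_regularPart ha
  exact mem_iUnion.2 ⟨y, k * k', mul_smul _ _ _⟩

/-- The paths that survive up to time `T` with polar decomposition in `A`. -/
def IsTransversal.polarSet (h : IsTransversal (n := n) (d := d) IY Y M) (T : ℝ≥0)
    (A : Set (RcllPath T (IY.interior Y) × RcllPath T (K ⧸ M))) : Set (LifePath X) :=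
  {w | ∃ hs : Survives (regularPart K IY Y) T w.1, h.polarPath w.2 hs ∈ A}

section

variable {Ω : Type*} [MeasurableSpace Ω] {x : ℝ≥0 → Ω → OnePoint X}

theorem IsTransversal.measurableSet_preimage_polarSet
    (h : IsTransversal (n := n) (d := d) IY Y M) (T : ℝ≥0)
    (hm : ∀ t, Measurable (x t)) (hx : ∀ θ, IsRcllWithLifetime (fun t => x t θ))
    {A : Set (RcllPath T (IY.interior Y) × RcllPath T (K ⧸ M))} (hA : MeasurableSet A) :
    MeasurableSet (pathOf hx ⁻¹' h.polarSet T A) := by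
  have h1 := measurableSet_survives hm hx h.isOpen_regularPart T
  have h2 := (MeasurableEmbedding.subtype_coe h1).measurableSet_image.2
    (h.measurable_polarPath (T := T) hm hx hA)
  convert h2 using 1
  ext θ
  constructor
  · rintro ⟨hs, hA⟩
    exact ⟨⟨θ, hs⟩, hA, rfl⟩
  · rintro ⟨⟨θ, hs⟩, hA, rfl⟩
    exact ⟨hs, hA⟩

theorem IsTransversal.measurableSet_polarSet (h : IsTransversal (n := n) (d := d) IY Y M) (T : ℝ≥0)
    {A : Set (RcllPath T (IY.interior Y) × RcllPath T (K ⧸ M))} (hA : MeasurableSet A) :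
    MeasurableSet (h.polarSet T A) :=
  h.measurableSet_preimage_polarSet (Ω := LifePath X) (x := fun t w => w.1 t) T
    measurable_lifePath_eval (fun w => w.2) hA

theorem IsTransversal.lintegral_pathLaw (h : IsTransversal (n := n) (d := d) IY Y M) (T : ℝ≥0)
    (hm : ∀ t, Measurable (x t)) (hx : ∀ θ, IsRcllWithLifetime (fun t => x t θ)) (Q : Measure Ω)
    {F : RcllPath T (IY.interior Y) × RcllPath T (K ⧸ M) → ℝ≥0∞} (hF : Measurable F)
    {G : Ω → ℝ≥0∞} (hG : ∀ θ (hs : Survives (regularPart K IY Y) T fun t => x t θ),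
      G θ = F (h.polarPath (hx θ) hs)) :
    ∫⁻ r, F r ∂(h.pathLaw T hx Q)
      = ∫⁻ θ in {θ | Survives (regularPart K IY Y) T fun t => x t θ}, G θ ∂Q := by
  have h1 := measurableSet_survives hm hx h.isOpen_regularPart T
  rw [IsTransversal.pathLaw, lintegral_map hF (h.measurable_polarPath hm hx),
    ← lintegral_subtype_comap h1]
  exact lintegral_congr fun θ => (hG θ θ.2).symm

theorem IsTransversal.pathLaw_apply (h : IsTransversal (n := n) (d := d) IY Y M) (T : ℝ≥0)
    (hm : ∀ t, Measurable (x t)) (hx : ∀ θ, IsRcllWithLifetime (fun t => x t θ)) (Q : Measure Ω)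
    {A : Set (RcllPath T (IY.interior Y) × RcllPath T (K ⧸ M))} (hA : MeasurableSet A) :
    h.pathLaw T hx Q A = Q (pathOf hx ⁻¹' h.polarSet T A) := by
  have h1 := measurableSet_survives hm hx h.isOpen_regularPart T
  rw [IsTransversal.pathLaw, Measure.map_apply (h.measurable_polarPath hm hx) hA]
  refine ((MeasurableEmbedding.subtype_coe h1).comap_apply _ _).trans ?_
  congr 1
  ext θ
  constructor
  · rintro ⟨⟨θ, hs⟩, hA, rfl⟩
    exact ⟨hs, hA⟩
  · rintro ⟨hs, hA⟩
    exact ⟨⟨θ, hs⟩, hA, rfl⟩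

/-- The event that the path up to time `T` has its polar decomposition in `A` is determined by the
path up to time `T`. -/
theorem IsTransversal.measurableSet_pastSigma (h : IsTransversal (n := n) (d := d) IY Y M)
    (T : ℝ≥0) (hx : ∀ θ, IsRcllWithLifetime (fun t => x t θ))
    {A : Set (RcllPath T (IY.interior Y) × RcllPath T (K ⧸ M))} (hA : MeasurableSet A) :
    MeasurableSet[pastSigma x T] (pathOf hx ⁻¹' h.polarSet T A) := by
  -- The general measurability statement is applied to the process stopped at `T`, with `pastSigma x
  -- T` as the σ-algebra on `Ω`.
  have h1 := @IsTransversal.measurableSet_preimage_polarSet n d X _ _ _ _ _ _ K _ _ _ _ _ _ _ _ _ _ _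
    EY HY _ _ _ _ IY Y _ _ M _ _ _ _ _ _ Ω (pastSigma x T) (fun t => x (min t T)) h T
    (fun t => measurable_pastSigma (min_le_right _ _)) (fun θ => (hx θ).stopped T) A hA
  convert h1 using 1
  ext θ
  have h2 : ∀ (hs : Survives (regularPart K IY Y) T fun t => x t θ)
      (hs' : Survives (regularPart K IY Y) T fun t => x (min t T) θ),
      h.polarPath ((hx θ).stopped T) hs' = h.polarPath (hx θ) hs := by
    intro hs hs'
    refine h.polarPath_eq _ _ _ fun t => ?_
    rw [min_eq_left t.2.2]
    exact h.polarPath_spec (hx θ) hs t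
  constructor
  · rintro ⟨hs, hA⟩
    have hs' := (survives_stopped_iff h.isOpen_regularPart (hx θ) T).2 hs
    refine ⟨hs', ?_⟩
    change h.polarPath ((hx θ).stopped T) hs' ∈ A
    rw [h2 hs hs']
    exact hA
  · rintro ⟨hs', hA⟩
    have hs := (survives_stopped_iff h.isOpen_regularPart (hx θ) T).1 hs'
    refine ⟨hs, ?_⟩
    change h.polarPath (hx θ) hs ∈ A
    rw [← h2 hs hs']
    exact hA

end

theorem IsTransversal.smul_mem_polarSet_iff (h : IsTransversal (n := n) (d := d) IY Y M) {T : ℝ≥0}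
    (k : K) (A : Set (RcllPath T (IY.interior Y) × RcllPath T (K ⧸ M))) (w : LifePath X) :
    w.smul k ∈ h.polarSet T A ↔ w ∈ h.polarSet T (Prod.map id (smulPath k) ⁻¹' A) := by
  have h1 : ∀ (hs : Survives (regularPart K IY Y) T w.1)
      (hs' : Survives (regularPart K IY Y) T (w.smul k).1),
      h.polarPath (w.smul k).2 hs' = Prod.map id (smulPath k) (h.polarPath w.2 hs) := by
    intro hs hs'
    refine h.polarPath_eq _ _ _ fun t => ?_
    obtain ⟨l, hl, hlw⟩ := h.polarPath_spec w.2 hs t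
    refine ⟨k * l, ?_, ?_⟩
    · change ((k * l : K) : K ⧸ M) = k • (h.polarPath w.2 hs).2.1 t
      rw [← hl]
      rfl
    · change _ = (Homeomorph.smul k).onePointCongr (w.1 t)
      rw [← hlw, mul_smul]
      rfl
  have h2 : ∀ (w : LifePath X) (k : K), Survives (regularPart K IY Y) T w.1 →
      Survives (regularPart K IY Y) T (w.smul k).1 := fun w k hs =>
    hs.map h.isOpen_regularPart w.2 (Homeomorph.smul k) fun a ha => smul_mem_regularPart k ha
  constructor
  · rintro ⟨hs', hA⟩
    have hs : Survives (regularPart K IY Y) T w.1 := by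
      have := h2 _ k⁻¹ hs'
      convert this using 1
      funext t
      change _ = (Homeomorph.smul k⁻¹).onePointCongr ((Homeomorph.smul k).onePointCongr (w.1 t))
      rcases w.1 t with _ | a
      · rfl
      · exact congrArg (fun a : X => (a : OnePoint X)) (inv_smul_smul k a).symm
    exact ⟨hs, by rw [h1 hs hs'] at hA; exact hA⟩
  · rintro ⟨hs, hA⟩
    exact ⟨h2 w k hs, by rw [h1 hs (h2 w k hs)]; exact hA⟩

/-- Survival up to `s + u` splits into survival up to `s` and survival of the shifted path up to
`u`, and by uniqueness the polar paths of the two pieces are the windows of the whole polar path. -/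
theorem IsTransversal.window_mem_polarSet_iff (h : IsTransversal (n := n) (d := d) IY Y M)
    {s u T : ℝ≥0} (hT : s + u = T) (h₁ : 0 + s ≤ T) (h₂ : s + u ≤ T)
    (A : Set (RcllPath s (IY.interior Y) × RcllPath s (K ⧸ M)))
    (B : Set (RcllPath u (IY.interior Y) × RcllPath u (K ⧸ M))) (w : LifePath X) :
    w ∈ h.polarSet T (Prod.map (window 0 h₁) (window 0 h₁) ⁻¹' A ∩
        Prod.map (window s h₂) (window s h₂) ⁻¹' B) ↔
      w ∈ h.polarSet s A ∧ w.shift s ∈ h.polarSet u B := by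
  subst hT
  have hiff : Survives (regularPart K IY Y) (s + u) w.1 ↔
      Survives (regularPart K IY Y) s w.1 ∧ Survives (regularPart K IY Y) u (w.shift s).1 :=
    survives_add_iff h.isOpen_regularPart w.2 s u
  have h3 : ∀ (hs : Survives (regularPart K IY Y) (s + u) w.1)
      (hs' : Survives (regularPart K IY Y) s w.1), h.polarPath w.2 hs'
        = Prod.map (window 0 h₁) (window 0 h₁) (h.polarPath w.2 hs) := by
    intro hs hs'
    refine h.polarPath_eq _ _ _ fun t => ?_
    have := h.polarPath_spec w.2 hs (shiftTime 0 h₁ t)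
    rw [show ((shiftTime 0 h₁ t : Icc (0 : ℝ≥0) (s + u)) : ℝ≥0) = t from zero_add _] at this
    exact this
  have h4 : ∀ (hs : Survives (regularPart K IY Y) (s + u) w.1)
      (hs' : Survives (regularPart K IY Y) u (w.shift s).1), h.polarPath (w.shift s).2 hs'
        = Prod.map (window s h₂) (window s h₂) (h.polarPath w.2 hs) := by
    intro hs hs'
    refine h.polarPath_eq _ _ _ fun t => ?_
    exact h.polarPath_spec w.2 hs (shiftTime s h₂ t)
  constructor
  · rintro ⟨hs, hA, hB⟩
    refine ⟨⟨(hiff.1 hs).1, ?_⟩, ⟨(hiff.1 hs).2, ?_⟩⟩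
    · rw [h3 hs]; exact hA
    · change h.polarPath (w.shift s).2 _ ∈ B
      rw [h4 hs]; exact hB
  · rintro ⟨⟨hs₁, hA⟩, ⟨hs₂, hB⟩⟩
    have hs := hiff.2 ⟨hs₁, hs₂⟩
    refine ⟨hs, ?_, ?_⟩
    · rw [h3 hs] at hA; exact hA
    · have hB' : h.polarPath (w.shift s).2 hs₂ ∈ B := hB
      rw [h4 hs] at hB'; exact hB'

/-! ### The laws of the polar decomposition -/

/-- The point `z y` of `X` with radial part `y` and angular part `z`. -/
def polarPoint (a : IY.interior Y × (K ⧸ M)) : X := a.2.out • ((a.1 : Y) : X)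

/-- The chosen representative of the coset differs from `k` by an element of `M`, which fixes `y`.
-/
theorem IsTransversal.polarPoint_mk (h : IsTransversal (n := n) (d := d) IY Y M)
    (y : IY.interior Y) (k : K) : polarPoint (y, (k : K ⧸ M)) = k • ((y : Y) : X) := by
  obtain ⟨m, hm⟩ := QuotientGroup.mk_out_eq_mul M k
  have : (m : K) • ((y : Y) : X) = y := by
    rw [← MulAction.mem_stabilizer_iff, h.stabilizer_eq _ y.2]
    exact m.2
  change ((k : K ⧸ M).out : K) • ((y : Y) : X) = _
  rw [hm, mul_smul, this]

theorem IsTransversal.continuous_polarPoint (h : IsTransversal (n := n) (d := d) IY Y M) :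
    Continuous (polarPoint : IY.interior Y × (K ⧸ M) → X) := by
  have hq : IsOpenQuotientMap
      (Prod.map id (fun k : K => (k : K ⧸ M)) : IY.interior Y × K → IY.interior Y × (K ⧸ M)) :=
    IsOpenQuotientMap.id.prodMap QuotientGroup.isOpenQuotientMap_mk
  rw [hq.isQuotientMap.continuous_iff]
  have : (polarPoint ∘ Prod.map id (fun k : K => (k : K ⧸ M)) : IY.interior Y × K → X)
      = fun p => p.2 • ((p.1 : Y) : X) := funext fun p => h.polarPoint_mk p.1 p.2
  rw [this]
  fun_prop

variable {Ω : Type*} [MeasurableSpace Ω] {P : ℝ≥0 → Kernel X X} {x : ℝ≥0 → Ω → OnePoint X}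
  {Pr : X → Measure Ω}

theorem IsTransversal.pathLaw_eq_pathKernel (h : IsTransversal (n := n) (d := d) IY Y M)
    (hx : IsMarkovProcess P x Pr) (T : ℝ≥0) (a : X)
    {A : Set (RcllPath T (IY.interior Y) × RcllPath T (K ⧸ M))} (hA : MeasurableSet A) :
    h.pathLaw T hx.rcll (Pr a) A = hx.pathKernel a (h.polarSet T A) := by
  rw [h.pathLaw_apply T hx.measurable hx.rcll _ hA, hx.pathKernel_apply,
    Measure.map_apply (measurable_pathOf hx.measurable hx.rcll) (h.measurableSet_polarSet T hA)]

/-- The law of the radial and the angular path on `ζ > T` as a kernel from `Y° × (K/M)`. -/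
def IsTransversal.polarKernel (h : IsTransversal (n := n) (d := d) IY Y M)
    (hx : IsMarkovProcess P x Pr) (T : ℝ≥0) :
    Kernel (IY.interior Y × (K ⧸ M)) (RcllPath T (IY.interior Y) × RcllPath T (K ⧸ M)) where
  toFun a := h.pathLaw T hx.rcll (Pr (polarPoint a))
  measurable' := by
    refine Measure.measurable_of_measurable_coe _ fun A hA => ?_
    simp only [h.pathLaw_eq_pathKernel hx T _ hA]
    exact (Kernel.measurable_coe _ (h.measurableSet_polarSet T hA)).comp
      h.continuous_polarPoint.measurable

theorem IsTransversal.polarKernel_apply (h : IsTransversal (n := n) (d := d) IY Y M)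
    (hx : IsMarkovProcess P x Pr) (T : ℝ≥0) (a : IY.interior Y × (K ⧸ M)) :
    h.polarKernel hx T a = h.pathLaw T hx.rcll (Pr (polarPoint a)) := rfl

theorem IsTransversal.isFiniteKernel_polarKernel (h : IsTransversal (n := n) (d := d) IY Y M)
    (hx : IsMarkovProcess P x Pr) (T : ℝ≥0) : IsFiniteKernel (h.polarKernel hx T) := by
  have := hx.isMarkovKernel_pathKernel
  refine ⟨1, ENNReal.one_lt_top, fun a => ?_⟩
  rw [h.polarKernel_apply, h.pathLaw_eq_pathKernel hx T _ MeasurableSet.univ]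
  exact prob_le_one

theorem IsTransversal.polarKernel_smul (h : IsTransversal (n := n) (d := d) IY Y M)
    (hx : IsMarkovProcess P x Pr) (hP : IsInvariantSemigroup K P) (T : ℝ≥0) (k : K)
    (y : IY.interior Y) (z : K ⧸ M) :
    h.polarKernel hx T (y, k • z)
      = (h.polarKernel hx T (y, z)).map (Prod.map id (smulPath k)) := by
  obtain ⟨l, rfl⟩ := QuotientGroup.mk_surjective z
  have hm : Measurable (Prod.map id (smulPath k) :
      RcllPath T (IY.interior Y) × RcllPath T (K ⧸ M) → _) :=
    measurable_id.prodMap (measurable_smulPath k)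
  refine Measure.ext fun A hA => ?_
  have h1 : polarPoint (y, k • (l : K ⧸ M)) = k • (l • ((y : Y) : X)) := by
    rw [← mul_smul]
    exact h.polarPoint_mk y (k * l)
  rw [h.polarKernel_apply, h1, h.pathLaw_eq_pathKernel hx T _ hA, hx.pathKernel_smul hP,
    Measure.map_apply (measurable_lifePath_smul k) (h.measurableSet_polarSet T hA),
    Measure.map_apply hm hA, h.polarKernel_apply, h.polarPoint_mk,
    h.pathLaw_eq_pathKernel hx T _ (hm hA)]
  congr 1
  ext w
  exact h.smul_mem_polarSet_iff k A w

theorem IsTransversal.ae_polarKernel_start (h : IsTransversal (n := n) (d := d) IY Y M)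
    (hx : IsMarkovProcess P x Pr) (T : ℝ≥0) (a : IY.interior Y × (K ⧸ M)) :
    ∀ᵐ r ∂(h.polarKernel hx T a), r.1.1 firstTime = a.1 ∧ r.2.1 firstTime = a.2 := by
  obtain ⟨y, z⟩ := a
  obtain ⟨l, rfl⟩ := QuotientGroup.mk_surjective z
  have hA : MeasurableSet {r : RcllPath T (IY.interior Y) × RcllPath T (K ⧸ M) |
      ¬ (r.1.1 firstTime = y ∧ r.2.1 firstTime = (l : K ⧸ M))} :=
    (MeasurableSet.inter ((measurable_eval _).comp measurable_fst (measurableSet_singleton y))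
      ((measurable_eval _).comp measurable_snd (measurableSet_singleton (l : K ⧸ M)))).compl
  rw [ae_iff, h.polarKernel_apply, h.polarPoint_mk,
    h.pathLaw_apply T hx.measurable hx.rcll _ hA]
  refine measure_mono_null ?_ (ae_iff.1 (hx.start (l • ((y : Y) : X))))
  rintro θ ⟨hs, hne⟩ h0
  obtain ⟨k, hk, hkx⟩ := h.polarPath_spec (hx.rcll θ) hs firstTime
  have h1 : ((k • (((h.polarPath (hx.rcll θ) hs).1.1 firstTime : Y) : X) : X) : OnePoint X)
      = ((l • ((y : Y) : X) : X) : OnePoint X) := hkx.trans h0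
  have h2 := h.polar_unique (OnePoint.coe_injective h1)
  exact hne ⟨h2.1, hk.symm.trans h2.2⟩

/-- The Markov property at time `s` in polar coordinates: on survival up to `s`, the point `x s` is
the `polarPoint` of the two end values, so the law of the restarted process is a function of these
values. -/
theorem IsTransversal.map_polarKernel (h : IsTransversal (n := n) (d := d) IY Y M)
    (hx : IsMarkovProcess P x Pr) {s u T : ℝ≥0} (hT : s + u = T) (h₁ : 0 + s ≤ T) (h₂ : s + u ≤ T)
    (a : IY.interior Y × (K ⧸ M)) :
    (h.polarKernel hx T a).map (fun r =>
        (Prod.map (window 0 h₁) (window 0 h₁) r, Prod.map (window s h₂) (window s h₂) r))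
      = (h.polarKernel hx s a) ⊗ₘ ((h.polarKernel hx u).comap
          (fun r => (r.1.1 lastTime, r.2.1 lastTime))
          (((measurable_eval _).comp measurable_fst).prodMk
            ((measurable_eval _).comp measurable_snd))) := by
  have := h.isFiniteKernel_polarKernel hx T
  have := h.isFiniteKernel_polarKernel hx s
  have := h.isFiniteKernel_polarKernel hx u
  have := hx.isProb
  have hw₁ := measurable_window (E := IY.interior Y) 0 h₁
  have hw₂ := measurable_window (E := K ⧸ M) 0 h₁
  have hw₃ := measurable_window (E := IY.interior Y) s h₂
  have hw₄ := measurable_window (E := K ⧸ M) s h₂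
  have hend : Measurable fun r : RcllPath s (IY.interior Y) × RcllPath s (K ⧸ M) =>
      (r.1.1 lastTime, r.2.1 lastTime) :=
    ((measurable_eval _).comp measurable_fst).prodMk ((measurable_eval _).comp measurable_snd)
  have hwA := hw₁.prodMap hw₂
  have hwB := hw₃.prodMap hw₄
  refine Measure.ext_prod fun {A B} hA hB => ?_
  rw [Measure.map_apply (hwA.prodMk hwB) (hA.prod hB), Measure.compProd_apply_prod hA hB]
  have hset : (fun r : RcllPath T (IY.interior Y) × RcllPath T (K ⧸ M) =>
      (Prod.map (window 0 h₁) (window 0 h₁) r, Prod.map (window s h₂) (window s h₂) r)) ⁻¹' A ×ˢ B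
      = Prod.map (window 0 h₁) (window 0 h₁) ⁻¹' A ∩
        Prod.map (window s h₂) (window s h₂) ⁻¹' B := rfl
  rw [hset, h.polarKernel_apply,
    h.pathLaw_apply T hx.measurable hx.rcll _ ((hwA hA).inter (hwB hB))]
  have hset' : pathOf hx.rcll ⁻¹' h.polarSet T (Prod.map (window 0 h₁) (window 0 h₁) ⁻¹' A ∩
        Prod.map (window s h₂) (window s h₂) ⁻¹' B)
      = pathOf hx.rcll ⁻¹' h.polarSet s A ∩
        {θ | (pathOf hx.rcll θ).shift s ∈ h.polarSet u B} := by
    ext θ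
    exact h.window_mem_polarSet_iff hT h₁ h₂ A B _
  have hpolar : ∀ θ (hs : Survives (regularPart K IY Y) s fun t => x t θ),
      x s θ = ((polarPoint ((h.polarPath (hx.rcll θ) hs).1.1 lastTime,
        (h.polarPath (hx.rcll θ) hs).2.1 lastTime) : X) : OnePoint X) := by
    intro θ hs
    obtain ⟨k, hk, hkx⟩ := h.polarPath_spec (hx.rcll θ) hs lastTime
    rw [← hk, h.polarPoint_mk]
    exact hkx.symm
  rw [hset', hx.measure_inter_shift _ s (h.measurableSet_pastSigma s hx.rcll hA)
    (fun θ hθ => ?_) (h.measurableSet_polarSet u hB)]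
  · have hF : Measurable fun r : RcllPath s (IY.interior Y) × RcllPath s (K ⧸ M) =>
        A.indicator (fun r => h.polarKernel hx u (r.1.1 lastTime, r.2.1 lastTime) B) r :=
      ((Kernel.measurable_coe _ hB).comp hend).indicator hA
    have hmA := h.measurableSet_preimage_polarSet s hx.measurable hx.rcll hA
    simp only [Kernel.comap_apply]
    rw [← lintegral_indicator hA, h.polarKernel_apply hx s,
      h.lintegral_pathLaw s hx.measurable hx.rcll _ hF
      (G := (pathOf hx.rcll ⁻¹' h.polarSet s A).indicator fun θ =>
        zeroExtend (fun b => hx.pathKernel b (h.polarSet u B)) (x s θ)),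
      setLIntegral_indicator hmA]
    · congr 2
      refine (inter_eq_left.2 ?_).symm
      rintro θ ⟨hs, -⟩
      exact hs
    · intro θ hs
      by_cases hA' : h.polarPath (hx.rcll θ) hs ∈ A
      · rw [indicator_of_mem hA', indicator_of_mem (show θ ∈ pathOf hx.rcll ⁻¹' h.polarSet s A from ⟨hs, hA'⟩), hpolar θ hs,
          zeroExtend_coe, h.polarKernel_apply, h.pathLaw_eq_pathKernel hx u _ hB]
      · rw [indicator_of_notMem hA', indicator_of_notMem]
        rintro ⟨hs', hA''⟩
        exact hA' hA''
  · obtain ⟨hs, -⟩ := hθ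
    rw [hpolar θ hs]
    exact mem_range_self _

end Polar

end AngularPart

namespace AngularPart

/-! ### Disintegration of the angular path over the radial path. -/

section Family

universe u

variable {K : Type u} [Group K] [TopologicalSpace K] [IsTopologicalGroup K] [PolishSpace K]
  [MeasurableSpace K] [BorelSpace K] {M : Subgroup K} [CompactSpace M]
  [MeasurableSpace (K ⧸ M)] [BorelSpace (K ⧸ M)] [PolishSpace (K ⧸ M)]
  {E : Type*} [TopologicalSpace E] [T2Space E] [TopologicalSpace.PseudoMetrizableSpace E]
  [SecondCountableTopology E] [MeasurableSpace E] [BorelSpace E]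

/-- The laws of the radial and the angular path on the time intervals `[0, r]`, as a function of
the starting point: they are equivariant under `K` and satisfy the Markov property. -/
structure IsPolarFamily
    (L : ∀ r : ℝ≥0, Kernel (E × (K ⧸ M)) (RcllPath r E × RcllPath r (K ⧸ M))) : Prop where
  finite : ∀ r, IsFiniteKernel (L r)
  smul : ∀ r (k : K) (y : E) (z : K ⧸ M),
    L r (y, k • z) = (L r (y, z)).map (Prod.map id (smulPath k))
  start : ∀ r a, ∀ᵐ p ∂(L r a), p.1.1 firstTime = a.1 ∧ p.2.1 firstTime = a.2
  markov : ∀ {s u T : ℝ≥0} (_ : s + u = T) (h₁ : 0 + s ≤ T) (h₂ : s + u ≤ T) (a : E × (K ⧸ M)),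
    (L T a).map (fun r =>
        (Prod.map (window 0 h₁) (window 0 h₁) r, Prod.map (window s h₂) (window s h₂) r))
      = (L s a) ⊗ₘ ((L u).comap (fun r => (r.1.1 lastTime, r.2.1 lastTime))
          (((measurable_eval _).comp measurable_fst).prodMk
            ((measurable_eval _).comp measurable_snd)))

theorem measurable_smulPath_uncurry {r : ℝ≥0} :
    Measurable fun p : K × RcllPath r (K ⧸ M) => smulPath p.1 p.2 :=
  measurable_rcllPath_iff.2 fun t => measurable_fst.smul ((measurable_eval t).comp measurable_snd)

theorem smulPath_smulPath {r : ℝ≥0} (k l : K) (q : RcllPath r (K ⧸ M)) :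
    smulPath k (smulPath l q) = smulPath (k * l) q :=
  Subtype.ext (funext fun t => (mul_smul k l (q.1 t)).symm)

variable {L : ∀ r : ℝ≥0, Kernel (E × (K ⧸ M)) (RcllPath r E × RcllPath r (K ⧸ M))}

/-- The law of both paths when the angular path starts at the base point. -/
def baseKernel (L : ∀ r : ℝ≥0, Kernel (E × (K ⧸ M)) (RcllPath r E × RcllPath r (K ⧸ M)))
    (r : ℝ≥0) : Kernel E (RcllPath r E × RcllPath r (K ⧸ M)) :=
  (L r).sectL ((1 : K) : K ⧸ M)

theorem IsPolarFamily.isFiniteKernel_baseKernel (hL : IsPolarFamily L) (r : ℝ≥0) :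
    IsFiniteKernel (baseKernel L r) := by
  have := hL.finite r
  unfold baseKernel
  infer_instance

/-- A conditional distribution of the angular path given the starting point and the radial path,
when the angular path starts at the base point. -/
def IsPolarFamily.condKernel (hL : IsPolarFamily L) (r : ℝ≥0) :
    Kernel (E × RcllPath r E) (RcllPath r (K ⧸ M)) :=
  haveI := hL.isFiniteKernel_baseKernel r
  (baseKernel L r).condKernel

instance IsPolarFamily.isMarkovKernel_condKernel (hL : IsPolarFamily L) (r : ℝ≥0) :
    IsMarkovKernel (hL.condKernel r) := by
  have := hL.isFiniteKernel_baseKernel r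
  unfold IsPolarFamily.condKernel
  infer_instance

theorem IsPolarFamily.measurable_condKernel_arg {r : ℝ≥0} :
    Measurable fun p : RcllPath r E => (p.1 firstTime, p) :=
  (measurable_eval _).prodMk measurable_id

/-- The conditional distribution of the angular path given the radial path and the starting point
of the angular path. -/
def IsPolarFamily.angularKernel (hL : IsPolarFamily L) (r : ℝ≥0) :
    Kernel (RcllPath r E × (K ⧸ M)) (RcllPath r (K ⧸ M)) :=
  (((cosetKernel M).comap Prod.snd measurable_snd) ×ₖ
    ((hL.condKernel r).comap (fun a : RcllPath r E × (K ⧸ M) => (a.1.1 firstTime, a.1))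
      (IsPolarFamily.measurable_condKernel_arg.comp measurable_fst))).map
        fun p => smulPath p.1 p.2

variable (hL : IsPolarFamily L)

instance IsPolarFamily.isMarkovKernel_angularKernel (r : ℝ≥0) :
    IsMarkovKernel (hL.angularKernel r) := by
  have := hL.isMarkovKernel_condKernel r
  exact Kernel.IsMarkovKernel.map _ measurable_smulPath_uncurry

theorem IsPolarFamily.lintegral_angularKernel (r : ℝ≥0) (p : RcllPath r E) (k : K)
    {F : RcllPath r (K ⧸ M) → ℝ≥0∞} (hF : Measurable F) :
    ∫⁻ q, F q ∂(hL.angularKernel r (p, (k : K ⧸ M)))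
      = ∫⁻ m, ∫⁻ q, F (smulPath (k * m) q) ∂(hL.condKernel r (p.1 firstTime, p))
          ∂(uniformMeasure M) := by
  have := hL.isMarkovKernel_condKernel r
  have hF' : Measurable fun p : K × RcllPath r (K ⧸ M) => F (smulPath p.1 p.2) :=
    hF.comp measurable_smulPath_uncurry
  rw [IsPolarFamily.angularKernel, Kernel.lintegral_map _ measurable_smulPath_uncurry _ hF,
    Kernel.lintegral_prod _ _ _ hF', Kernel.comap_apply, Kernel.comap_apply,
    lintegral_cosetKernel k hF'.lintegral_prod_right']

/-- Holds for every radial path, with no exceptional set: only the kernel started at the base coset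
comes from a disintegration, and other starting points are reached by translation. -/
theorem IsPolarFamily.angularKernel_smul (r : ℝ≥0) (p : RcllPath r E) (k : K) (z : K ⧸ M) :
    hL.angularKernel r (p, k • z) = (hL.angularKernel r (p, z)).map (smulPath k) := by
  obtain ⟨l, rfl⟩ := QuotientGroup.mk_surjective z
  refine Measure.ext_of_lintegral _ fun F hF => ?_
  rw [MulAction.Quotient.smul_coe, hL.lintegral_angularKernel r p _ hF,
    lintegral_map hF (measurable_smulPath k),
    hL.lintegral_angularKernel r p _ (F := fun q => F (smulPath k q))
      (hF.comp (measurable_smulPath k))]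
  simp [smulPath_smulPath, mul_assoc]

/-- The law of the radial path. -/
def radialKernel (L : ∀ r : ℝ≥0, Kernel (E × (K ⧸ M)) (RcllPath r E × RcllPath r (K ⧸ M)))
    (r : ℝ≥0) : Kernel E (RcllPath r E) :=
  (baseKernel L r).fst

theorem IsPolarFamily.isFiniteKernel_radialKernel (hL : IsPolarFamily L) (r : ℝ≥0) :
    IsFiniteKernel (radialKernel L r) := by
  have := hL.isFiniteKernel_baseKernel r
  unfold radialKernel
  infer_instance

theorem radialKernel_apply (r : ℝ≥0) (y : E) :
    radialKernel L r y = (L r (y, ((1 : K) : K ⧸ M))).map Prod.fst := by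
  rw [radialKernel, Kernel.fst_apply]
  rfl

/-- Translation acts on the angular coordinate alone, and `K` is transitive on `K ⧸ M`. -/
theorem IsPolarFamily.map_fst (hL : IsPolarFamily L) (r : ℝ≥0) (y : E) (z : K ⧸ M) :
    (L r (y, z)).map Prod.fst = radialKernel L r y := by
  obtain ⟨k, rfl⟩ := QuotientGroup.mk_surjective z
  have h1 : (k : K ⧸ M) = k • ((1 : K) : K ⧸ M) := by
    rw [MulAction.Quotient.smul_coe]; simp
  rw [radialKernel_apply, h1, hL.smul,
    Measure.map_map measurable_fst (measurable_id.prodMap (measurable_smulPath k))]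
  rfl

theorem IsPolarFamily.ae_radialKernel_start (hL : IsPolarFamily L) (r : ℝ≥0) (y : E) :
    ∀ᵐ p ∂(radialKernel L r y), p.1 firstTime = y := by
  rw [radialKernel_apply]
  refine (ae_map_iff measurable_fst.aemeasurable
    (p := fun p : RcllPath r E => p.1 firstTime = y)
    (measurable_eval firstTime (measurableSet_singleton y))).2 ?_
  filter_upwards [hL.start r (y, ((1 : K) : K ⧸ M))] with p hp using hp.1

/-- The disintegration has the starting point as an extra parameter. Almost surely this is the
initial value of the radial path, so the parameter can be read off the path, which yields one kernel
for all starting points. -/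
theorem IsPolarFamily.lintegral_base (r : ℝ≥0) (y : E)
    {F : RcllPath r E × RcllPath r (K ⧸ M) → ℝ≥0∞} (hF : Measurable F) :
    ∫⁻ x, F x ∂(L r (y, ((1 : K) : K ⧸ M)))
      = ∫⁻ p, ∫⁻ q, F (p, q) ∂(hL.condKernel r (p.1 firstTime, p)) ∂(radialKernel L r y) := by
  have := hL.isFiniteKernel_baseKernel r
  have := hL.isMarkovKernel_condKernel r
  have h1 : (radialKernel L r) ⊗ₖ (hL.condKernel r) = baseKernel L r :=
    (baseKernel L r).disintegrate (baseKernel L r).condKernel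
  have h2 : L r (y, ((1 : K) : K ⧸ M)) = baseKernel L r y := rfl
  have := hL.isFiniteKernel_radialKernel r
  rw [h2, ← h1, Kernel.lintegral_compProd _ _ _ hF]
  refine lintegral_congr_ae ?_
  filter_upwards [hL.ae_radialKernel_start r y] with p hp
  rw [hp]

/-- For `m` in `M`, starting at `k * m` is the same as starting at `k`, so the left side does not
change when it is averaged over `M`; the average of the translated disintegrations is
`angularKernel`. -/
theorem IsPolarFamily.lintegral_eq (r : ℝ≥0) (y : E) (z : K ⧸ M)
    {F : RcllPath r E × RcllPath r (K ⧸ M) → ℝ≥0∞} (hF : Measurable F) :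
    ∫⁻ x, F x ∂(L r (y, z))
      = ∫⁻ p, ∫⁻ q, F (p, q) ∂(hL.angularKernel r (p, z)) ∂(radialKernel L r y) := by
  have := hL.isMarkovKernel_condKernel r
  have := hL.isFiniteKernel_radialKernel r
  obtain ⟨k, rfl⟩ := QuotientGroup.mk_surjective z
  have hFk : ∀ k : K, Measurable fun x : RcllPath r E × RcllPath r (K ⧸ M) =>
      F (x.1, smulPath k x.2) := fun k =>
    hF.comp (measurable_fst.prodMk ((measurable_smulPath k).comp measurable_snd))
  have h1 : ∀ k : K, ∫⁻ x, F x ∂(L r (y, (k : K ⧸ M)))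
      = ∫⁻ p, ∫⁻ q, F (p, smulPath k q) ∂(hL.condKernel r (p.1 firstTime, p))
          ∂(radialKernel L r y) := by
    intro k
    have h2 : (k : K ⧸ M) = k • ((1 : K) : K ⧸ M) := by
      rw [MulAction.Quotient.smul_coe]; simp
    rw [h2, hL.smul, lintegral_map hF (measurable_id.prodMap (measurable_smulPath k))]
    exact hL.lintegral_base r y (hFk k)
  have h3 : ∀ᵐ m ∂(uniformMeasure M), ∫⁻ x, F x ∂(L r (y, (k : K ⧸ M)))
      = ∫⁻ p, ∫⁻ q, F (p, smulPath (k * m) q) ∂(hL.condKernel r (p.1 firstTime, p))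
          ∂(radialKernel L r y) := by
    filter_upwards [ae_mem_uniformMeasure M] with m hm
    rw [← h1 (k * m)]
    have : ((k * m : K) : K ⧸ M) = k := QuotientGroup.mk_mul_of_mem k hm
    rw [this]
  have h4 : ∫⁻ x, F x ∂(L r (y, (k : K ⧸ M)))
      = ∫⁻ _ : K, ∫⁻ x, F x ∂(L r (y, (k : K ⧸ M))) ∂(uniformMeasure M) := by
    rw [lintegral_const, measure_univ, mul_one]
  have hm : Measurable fun x : (K × RcllPath r E) × RcllPath r (K ⧸ M) =>
      F (x.1.2, smulPath (k * x.1.1) x.2) :=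
    hF.comp ((measurable_snd.comp measurable_fst).prodMk (measurable_smulPath_uncurry.comp
      (((measurable_const_mul k).comp (measurable_fst.comp measurable_fst)).prodMk measurable_snd)))
  have hm' : Measurable fun x : K × RcllPath r E =>
      ∫⁻ q, F (x.2, smulPath (k * x.1) q) ∂(hL.condKernel r (x.2.1 firstTime, x.2)) :=
    Measurable.lintegral_kernel_prod_right'
      (κ := (hL.condKernel r).comap (fun x : K × RcllPath r E => (x.2.1 firstTime, x.2))
        (IsPolarFamily.measurable_condKernel_arg.comp measurable_snd)) hm
  rw [h4, lintegral_congr_ae h3, lintegral_lintegral_swap hm'.aemeasurable]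
  refine lintegral_congr fun p => ?_
  rw [hL.lintegral_angularKernel r p k (F := fun q => F (p, q)) (hF.comp measurable_prodMk_left)]

theorem IsPolarFamily.eq_compProd (r : ℝ≥0) (y : E) (z : K ⧸ M) :
    L r (y, z) = (radialKernel L r y) ⊗ₘ ((hL.angularKernel r).sectL z) := by
  have := hL.isMarkovKernel_angularKernel r
  have := hL.isFiniteKernel_radialKernel r
  refine Measure.ext_of_lintegral _ fun F hF => ?_
  rw [Measure.lintegral_compProd hF, hL.lintegral_eq r y z hF]
  rfl

/-- The conditional distribution of the angular path is unique up to null sets. -/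
theorem IsPolarFamily.ae_eq_angularKernel (r : ℝ≥0) (y : E) (z : K ⧸ M)
    {R : Kernel (RcllPath r E × (K ⧸ M)) (RcllPath r (K ⧸ M))} [IsFiniteKernel R]
    (hR : L r (y, z) = (radialKernel L r y) ⊗ₘ (R.sectL z)) :
    ∀ᵐ p ∂(radialKernel L r y), R (p, z) = hL.angularKernel r (p, z) := by
  have := hL.isMarkovKernel_angularKernel r
  have := hL.isFiniteKernel_radialKernel r
  rw [hL.eq_compProd] at hR
  exact (Kernel.ae_eq_of_compProd_eq hR).symm

theorem IsPolarFamily.ae_angularKernel_start (r : ℝ≥0) (y : E) :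
    ∀ᵐ p ∂(radialKernel L r y), ∀ᵐ q ∂(hL.angularKernel r (p, ((1 : K) : K ⧸ M))),
      q.1 firstTime = ((1 : K) : K ⧸ M) := by
  have := hL.isMarkovKernel_angularKernel r
  have := hL.isFiniteKernel_radialKernel r
  have h := hL.start r (y, ((1 : K) : K ⧸ M))
  rw [hL.eq_compProd] at h
  filter_upwards [Measure.ae_ae_of_ae_compProd h] with p hp
  filter_upwards [hp] with q hq using hq.2

/-- Defining property of a conditional expectation given the radial path, for a fixed angular
starting point. -/
theorem IsPolarFamily.lintegral_cond (r : ℝ≥0) (a : E × (K ⧸ M))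
    {f : RcllPath r E → ℝ≥0∞} (hf : Measurable f) {h : RcllPath r (K ⧸ M) → ℝ≥0∞}
    (hh : Measurable h) :
    ∫⁻ x, f x.1 * h x.2 ∂(L r a)
      = ∫⁻ x, f x.1 * ∫⁻ q, h q ∂(hL.angularKernel r (x.1, a.2)) ∂(L r a) := by
  have := hL.isMarkovKernel_angularKernel r
  obtain ⟨y, z⟩ := a
  have hm : Measurable fun p : RcllPath r E => ∫⁻ q, h q ∂(hL.angularKernel r (p, z)) :=
    (hh.lintegral_kernel).comp measurable_prodMk_right
  rw [hL.lintegral_eq r y z (F := fun x => f x.1 * h x.2)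
      ((hf.comp measurable_fst).mul (hh.comp measurable_snd)),
    hL.lintegral_eq r y z (F := fun x => f x.1 * ∫⁻ q, h q ∂(hL.angularKernel r (x.1, z)))
      ((hf.comp measurable_fst).mul (hm.comp measurable_fst))]
  refine lintegral_congr fun p => ?_
  simp only [lintegral_const, measure_univ, mul_one]
  rw [lintegral_const_mul _ hh]

end Family

end AngularPart

namespace AngularPart

/-! ### One conditional step of the angular path. -/

section Windows

variable {E : Type*} [TopologicalSpace E] [MeasurableSpace E] {s u T : ℝ≥0}

/-- Each time lies in one of the two windows, so together they determine the whole path. -/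
theorem measurableSpace_le_comap_windows (hT : s + u = T) (h₁ : 0 + s ≤ T) (h₂ : s + u ≤ T) :
    (inferInstance : MeasurableSpace (RcllPath T E)) ≤ MeasurableSpace.comap
      (fun p : RcllPath T E => (window 0 h₁ p, window s h₂ p)) inferInstance := by
  have h : ∀ t, Measurable[MeasurableSpace.comap
      (fun p : RcllPath T E => (window 0 h₁ p, window s h₂ p)) inferInstance]
        fun p : RcllPath T E => p.1 t := by
    intro t
    have hW := comap_measurable (m := inferInstance) (fun p : RcllPath T E => (window 0 h₁ p, window s h₂ p))
    rcases le_total (t : ℝ≥0) s with hts | hts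
    · have h3 : (fun p : RcllPath T E => p.1 t)
          = (fun r : RcllPath s E × RcllPath u E => r.1.1 ⟨t, zero_le, hts⟩) ∘
            (fun p : RcllPath T E => (window 0 h₁ p, window s h₂ p)) := by
        funext p
        exact congrArg p.1 (Subtype.ext (zero_add (t : ℝ≥0)).symm)
      rw [h3]
      exact ((measurable_eval _).comp measurable_fst).comp hW
    · have htu : (t : ℝ≥0) - s ≤ u := tsub_le_iff_left.2 (hT ▸ t.2.2)
      have h3 : (fun p : RcllPath T E => p.1 t)
          = (fun r : RcllPath s E × RcllPath u E => r.2.1 ⟨t - s, zero_le, htu⟩) ∘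
            (fun p : RcllPath T E => (window 0 h₁ p, window s h₂ p)) := by
        funext p
        exact congrArg p.1 (Subtype.ext (add_tsub_cancel_of_le hts).symm)
      rw [h3]
      exact ((measurable_eval _).comp measurable_snd).comp hW
  have h' : Measurable[MeasurableSpace.comap
      (fun p : RcllPath T E => (window 0 h₁ p, window s h₂ p)) inferInstance]
        (Subtype.val : RcllPath T E → _) :=
    @measurable_pi_lambda _ _ _ (MeasurableSpace.comap
      (fun p : RcllPath T E => (window 0 h₁ p, window s h₂ p)) inferInstance) _ _ h
  exact h'.comap_le

theorem exists_eq_comp_windows (hT : s + u = T) (h₁ : 0 + s ≤ T) (h₂ : s + u ≤ T)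
    {f : RcllPath T E → ℝ≥0∞} (hf : Measurable f) :
    ∃ F : RcllPath s E × RcllPath u E → ℝ≥0∞, Measurable F ∧
      ∀ p, f p = F (window 0 h₁ p, window s h₂ p) := by
  have h := hf.mono (measurableSpace_le_comap_windows hT h₁ h₂) le_rfl
  obtain ⟨F, hF, hfF⟩ := h.exists_eq_measurable_comp
  exact ⟨F, hF, fun p => congrFun hfF p⟩

end Windows

section OneStep

universe u

variable {K : Type u} [Group K] [TopologicalSpace K] [IsTopologicalGroup K] [PolishSpace K]
  [MeasurableSpace K] [BorelSpace K] {M : Subgroup K} [CompactSpace M]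
  [MeasurableSpace (K ⧸ M)] [BorelSpace (K ⧸ M)] [PolishSpace (K ⧸ M)]
  {E : Type*} [TopologicalSpace E] [T2Space E] [TopologicalSpace.PseudoMetrizableSpace E]
  [SecondCountableTopology E] [MeasurableSpace E] [BorelSpace E]
  {L : ∀ r : ℝ≥0, Kernel (E × (K ⧸ M)) (RcllPath r E × RcllPath r (K ⧸ M))}

theorem IsPolarFamily.lintegral_windows (hL : IsPolarFamily L) {s v T : ℝ≥0} (hT : s + v = T)
    (h₁ : 0 + s ≤ T) (h₂ : s + v ≤ T) (a : E × (K ⧸ M))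
    {Φ : (RcllPath s E × RcllPath s (K ⧸ M)) × (RcllPath v E × RcllPath v (K ⧸ M)) → ℝ≥0∞}
    (hΦ : Measurable Φ) :
    ∫⁻ x, Φ ((window 0 h₁ x.1, window 0 h₁ x.2), (window s h₂ x.1, window s h₂ x.2)) ∂(L T a)
      = ∫⁻ x, ∫⁻ x', Φ (x, x') ∂(L v (x.1.1 lastTime, x.2.1 lastTime)) ∂(L s a) := by
  have := hL.finite s
  have := hL.finite v
  have h := congrArg (fun μ => ∫⁻ x, Φ x ∂μ) (hL.markov hT h₁ h₂ a)
  have hm : Measurable fun r : RcllPath T E × RcllPath T (K ⧸ M) =>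
      (Prod.map (window 0 h₁) (window 0 h₁) r, Prod.map (window s h₂) (window s h₂) r) :=
    ((measurable_window 0 h₁).prodMap (measurable_window 0 h₁)).prodMk
      ((measurable_window s h₂).prodMap (measurable_window s h₂))
  rw [lintegral_map hΦ hm, Measure.lintegral_compProd hΦ] at h
  exact h

/-- Conditioning the future radial path on the past of both paths. -/
theorem IsPolarFamily.exists_lintegral_past (hL : IsPolarFamily L) {s v T : ℝ≥0} (hT : s + v = T)
    (h₁ : 0 + s ≤ T) {f : RcllPath T E → ℝ≥0∞} (hf : Measurable f) :
    ∃ f' : RcllPath s E → ℝ≥0∞, Measurable f' ∧ ∀ (a : E × (K ⧸ M))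
      (G : RcllPath s E × RcllPath s (K ⧸ M) → ℝ≥0∞), Measurable G →
        ∫⁻ x, f x.1 * G (window 0 h₁ x.1, window 0 h₁ x.2) ∂(L T a)
          = ∫⁻ x, f' x.1 * G x ∂(L s a) := by
  have h₂ : s + v ≤ T := hT.le
  have := hL.isFiniteKernel_radialKernel v
  obtain ⟨F, hF, hfF⟩ := exists_eq_comp_windows hT h₁ h₂ hf
  -- The conditional expectation of `f` given both paths up to `s`. It is a function of the radial
  -- past alone, because by `map_fst` the law of the later radial path does not depend on the
  -- angular position at `s`.
  refine ⟨fun p => ∫⁻ p', F (p, p') ∂(radialKernel L v (p.1 lastTime)), ?_, fun a G hG => ?_⟩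
  · exact Measurable.lintegral_kernel_prod_right'
      (κ := (radialKernel L v).comap (fun p : RcllPath s E => p.1 lastTime) (measurable_eval _)) hF
  · simp only [hfF]
    rw [hL.lintegral_windows hT h₁ h₂ a (Φ := fun x => F (x.1.1, x.2.1) * G x.1)]
    · refine lintegral_congr fun x => ?_
      have hFx : Measurable fun p' => F (x.1, p') := hF.comp measurable_prodMk_left
      change ∫⁻ x' : RcllPath v E × RcllPath v (K ⧸ M), F (x.1, x'.1) * G x ∂_ = _
      rw [lintegral_mul_const (f := fun x' : RcllPath v E × RcllPath v (K ⧸ M) => F (x.1, x'.1)) _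
          (hFx.comp measurable_fst),
        ← hL.map_fst v (x.1.1 lastTime) (x.2.1 lastTime), lintegral_map hFx measurable_fst]
    · exact (hF.comp ((measurable_fst.comp measurable_fst).prodMk
        (measurable_fst.comp measurable_snd))).mul (hG.comp measurable_fst)

/-- The case where the increment ends at the final time: restart at `s`, then condition the
restarted angular path on the restarted radial path. -/
theorem IsPolarFamily.lintegral_step_last (hL : IsPolarFamily L) {s v T : ℝ≥0} (hT : s + v = T)
    (h₁ : 0 + s ≤ T) (h₂ : s + v ≤ T) (a : E × (K ⧸ M)) {f : RcllPath T E → ℝ≥0∞}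
    (hf : Measurable f) {g : RcllPath s (K ⧸ M) → ℝ≥0∞} (hg : Measurable g) {h : K ⧸ M → ℝ≥0∞}
    (hh : Measurable h) :
    ∫⁻ x, f x.1 * (g (window 0 h₁ x.2) * h (x.2.1 lastTime)) ∂(L T a)
      = ∫⁻ x, f x.1 * (g (window 0 h₁ x.2) * ∫⁻ q, h (q.1 lastTime)
          ∂(hL.angularKernel v (window s h₂ x.1, (window 0 h₁ x.2).1 lastTime))) ∂(L T a) := by
  obtain ⟨F, hF, hfF⟩ := exists_eq_comp_windows hT h₁ h₂ hf
  have hlast : ∀ q : RcllPath T (K ⧸ M), q.1 lastTime = (window s h₂ q).1 lastTime := fun q =>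
    congrArg q.1 (Subtype.ext hT.symm)
  have hh' : Measurable fun q : RcllPath v (K ⧸ M) => h (q.1 lastTime) :=
    hh.comp (measurable_eval _)
  have := hL.isMarkovKernel_angularKernel v
  have hH : Measurable fun b : RcllPath v E × (K ⧸ M) =>
      ∫⁻ q, h (q.1 lastTime) ∂(hL.angularKernel v b) := hh'.lintegral_kernel
  simp only [hfF, hlast]
  rw [hL.lintegral_windows hT h₁ h₂ a
      (Φ := fun x => F (x.1.1, x.2.1) * (g x.1.2 * h (x.2.2.1 lastTime))),
    hL.lintegral_windows hT h₁ h₂ a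
      (Φ := fun x => F (x.1.1, x.2.1) * (g x.1.2 * ∫⁻ q, h (q.1 lastTime)
          ∂(hL.angularKernel v (x.2.1, x.1.2.1 lastTime))))]
  · refine lintegral_congr fun x => ?_
    have hFx : Measurable fun p' => g x.2 * F (x.1, p') :=
      (hF.comp measurable_prodMk_left).const_mul _
    have h3 := hL.lintegral_cond v (x.1.1 lastTime, x.2.1 lastTime) hFx hh'
    simp only [mul_left_comm, ← mul_assoc] at h3 ⊢
    exact h3
  · exact (hF.comp ((measurable_fst.comp measurable_fst).prodMk
      (measurable_fst.comp measurable_snd))).mul ((hg.comp (measurable_snd.comp measurable_fst)).mul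
        (hH.comp ((measurable_fst.comp measurable_snd).prodMk
          ((measurable_eval _).comp (measurable_snd.comp measurable_fst)))))
  · exact (hF.comp ((measurable_fst.comp measurable_fst).prodMk
      (measurable_fst.comp measurable_snd))).mul ((hg.comp (measurable_snd.comp measurable_fst)).mul
        (hh'.comp (measurable_snd.comp measurable_snd)))

variable {T : ℝ≥0} {s t : Icc (0 : ℝ≥0) T}

theorem zero_add_le (s : Icc (0 : ℝ≥0) T) : 0 + (s : ℝ≥0) ≤ T := (zero_add (s : ℝ≥0)).le.trans s.2.2

theorem add_sub_le (hst : s ≤ t) : (s : ℝ≥0) + ((t : ℝ≥0) - s) ≤ T :=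
  (add_tsub_cancel_of_le (show (s : ℝ≥0) ≤ t from hst)).le.trans t.2.2

/-- The radial path after `t` carries no information about `z_t` beyond the past of the radial path:
integrating it out replaces `f` by the same `f'` on both sides. This leaves the case in which `t` is
the final time. -/
theorem IsPolarFamily.lintegral_step (hL : IsPolarFamily L) (hst : s ≤ t) (a : E × (K ⧸ M))
    {f : RcllPath T E → ℝ≥0∞} (hf : Measurable f)
    {g : RcllPath (s : ℝ≥0) (K ⧸ M) → ℝ≥0∞} (hg : Measurable g) {h : K ⧸ M → ℝ≥0∞}
    (hh : Measurable h) :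
    ∫⁻ x, f x.1 * (g (window 0 (zero_add_le s) x.2) * h (x.2.1 t)) ∂(L T a)
      = ∫⁻ x, f x.1 * (g (window 0 (zero_add_le s) x.2) * ∫⁻ q, h (q.1 lastTime)
          ∂(hL.angularKernel _ (window s (add_sub_le hst) x.1, x.2.1 s))) ∂(L T a) := by
  have hst' : (s : ℝ≥0) ≤ t := hst
  have hT : (t : ℝ≥0) + (T - t) = T := add_tsub_cancel_of_le t.2.2
  have hst2 : (s : ℝ≥0) + ((t : ℝ≥0) - s) = t := add_tsub_cancel_of_le hst'
  have h₁ : 0 + (s : ℝ≥0) ≤ t := (zero_add (s : ℝ≥0)).le.trans hst'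
  obtain ⟨f', hf', hff'⟩ := hL.exists_lintegral_past hT (zero_add_le t) hf
  have := hL.isMarkovKernel_angularKernel ((t : ℝ≥0) - s)
  have hh' : Measurable fun q : RcllPath ((t : ℝ≥0) - s) (K ⧸ M) => h (q.1 lastTime) :=
    hh.comp (measurable_eval _)
  have hH : Measurable fun b : RcllPath ((t : ℝ≥0) - s) E × (K ⧸ M) =>
      ∫⁻ q, h (q.1 lastTime) ∂(hL.angularKernel _ b) := hh'.lintegral_kernel
  have e1 : ∀ q : RcllPath T (K ⧸ M),
      window 0 (zero_add_le s) q = window 0 h₁ (window 0 (zero_add_le t) q) := fun q =>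
    Subtype.ext (funext fun r => congrArg q.1 (Subtype.ext (zero_add _).symm))
  have e2 : ∀ p : RcllPath T E,
      window s (add_sub_le hst) p = window s hst2.le (window 0 (zero_add_le t) p) := fun p =>
    Subtype.ext (funext fun r => congrArg p.1 (Subtype.ext (zero_add _).symm))
  have e3 : ∀ q : RcllPath T (K ⧸ M), q.1 t = (window 0 (zero_add_le t) q).1 lastTime := fun q =>
    congrArg q.1 (Subtype.ext (zero_add _).symm)
  have e4 : ∀ q : RcllPath T (K ⧸ M),
      q.1 s = (window 0 h₁ (window 0 (zero_add_le t) q)).1 lastTime := fun q =>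
    congrArg q.1 (Subtype.ext (by
      change (s : ℝ≥0) = 0 + (0 + (s : ℝ≥0))
      simp))
  simp only [e1, e2, e3, e4]
  have h3 := hff' a (fun x => g (window 0 h₁ x.2) * h (x.2.1 lastTime))
    ((hg.comp ((measurable_window 0 h₁).comp measurable_snd)).mul
      (hh.comp ((measurable_eval _).comp measurable_snd)))
  have h4 := hff' a (fun x => g (window 0 h₁ x.2) * ∫⁻ q, h (q.1 lastTime)
      ∂(hL.angularKernel _ (window s hst2.le x.1, (window 0 h₁ x.2).1 lastTime)))
    ((hg.comp ((measurable_window 0 h₁).comp measurable_snd)).mul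
      (hH.comp (((measurable_window s hst2.le).comp measurable_fst).prodMk
        ((measurable_eval _).comp ((measurable_window 0 h₁).comp measurable_snd)))))
  rw [h3, h4]
  exact hL.lintegral_step_last hst2 h₁ hst2.le a hf' hg hh

end OneStep

end AngularPart

namespace AngularPart

/-! ### Independent increments for almost every radial path. -/

section AlmostSure

universe u

variable {K : Type u} [Group K] [TopologicalSpace K] [IsTopologicalGroup K] [PolishSpace K]
  [MeasurableSpace K] [BorelSpace K] {M : Subgroup K} [CompactSpace M]
  [MeasurableSpace (K ⧸ M)] [BorelSpace (K ⧸ M)] [PolishSpace (K ⧸ M)] {T : ℝ≥0}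
  {s t : Icc (0 : ℝ≥0) T}

/-- The increment law is determined by the transition probabilities. -/
theorem incrementLaw_eq_of_transition {Q : Measure (RcllPath T (K ⧸ M))} [IsProbabilityMeasure Q]
    {ν : Measure (K ⧸ M)} [IsProbabilityMeasure ν] (hν : IsInvariantUnder M ν)
    (h : ∀ A, MeasurableSet[evalSigma (K ⧸ M) firstTime s] A → ∀ B, MeasurableSet B →
      Q (A ∩ {q | q.1 t ∈ B}) = ∫⁻ q in A, translateKernel ν (q.1 s) B ∂Q) :
    incrementLaw Q s t = ν := by
  have hpair : Q.map (fun q => (q.1 s, q.1 t)) = (Q.map fun q => q.1 s) ⊗ₘ translateKernel ν := by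
    have : IsProbabilityMeasure (Q.map fun q => (q.1 s, q.1 t)) :=
      Measure.isProbabilityMeasure_map (measurable_eval_pair s t).aemeasurable
    have : IsProbabilityMeasure (Q.map fun q => q.1 s) :=
      Measure.isProbabilityMeasure_map (measurable_eval s).aemeasurable
    refine Measure.ext_prod fun {A B} hA hB => ?_
    have hA' : MeasurableSet[evalSigma (K ⧸ M) firstTime s]
        ((fun q : RcllPath T (K ⧸ M) => q.1 s) ⁻¹' A) :=
      measurable_eval_evalSigma ⟨zero_le (a := (s : ℝ≥0)), le_rfl⟩ hA
    rw [Measure.map_apply (measurable_eval_pair s t) (hA.prod hB),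
      Measure.compProd_apply_prod hA hB,
      setLIntegral_map hA (Kernel.measurable_coe _ hB) (measurable_eval s), ← h _ hA' B hB]
    rfl
  have : IsProbabilityMeasure (Q.map fun q => q.1 s) :=
      Measure.isProbabilityMeasure_map (measurable_eval s).aemeasurable
  refine Measure.ext_of_lintegral _ fun f hf => ?_
  rw [incrementLaw, hpair,
    Measure.lintegral_bind (Kernel.measurable _).aemeasurable hf.aemeasurable,
    Measure.lintegral_compProd hf.lintegral_kernel]
  have h1 : ∀ z : K ⧸ M, ∫⁻ w, ∫⁻ v, f v ∂(incrementKernel M (z, w)) ∂(translateKernel ν z)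
      = ∫⁻ v, f v ∂ν := by
    intro z
    obtain ⟨k, rfl⟩ := QuotientGroup.mk_surjective z
    rw [hν.translateKernel_mk, lintegral_map
      (f := fun w => ∫⁻ v, f v ∂(incrementKernel M ((k : K ⧸ M), w)))
      (hf.lintegral_kernel.comp measurable_prodMk_left) (measurable_const_smul k),
      hν.lintegral_incrementKernel k hf]
  simp only [h1]
  rw [lintegral_const, measure_univ, mul_one]

variable {E : Type*} [TopologicalSpace E] [T2Space E] [TopologicalSpace.PseudoMetrizableSpace E]
  [SecondCountableTopology E] [MeasurableSpace E] [BorelSpace E]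
  {L : ∀ r : ℝ≥0, Kernel (E × (K ⧸ M)) (RcllPath r E × RcllPath r (K ⧸ M))}

/-- The conditional distribution of the increment between `s` and `t`, given the radial path
between `s` and `t`. -/
def IsPolarFamily.windowIncrement (hL : IsPolarFamily L) (hst : s ≤ t) (p : RcllPath T E) :
    Measure (K ⧸ M) :=
  (hL.angularKernel _ (window s (add_sub_le hst) p, ((1 : K) : K ⧸ M))).map fun q => q.1 lastTime

instance IsPolarFamily.isProbabilityMeasure_windowIncrement (hL : IsPolarFamily L) (hst : s ≤ t)
    (p : RcllPath T E) : IsProbabilityMeasure (hL.windowIncrement hst p) := by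
  have := hL.isMarkovKernel_angularKernel ((t : ℝ≥0) - s)
  exact Measure.isProbabilityMeasure_map (measurable_eval _).aemeasurable

theorem IsPolarFamily.measurable_windowIncrement (hL : IsPolarFamily L) (hst : s ≤ t) :
    Measurable[evalSigma E s t] (hL.windowIncrement hst) := by
  have h1 : Measurable fun p : RcllPath ((t : ℝ≥0) - s) E =>
      (hL.angularKernel _ (p, ((1 : K) : K ⧸ M))).map
        fun q : RcllPath ((t : ℝ≥0) - s) (K ⧸ M) => q.1 lastTime :=
    (Measure.measurable_map _ (measurable_eval _)).comp
      ((Kernel.measurable _).comp measurable_prodMk_right)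
  exact h1.comp (measurable_window_evalSigma hst (add_sub_le hst))

theorem IsPolarFamily.map_last_angularKernel (hL : IsPolarFamily L) (r : ℝ≥0) (p : RcllPath r E)
    (k : K) (z : K ⧸ M) :
    (hL.angularKernel r (p, k • z)).map (fun q => q.1 lastTime)
      = ((hL.angularKernel r (p, z)).map (fun q => q.1 lastTime)).map (k • ·) := by
  rw [hL.angularKernel_smul, Measure.map_map (measurable_eval _) (measurable_smulPath k),
    Measure.map_map (measurable_const_smul k) (measurable_eval _)]
  rfl

/-- Elements of `M` fix the base coset, so equivariance makes the law of the end point invariant. -/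
theorem IsPolarFamily.isInvariantUnder_windowIncrement (hL : IsPolarFamily L) (hst : s ≤ t)
    (p : RcllPath T E) : IsInvariantUnder M (hL.windowIncrement hst p) := by
  intro m hm
  rw [IsPolarFamily.windowIncrement, ← hL.map_last_angularKernel]
  have : m • ((1 : K) : K ⧸ M) = ((1 : K) : K ⧸ M) := by
    rw [MulAction.Quotient.smul_coe, smul_eq_mul, mul_one, QuotientGroup.eq]
    simpa using hm
  rw [this]

theorem IsPolarFamily.map_last_eq_translateKernel (hL : IsPolarFamily L) (hst : s ≤ t)
    (p : RcllPath T E) (z : K ⧸ M) :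
    (hL.angularKernel _ (window s (add_sub_le hst) p, z)).map (fun q => q.1 lastTime)
      = translateKernel (hL.windowIncrement hst p) z := by
  obtain ⟨k, rfl⟩ := QuotientGroup.mk_surjective z
  rw [(hL.isInvariantUnder_windowIncrement hst p).translateKernel_mk,
    IsPolarFamily.windowIncrement, ← hL.map_last_angularKernel]
  rw [MulAction.Quotient.smul_coe, smul_eq_mul, mul_one]

/-- The conditional distribution of the angular path when it starts at the base point. -/
def IsPolarFamily.baseLaw (hL : IsPolarFamily L) (T : ℝ≥0) :
    Kernel (RcllPath T E) (RcllPath T (K ⧸ M)) :=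
  (hL.angularKernel T).sectL ((1 : K) : K ⧸ M)

instance IsPolarFamily.isMarkovKernel_baseLaw (hL : IsPolarFamily L) (T : ℝ≥0) :
    IsMarkovKernel (hL.baseLaw T) := by
  have := hL.isMarkovKernel_angularKernel T
  unfold IsPolarFamily.baseLaw
  infer_instance

/-- The distribution of the angular path at the end of the time interval `[s, t]`, given the radial
path and the angular path at the time `s`. -/
def IsPolarFamily.stepKernel (hL : IsPolarFamily L) (hst : s ≤ t) :
    Kernel (RcllPath T E × RcllPath T (K ⧸ M)) (K ⧸ M) :=
  ((hL.angularKernel ((t : ℝ≥0) - s)).comap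
    (fun x => (window s (add_sub_le hst) x.1, x.2.1 s))
    (((measurable_window _ _).comp measurable_fst).prodMk
      ((measurable_eval s).comp measurable_snd))).map fun q => q.1 lastTime

instance IsPolarFamily.isMarkovKernel_stepKernel (hL : IsPolarFamily L) (hst : s ≤ t) :
    IsMarkovKernel (hL.stepKernel hst) := by
  have := hL.isMarkovKernel_angularKernel ((t : ℝ≥0) - s)
  exact Kernel.IsMarkovKernel.map _ (measurable_eval _)

theorem IsPolarFamily.lintegral_stepKernel (hL : IsPolarFamily L) (hst : s ≤ t)
    (x : RcllPath T E × RcllPath T (K ⧸ M)) {h : K ⧸ M → ℝ≥0∞} (hh : Measurable h) :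
    ∫⁻ z, h z ∂(hL.stepKernel hst x) = ∫⁻ q, h (q.1 lastTime)
      ∂(hL.angularKernel _ (window s (add_sub_le hst) x.1, x.2.1 s)) := by
  rw [IsPolarFamily.stepKernel, Kernel.lintegral_map _ (measurable_eval _) _ hh,
    Kernel.comap_apply]

/-- The identities for all radial, past and end point events together say that two kernels have the
same composition product with the radial law. As their target is countably generated, they agree off
a single null set, which does not depend on the past event or on the end point event. -/
theorem IsPolarFamily.ae_map_baseLaw (hL : IsPolarFamily L) (hst : s ≤ t) (y : E) :
    ∀ᵐ p ∂(radialKernel L T y),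
      (hL.baseLaw T p).map (fun q => (window 0 (zero_add_le s) q, q.1 t))
        = ((hL.baseLaw T p) ⊗ₘ ((hL.stepKernel hst).comap (Prod.mk p) measurable_prodMk_left)).map
          fun x => (window 0 (zero_add_le s) x.1, x.2) := by
  have := hL.isFiniteKernel_radialKernel T
  have := hL.isMarkovKernel_baseLaw T
  have := hL.isMarkovKernel_stepKernel hst
  have hm₁ : Measurable fun q : RcllPath T (K ⧸ M) => (window 0 (zero_add_le s) q, q.1 t) :=
    (measurable_window _ _).prodMk (measurable_eval t)
  have hm₂ : Measurable fun x : RcllPath T (K ⧸ M) × (K ⧸ M) =>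
      (window 0 (zero_add_le s) x.1, x.2) :=
    ((measurable_window _ _).comp measurable_fst).prodMk measurable_snd
  set κ₁ := (hL.baseLaw T).map fun q => (window 0 (zero_add_le s) q, q.1 t) with hκ₁
  set κ₂ := ((hL.baseLaw T) ⊗ₖ (hL.stepKernel hst)).map
    fun x => (window 0 (zero_add_le s) x.1, x.2) with hκ₂
  have : IsMarkovKernel κ₁ := Kernel.IsMarkovKernel.map _ hm₁
  have : IsMarkovKernel κ₂ := Kernel.IsMarkovKernel.map _ hm₂
  have heq : (radialKernel L T y) ⊗ₘ κ₁ = (radialKernel L T y) ⊗ₘ κ₂ := by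
    refine Measure.ext_prod₃ fun {A C B} hA hC hB => ?_
    set f : RcllPath T E → ℝ≥0∞ := A.indicator 1 with hfdef
    set g : RcllPath (s : ℝ≥0) (K ⧸ M) → ℝ≥0∞ := C.indicator 1 with hgdef
    set h : K ⧸ M → ℝ≥0∞ := B.indicator 1 with hhdef
    have hf : Measurable f := measurable_one.indicator hA
    have hg : Measurable g := measurable_one.indicator hC
    have hh : Measurable h := measurable_one.indicator hB
    have hind : ∀ x : RcllPath T E × RcllPath (s : ℝ≥0) (K ⧸ M) × (K ⧸ M),
        (A ×ˢ C ×ˢ B).indicator (1 : RcllPath T E × RcllPath (s : ℝ≥0) (K ⧸ M) × (K ⧸ M) → ℝ≥0∞) x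
          = f x.1 * (g x.2.1 * h x.2.2) := by
      rintro ⟨p, c, b⟩
      simp only [hfdef, hgdef, hhdef, indicator, mem_prod, Pi.one_apply]
      split_ifs <;> simp_all
    have hmF : Measurable fun x : RcllPath T E × RcllPath (s : ℝ≥0) (K ⧸ M) × (K ⧸ M) =>
        f x.1 *
          (g x.2.1 * h x.2.2) :=
      (hf.comp measurable_fst).mul ((hg.comp (measurable_fst.comp measurable_snd)).mul
        (hh.comp (measurable_snd.comp measurable_snd)))
    have hmFp : ∀ p, Measurable fun x : RcllPath (s : ℝ≥0) (K ⧸ M) × (K ⧸ M) =>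
        f p * (g x.1 * h x.2) := fun p => hmF.comp measurable_prodMk_left
    have hH : Measurable fun b : RcllPath T E × RcllPath T (K ⧸ M) =>
        ∫⁻ z, h z ∂(hL.stepKernel hst b) := hh.lintegral_kernel
    have hstep := hL.lintegral_step hst (y, ((1 : K) : K ⧸ M)) hf hg hh
    simp only [← hL.lintegral_stepKernel hst _ hh] at hstep
    rw [hL.lintegral_eq T y _ (F := fun x => f x.1 *
        (g (window 0 (zero_add_le s) x.2) * h (x.2.1 t))),
      hL.lintegral_eq T y _ (F := fun x => f x.1 *
        (g (window 0 (zero_add_le s) x.2) *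
          ∫⁻ z, h z ∂(hL.stepKernel hst x)))] at hstep
    · rw [← lintegral_indicator_one (hA.prod (hC.prod hB)), ← lintegral_indicator_one
        (hA.prod (hC.prod hB))]
      simp only [hind]
      rw [Measure.lintegral_compProd hmF, Measure.lintegral_compProd hmF]
      have h1 : ∀ p, ∫⁻ x, f p *
          (g x.1 * h x.2) ∂(κ₁ p)
          = ∫⁻ q, f p * (g (window 0 (zero_add_le s) q) *
            h (q.1 t)) ∂(hL.angularKernel T (p, ((1 : K) : K ⧸ M))) := by
        intro p
        rw [hκ₁, Kernel.lintegral_map _ hm₁ _ (hmFp p)]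
        rfl
      have h2 : ∀ p, ∫⁻ x, f p *
          (g x.1 * h x.2) ∂(κ₂ p)
          = ∫⁻ q, f p * (g (window 0 (zero_add_le s) q) *
            ∫⁻ z, h z ∂(hL.stepKernel hst (p, q)))
              ∂(hL.angularKernel T (p, ((1 : K) : K ⧸ M))) := by
        intro p
        rw [hκ₂, Kernel.lintegral_map _ hm₂ _ (hmFp p),
          Kernel.lintegral_compProd (f := fun x : RcllPath T (K ⧸ M) × (K ⧸ M) =>
              f p * (g (window 0 (zero_add_le s) x.1) * h x.2)) _ _ _ ((hmFp p).comp hm₂)]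
        refine lintegral_congr fun q => ?_
        dsimp only
        rw [lintegral_const_mul _ (hh.const_mul _), lintegral_const_mul _ hh]
      simp only [h1, h2]
      exact hstep
    · exact (hf.comp measurable_fst).mul ((hg.comp ((measurable_window _ _).comp
        measurable_snd)).mul hH)
    · exact (hf.comp measurable_fst).mul ((hg.comp ((measurable_window _ _).comp
        measurable_snd)).mul (hh.comp ((measurable_eval t).comp measurable_snd)))
  filter_upwards [Kernel.ae_eq_of_compProd_eq heq] with p hp
  rw [hκ₁, hκ₂, Kernel.map_apply _ hm₁, Kernel.map_apply _ hm₂,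
    Kernel.compProd_apply_eq_compProd_sectR] at hp
  exact hp

theorem IsPolarFamily.ae_transition (hL : IsPolarFamily L) (hst : s ≤ t) (y : E) :
    ∀ᵐ p ∂(radialKernel L T y), ∀ A, MeasurableSet[evalSigma (K ⧸ M) firstTime s] A →
      ∀ B, MeasurableSet B → hL.baseLaw T p (A ∩ {q | q.1 t ∈ B})
        = ∫⁻ q in A, (hL.stepKernel hst (p, q)) B ∂(hL.baseLaw T p) := by
  have := hL.isMarkovKernel_baseLaw T
  have := hL.isMarkovKernel_stepKernel hst
  have hm₁ : Measurable fun q : RcllPath T (K ⧸ M) => (window 0 (zero_add_le s) q, q.1 t) :=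
    (measurable_window _ _).prodMk (measurable_eval t)
  have hm₂ : Measurable fun x : RcllPath T (K ⧸ M) × (K ⧸ M) =>
      (window 0 (zero_add_le s) x.1, x.2) :=
    ((measurable_window _ _).comp measurable_fst).prodMk measurable_snd
  filter_upwards [hL.ae_map_baseLaw hst y] with p hp A hA B hB
  obtain ⟨A', hA', rfl⟩ := evalSigma_firstTime_le_comap (zero_add_le s) A hA
  have h := congrArg (fun μ => μ (A' ×ˢ B)) hp
  rw [Measure.map_apply hm₁ (hA'.prod hB), Measure.map_apply hm₂ (hA'.prod hB)] at h
  have h1 : (fun x : RcllPath T (K ⧸ M) × (K ⧸ M) => (window 0 (zero_add_le s) x.1, x.2)) ⁻¹'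
      A' ×ˢ B = (window 0 (zero_add_le s) ⁻¹' A') ×ˢ B := rfl
  rw [h1, Measure.compProd_apply_prod (measurable_window _ _ hA') hB] at h
  exact h

/-- For almost every radial path, the angular path has independent increments. -/
theorem IsPolarFamily.ae_incrementLaw_eq (hL : IsPolarFamily L) (hst : s ≤ t) (y : E) :
    ∀ᵐ p ∂(radialKernel L T y),
      incrementLaw (hL.baseLaw T p) s t = hL.windowIncrement hst p ∧
        HasIndepIncrement (hL.baseLaw T p) s t := by
  have := hL.isMarkovKernel_baseLaw T
  filter_upwards [hL.ae_transition hst y] with p hp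
  have := hL.isProbabilityMeasure_windowIncrement hst p
  have h1 : ∀ q, hL.stepKernel hst (p, q)
      = translateKernel (hL.windowIncrement hst p) (q.1 s) := by
    intro q
    rw [IsPolarFamily.stepKernel, Kernel.map_apply _ (measurable_eval _), Kernel.comap_apply]
    exact hL.map_last_eq_translateKernel hst p (q.1 s)
  simp only [h1] at hp
  have h2 := incrementLaw_eq_of_transition (hL.isInvariantUnder_windowIncrement hst p) hp
  refine ⟨h2, fun A hA B hB => ?_⟩
  rw [hp A hA B hB]
  simp only [h2]

/-- Only countably many null sets are needed, one for each pair of grid times; right continuity does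
the rest, path by path. -/
theorem IsPolarFamily.ae_hasIndepIncrement (hL : IsPolarFamily L) (y : E) :
    ∀ᵐ p ∂(radialKernel L T y), ∀ s t : Icc (0 : ℝ≥0) T, s ≤ t →
      HasIndepIncrement (hL.baseLaw T p) s t := by
  have := hL.isMarkovKernel_baseLaw T
  have h : ∀ᵐ p ∂(radialKernel L T y), ∀ s t : grid T, (s : Icc (0 : ℝ≥0) T) ≤ t →
      HasIndepIncrement (hL.baseLaw T p) (s : Icc (0 : ℝ≥0) T) t := by
    refine ae_all_iff.2 fun s => ae_all_iff.2 fun t => ?_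
    by_cases hst : (s : Icc (0 : ℝ≥0) T) ≤ t
    · filter_upwards [hL.ae_incrementLaw_eq hst y] with p hp _ using hp.2
    · exact Eventually.of_forall fun p h => absurd h hst
  filter_upwards [h] with p hp s t hst
  exact HasIndepIncrement.of_grid (fun s hs t ht hst => hp ⟨s, hs⟩ ⟨t, ht⟩ hst) hst

/-- For almost every radial path, the angular path that starts at `z` is a nonhomogeneous Lévy
process. -/
theorem IsPolarFamily.ae_isNonhomogeneousLevy (hL : IsPolarFamily L) (y : E) (z : K ⧸ M) :
    ∀ᵐ p ∂(radialKernel L T y), IsNonhomogeneousLevy (hL.angularKernel T (p, z))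
      (incrementLaw (hL.baseLaw T p)) := by
  have := hL.isMarkovKernel_baseLaw T
  obtain ⟨k, rfl⟩ := QuotientGroup.mk_surjective z
  filter_upwards [hL.ae_hasIndepIncrement y, hL.ae_angularKernel_start T y] with p hp h₀
  have h1 : hL.angularKernel T (p, (k : K ⧸ M)) = (hL.baseLaw T p).map (smulPath k) := by
    have h2 : (k : K ⧸ M) = k • ((1 : K) : K ⧸ M) := by
      rw [MulAction.Quotient.smul_coe]; simp
    rw [h2, hL.angularKernel_smul]
    rfl
  rw [h1]
  exact isNonhomogeneousLevy_map_smulPath hp h₀ k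

end AlmostSure

end AngularPart

namespace AngularPart

/-- For a compatible metric, a locally compact space is open in its completion: a compact
neighbourhood stays closed there and contains a neighbourhood of its point by density. Open subsets
of Polish spaces are Polish. -/
theorem polishSpace_of_locallyCompact (X : Type*) [TopologicalSpace X] [T2Space X]
    [LocallyCompactSpace X] [SecondCountableTopology X] : PolishSpace X := by
  let : MetricSpace X := TopologicalSpace.metrizableSpaceMetric X
  have : SecondCountableTopology (UniformSpace.Completion X) :=
    UniformSpace.secondCountable_of_separable _
  have hi : IsDenseEmbedding ((↑) : X → UniformSpace.Completion X) :=
    UniformSpace.Completion.isDenseEmbedding_coe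
  have ho : IsOpen (range ((↑) : X → UniformSpace.Completion X)) := by
    rw [isOpen_iff_mem_nhds]
    rintro _ ⟨a, rfl⟩
    obtain ⟨C, hC, haC⟩ := exists_compact_mem_nhds a
    rw [hi.isInducing.nhds_eq_comap, mem_comap] at haC
    obtain ⟨V, hV, hVC⟩ := haC
    obtain ⟨V', hV'V, hV', haV'⟩ := mem_nhds_iff.1 hV
    refine mem_of_superset (hV'.mem_nhds haV') ?_
    have h1 : V' ⊆ closure (V' ∩ range ((↑) : X → UniformSpace.Completion X)) :=
      hi.dense.open_subset_closure_inter hV'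
    have hCc : IsClosed (((↑) : X → UniformSpace.Completion X) '' C) :=
      (hC.image (UniformSpace.Completion.continuous_coe X)).isClosed
    refine h1.trans ((hCc.closure_subset_iff.2 ?_).trans (image_subset_range _ _))
    rintro _ ⟨hb, b, rfl⟩
    exact ⟨b, hVC (hV'V hb), rfl⟩
  have := ho.polishSpace
  exact hi.isEmbedding.toHomeomorph.isClosedEmbedding.polishSpace

/-! ### The conditional distribution and its increments for the given process. -/

section Main

variable {n d : ℕ}
  {X : Type*} [TopologicalSpace X] [T2Space X] [SecondCountableTopology X] [LocallyCompactSpace X]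
  [HasOuterApproxClosed X] [ChartedSpace (EuclideanSpace ℝ (Fin n)) X]
  {K : Type*} [TopologicalSpace K] [ChartedSpace (EuclideanSpace ℝ (Fin d)) K] [Group K]
  [LieGroup (𝓡 d) ∞ K] [IsTopologicalGroup K] [PolishSpace K] [MeasurableSpace K] [BorelSpace K]
  [MulAction K X] [ContMDiffSMul (𝓡 d) (𝓡 n) ∞ K X] [ContinuousSMul K X]
  {EY HY : Type*} [NormedAddCommGroup EY] [NormedSpace ℝ EY] [FiniteDimensional ℝ EY]
  [TopologicalSpace HY] {IY : ModelWithCorners ℝ EY HY} {Y : Set X} [ChartedSpace HY Y]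
  [IsManifold IY ∞ Y] {M : Subgroup K} [CompactSpace M] [PolishSpace (K ⧸ M)]
  [MeasurableSpace X] [BorelSpace X] [MeasurableSpace (K ⧸ M)] [BorelSpace (K ⧸ M)]
  {Ω : Type*} [MeasurableSpace Ω] {P : ℝ≥0 → Kernel X X} {x : ℝ≥0 → Ω → OnePoint X}
  {Pr : X → Measure Ω}

theorem IsTransversal.isPolarFamily (h : IsTransversal (n := n) (d := d) IY Y M)
    (hx : IsMarkovProcess P x Pr) (hP : IsInvariantSemigroup K P) :
    IsPolarFamily (h.polarKernel hx) where
  finite := h.isFiniteKernel_polarKernel hx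
  smul := h.polarKernel_smul hx hP
  start := h.ae_polarKernel_start hx
  markov hT h₁ h₂ a := h.map_polarKernel hx hT h₁ h₂ a

theorem IsTransversal.polarKernel_mk (h : IsTransversal (n := n) (d := d) IY Y M)
    (hx : IsMarkovProcess P x Pr) (T : ℝ≥0) (y : IY.interior Y) (k : K) :
    h.polarKernel hx T (y, (k : K ⧸ M)) = h.pathLaw T hx.rcll (Pr (k • ((y : Y) : X))) := by
  rw [h.polarKernel_apply, h.polarPoint_mk]

theorem IsTransversal.radialLaw_eq (h : IsTransversal (n := n) (d := d) IY Y M)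
    (hx : IsMarkovProcess P x Pr) (hP : IsInvariantSemigroup K P) (T : ℝ≥0) (y : IY.interior Y)
    (k : K) : h.radialLaw T hx.rcll (Pr (k • ((y : Y) : X)))
      = radialKernel (h.polarKernel hx) T y := by
  rw [IsTransversal.radialLaw, ← h.polarKernel_mk hx, (h.isPolarFamily hx hP).map_fst]

/-- Rectangles determine a finite measure on a product, so the defining identities of a conditional
distribution amount to a disintegration of the joint law for every starting point. -/
theorem IsTransversal.isAngularKernel_iff (h : IsTransversal (n := n) (d := d) IY Y M)
    (hx : IsMarkovProcess P x Pr) (hP : IsInvariantSemigroup K P) (T : ℝ≥0)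
    (R : Kernel (RcllPath T (IY.interior Y) × (K ⧸ M)) (RcllPath T (K ⧸ M))) :
    h.IsAngularKernel T hx.rcll Pr R ↔ IsMarkovKernel R ∧ ∀ y z,
      h.polarKernel hx T (y, z) = (radialKernel (h.polarKernel hx) T y) ⊗ₘ (R.sectL z) := by
  have hL := h.isPolarFamily hx hP
  have := h.isFiniteKernel_polarKernel hx T
  have := hL.isFiniteKernel_radialKernel T
  refine and_congr_right fun hR => ⟨fun hA y z => ?_, fun hA y k B F hB hF => ?_⟩
  · obtain ⟨k, rfl⟩ := QuotientGroup.mk_surjective z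
    refine Measure.ext_prod fun {B F} hB hF => ?_
    rw [h.polarKernel_mk, hA y k B F hB hF, h.radialLaw_eq hx hP,
      Measure.compProd_apply_prod hB hF]
    rfl
  · rw [← h.polarKernel_mk hx, hA y k, h.radialLaw_eq hx hP, Measure.compProd_apply_prod hB hF]
    rfl

theorem IsTransversal.isAngularKernel_angularKernel (h : IsTransversal (n := n) (d := d) IY Y M)
    (hx : IsMarkovProcess P x Pr) (hP : IsInvariantSemigroup K P) (T : ℝ≥0) :
    h.IsAngularKernel T hx.rcll Pr ((h.isPolarFamily hx hP).angularKernel T) :=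
  (h.isAngularKernel_iff hx hP T _).2
    ⟨inferInstance, fun y z => (h.isPolarFamily hx hP).eq_compProd T y z⟩

theorem IsTransversal.exists_increments (h : IsTransversal (n := n) (d := d) IY Y M)
    (hx : IsMarkovProcess P x Pr) (hP : IsInvariantSemigroup K P) (T : ℝ≥0)
    {R : Kernel (RcllPath T (IY.interior Y) × (K ⧸ M)) (RcllPath T (K ⧸ M))}
    (hR : h.IsAngularKernel T hx.rcll Pr R) :
    ∃ μ : RcllPath T (IY.interior Y) →
        Icc (0 : ℝ≥0) T → Icc (0 : ℝ≥0) T → Measure (K ⧸ M),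
      (∀ (y : IY.interior Y) (z : K ⧸ M),
        ∀ᵐ p ∂(h.radialLaw T hx.rcll (Pr ((y : Y) : X))),
          IsNonhomogeneousLevy (R (p, z)) (μ p)) ∧
      ∀ s t : Icc (0 : ℝ≥0) T, s ≤ t →
        ∃ ν : RcllPath T (IY.interior Y) → Measure (K ⧸ M),
          Measurable[evalSigma (IY.interior Y) s t] ν ∧
          ∀ y : IY.interior Y, ∀ᵐ p ∂(h.radialLaw T hx.rcll (Pr ((y : Y) : X))),
            μ p s t = ν p := by
  have hL := h.isPolarFamily hx hP
  obtain ⟨hRm, hRd⟩ := (h.isAngularKernel_iff hx hP T R).1 hR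
  have hrad : ∀ y : IY.interior Y, h.radialLaw T hx.rcll (Pr ((y : Y) : X))
      = radialKernel (h.polarKernel hx) T y := by
    intro y
    have := h.radialLaw_eq hx hP T y 1
    rwa [one_smul] at this
  simp only [hrad]
  -- The increment measures come from the constructed kernel, not from `R`, and involve no starting
  -- point. The window version depends on the chosen `s ≤ t` and is only a representative for that
  -- pair.
  refine ⟨fun p => incrementLaw (hL.baseLaw T p), fun y z => ?_, fun s t hst =>
    ⟨hL.windowIncrement hst, hL.measurable_windowIncrement hst, fun y => ?_⟩⟩
  · filter_upwards [hL.ae_eq_angularKernel T y z (hRd y z), hL.ae_isNonhomogeneousLevy y z]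
      with p hp hp'
    rw [hp]
    exact hp'
  · filter_upwards [hL.ae_incrementLaw_eq hst y] with p hp using hp.1

end Main

end AngularPart

open AngularPart

theorem theorem3 {n d : ℕ}
    {X : Type*} [TopologicalSpace X] [T2Space X] [SecondCountableTopology X]
    [ChartedSpace (EuclideanSpace ℝ (Fin n)) X] [IsManifold (𝓡 n) ∞ X]
    [MeasurableSpace X] [BorelSpace X]
    {K : Type*} [TopologicalSpace K] [T2Space K] [SecondCountableTopology K]
    [ChartedSpace (EuclideanSpace ℝ (Fin d)) K] [Group K] [LieGroup (𝓡 d) ∞ K]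
    [MulAction K X] [ContMDiffSMul (𝓡 d) (𝓡 n) ∞ K X]
    {EY HY : Type*} [NormedAddCommGroup EY] [NormedSpace ℝ EY] [FiniteDimensional ℝ EY]
    [TopologicalSpace HY] (IY : ModelWithCorners ℝ EY HY)
    (Y : Set X) [ChartedSpace HY Y] [IsManifold IY ∞ Y]
    (M : Subgroup K) [MeasurableSpace (K ⧸ M)] [BorelSpace (K ⧸ M)]
    (hY : IsTransversal (n := n) (d := d) IY Y M)
    {Ω : Type*} [MeasurableSpace Ω]
    (P : ℝ≥0 → Kernel X X) (x : ℝ≥0 → Ω → OnePoint X) (Pr : X → Measure Ω)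
    (hx : IsMarkovProcess P x Pr) (hP : IsInvariantSemigroup K P)
    (T : ℝ≥0) (hT : 0 < T) :
    (∃ R, hY.IsAngularKernel T hx.rcll Pr R) ∧
    ∀ R, hY.IsAngularKernel T hx.rcll Pr R →
      ∃ μ : RcllPath T (IY.interior Y) →
          Icc (0 : ℝ≥0) T → Icc (0 : ℝ≥0) T → Measure (K ⧸ M),
        (∀ (y : IY.interior Y) (z : K ⧸ M),
          ∀ᵐ p ∂(hY.radialLaw T hx.rcll (Pr ((y : Y) : X))),
            IsNonhomogeneousLevy (R (p, z)) (μ p)) ∧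
        ∀ s t : Icc (0 : ℝ≥0) T, s ≤ t →
          ∃ ν : RcllPath T (IY.interior Y) → Measure (K ⧸ M),
            Measurable[evalSigma (IY.interior Y) s t] ν ∧
            ∀ y : IY.interior Y, ∀ᵐ p ∂(hY.radialLaw T hx.rcll (Pr ((y : Y) : X))),
              μ p s t = ν p := by
  have : LocallyCompactSpace X := ChartedSpace.locallyCompactSpace (EuclideanSpace ℝ (Fin n)) X
  have : LocallyCompactSpace K := ChartedSpace.locallyCompactSpace (EuclideanSpace ℝ (Fin d)) K
  have : IsTopologicalGroup K := topologicalGroup_of_lieGroup (𝓡 d) ∞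
  have : ContinuousSMul K X := ContMDiffSMul.continuousSMul (I := 𝓡 d) (I' := 𝓡 n) ∞
  have : CompactSpace M := isCompact_iff_compactSpace.1 hY.compact
  have : IsClosed (M : Set K) := hY.compact.isClosed
  have : PolishSpace K := polishSpace_of_locallyCompact K
  have : PolishSpace (K ⧸ M) := polishSpace_of_locallyCompact (K ⧸ M)
  borelize K
  exact ⟨⟨_, hY.isAngularKernel_angularKernel hx hP T⟩, fun R hR =>
    hY.exists_increments hx hP T hR⟩
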